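/- Let $X$ be a topological space and let $\mathcal U=\{U_i\}_{i\in I}$ be a countable family of subsets of $X$ which is * a \emph{proper covering}: the interiors $\operatorname{int}U_i$ cover $X$ and the closures of the sets $U_i$ are compact; * \emph{star finite}: for every $i$ the intersection $U_i\cap U_j$ is non-empty for only finitely many $j$; * \emph{almost $l_1$-acyclic}: every non-empty intersection of finitely many elements of $\mathcal U$ is $l_1$-acyclic, except, perhaps, a single exceptional set $U_e$, which belongs to $\mathcal U$. Here a space is called $l_1$-acyclic (or boundedly acyclic) if its bounded cohomology with real coefficients is isomorphic to that of a point. Let $H^{\mathrm{cf}}_*(X)$ be the homology of the complex of compactly finite singular chains, i.e. of possibly infinite real singular chains $c=\sum_\sigma a_\sigma\sigma$ such that every compact subset of $X$ meets the images of only finitely many simplices $\sigma$ with $a_\sigma\neq0$. Let $\|c\|=\sum_\sigma|a_\sigma|\in[0,\infty]$, and for $h\in H^{\mathrm{cf}}_n(X)$ let $\|h\|$ be the infimum of $\|c\|$ over all compactly finite cycles $c$ representing $h$. Let $N$ be the nerve of $\mathcal U$, with a fixed linear order on its vertices, and for a simplex $\sigma$ of $N$ let $|\sigma|$ be the intersection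 of the elements of $\mathcal U$ corresponding to the vertices of $\sigma$. Let $H^{\mathrm{inf}}_*(N)$ be the homology of the complex of possibly infinite real simplicial chains of $N$. Let $T_\bullet$ be the total complex of the double complex with terms $\prod_{\sigma}C_q(|\sigma|)$, where $\sigma$ runs over all $p$-simplices of $N$ and $C_q$ denotes finite real singular $q$-chains. Summation of the chains in the column $p=0$ induces an isomorphism $\tau_*\colon H_*(T_\bullet)\to H^{\mathrm{cf}}_*(X)$, and the augmentations $C_0(|\sigma|)\to\mathbb R$ induce a homomorphism $\lambda_*\colon H_*(T_\bullet)\to H^{\mathrm{inf}}_*(N)$. The \emph{Leray homomorphism} is $l_{\mathcal U}=\lambda_*\circ\tau_*^{-1}\colon H^{\mathrm{cf}}_*(X)\to H^{\mathrm{inf}}_*(N)$. \textbf{Theorem.} If $h\in H^{\mathrm{cf}}_n(X)$, $n\ge0$, belongs to the kernel of $l_{\mathcal U}$, then $\|h\|<\infty$. -/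

import Mathlib

open scoped BigOperators ENNReal

noncomputable section

namespace LerayCF

/-! ### Homology of sequences of real vector spaces -/

section Homology

/-- The `n`-cycles of a complex `C 0 ← C 1 ← C 2 ← ⋯`; every element of `C 0` is a cycle. -/
def cycles (C : ℕ → Type*) [∀ n, AddCommGroup (C n)] [∀ n, Module ℝ (C n)]
    (d : ∀ n, C (n + 1) →ₗ[ℝ] C n) : ∀ n, Submodule ℝ (C n)
  | 0 => ⊤
  | n + 1 => LinearMap.ker (d n)

/-- The homology of a complex `C 0 ← C 1 ← C 2 ← ⋯`: cycles modulo boundaries. -/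
abbrev Homology (C : ℕ → Type*) [∀ n, AddCommGroup (C n)] [∀ n, Module ℝ (C n)]
    (d : ∀ n, C (n + 1) →ₗ[ℝ] C n) (n : ℕ) : Type _ :=
  cycles C d n ⧸ (LinearMap.range (d n)).submoduleOf (cycles C d n)

/-- The homology class of a cycle. -/
abbrev homologyClass (C : ℕ → Type*) [∀ n, AddCommGroup (C n)] [∀ n, Module ℝ (C n)]
    (d : ∀ n, C (n + 1) →ₗ[ℝ] C n) (n : ℕ) : cycles C d n →ₗ[ℝ] Homology C d n :=
  Submodule.mkQ _

theorem map_mem_cycles {C C' : ℕ → Type*} [∀ n, AddCommGroup (C n)] [∀ n, Module ℝ (C n)]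
    [∀ n, AddCommGroup (C' n)] [∀ n, Module ℝ (C' n)]
    {d : ∀ n, C (n + 1) →ₗ[ℝ] C n} {d' : ∀ n, C' (n + 1) →ₗ[ℝ] C' n}
    (f : ∀ n, C n →ₗ[ℝ] C' n) (hf : ∀ n x, f n (d n x) = d' n (f (n + 1) x)) :
    ∀ n, ∀ x ∈ cycles C d n, f n x ∈ cycles C' d' n
  | 0, _, _ => Submodule.mem_top
  | n + 1, x, hx => by
      have hx' : d n x = 0 := hx
      change d' n (f (n + 1) x) = 0
      rw [← hf, hx', map_zero]

/-- The linear map between homology spaces induced by a chain map. -/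
def homologyMap {C C' : ℕ → Type*} [∀ n, AddCommGroup (C n)] [∀ n, Module ℝ (C n)]
    [∀ n, AddCommGroup (C' n)] [∀ n, Module ℝ (C' n)]
    {d : ∀ n, C (n + 1) →ₗ[ℝ] C n} {d' : ∀ n, C' (n + 1) →ₗ[ℝ] C' n}
    (f : ∀ n, C n →ₗ[ℝ] C' n) (hf : ∀ n x, f n (d n x) = d' n (f (n + 1) x)) (n : ℕ) :
    Homology C d n →ₗ[ℝ] Homology C' d' n :=
  Submodule.mapQ _ _ ((f n).restrict (map_mem_cycles f hf n)) (by
    rintro ⟨x, hx⟩ ⟨y, hy⟩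
    exact ⟨f (n + 1) y, by rw [← hf, hy]; rfl⟩)

/-- The coboundaries of a cochain complex `C 0 → C 1 → C 2 → ⋯`. -/
def coboundaries (C : ℕ → Type*) [∀ n, AddCommGroup (C n)] [∀ n, Module ℝ (C n)]
    (d : ∀ n, C n →ₗ[ℝ] C (n + 1)) : ∀ n, Submodule ℝ (C n)
  | 0 => ⊥
  | n + 1 => LinearMap.range (d n)

/-- The cohomology of a cochain complex `C 0 → C 1 → C 2 → ⋯`: cocycles modulo coboundaries. -/
abbrev Cohomology (C : ℕ → Type*) [∀ n, AddCommGroup (C n)] [∀ n, Module ℝ (C n)]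
    (d : ∀ n, C n →ₗ[ℝ] C (n + 1)) (n : ℕ) : Type _ :=
  LinearMap.ker (d n) ⧸ (coboundaries C d n).submoduleOf (LinearMap.ker (d n))

end Homology

/-! ### Finite sums -/

theorem exists_ne_zero_of_finsum {α : Type*} {f : α → ℝ} (h : ∑ᶠ a, f a ≠ 0) :
    ∃ a, f a ≠ 0 := by
  by_contra! h'
  exact h (by simp [h'])

theorem finsum_swap {α β : Type*} (f : α → β → ℝ)
    (h : {x : α × β | f x.1 x.2 ≠ 0}.Finite) :
    ∑ᶠ a, ∑ᶠ b, f a b = ∑ᶠ b, ∑ᶠ a, f a b := by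
  rw [← finsum_curry (fun x : α × β => f x.1 x.2) h]
  have h2 : (Function.support fun x : β × α => f x.2 x.1).Finite := by
    refine (h.image Prod.swap).subset ?_
    rintro ⟨b, a⟩ hab
    exact ⟨(a, b), hab, rfl⟩
  rw [← finsum_curry (fun x : β × α => f x.2 x.1) h2]
  exact (finsum_comp_equiv (Equiv.prodComm β α) (f := fun x : α × β => f x.1 x.2)).symm

/-! ### Compactly finite families and coverings -/

section Families

variable {X : Type*} [TopologicalSpace X] {I : Type*}

/-- A family of subsets is compactly finite if every compact set meets only finitely many of
its members. -/
def IsCompactlyFinite {ι : Type*} (F : ι → Set X) : Prop :=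
  ∀ K : Set X, IsCompact K → {i | (K ∩ F i).Nonempty}.Finite

/-- A family of subsets is star finite if each member meets only finitely many members. -/
def IsStarFinite (U : I → Set X) : Prop :=
  ∀ i, {j | (U i ∩ U j).Nonempty}.Finite

/-- A covering is proper if the interiors of its members cover the space and the closures of
its members are compact. -/
structure IsProperCovering (U : I → Set X) : Prop where
  iUnion_interior : ⋃ i, interior (U i) = Set.univ
  isCompact_closure : ∀ i, IsCompact (closure (U i))

/-- The collection of all non-empty intersections of finitely many members of `U`. -/
def finiteIntersections (U : I → Set X) : Set (Set X) :=
  {Z | Z.Nonempty ∧ ∃ s : Finset I, s.Nonempty ∧ Z = ⋂ i ∈ s, U i}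

end Families

/-! ### Singular simplices and bounded cohomology -/

section Singular

variable (X : Type*) [TopologicalSpace X]

/-- Singular `n`-simplices in `X`. -/
abbrev Sing (n : ℕ) : Type _ := C(stdSimplex ℝ (Fin (n + 1)), X)

variable {X}

/-- The `i`-th face of a singular simplex. -/
def face {n : ℕ} (i : Fin (n + 2)) (σ : Sing X (n + 1)) : Sing X n :=
  σ.comp ⟨stdSimplex.map (Fin.succAbove i), stdSimplex.continuous_map _⟩

variable (X)

/-- Bounded real singular `n`-cochains. -/
def boundedCochains (n : ℕ) : Submodule ℝ (Sing X n → ℝ) where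
  carrier := {f | ∃ M : ℝ, ∀ σ, |f σ| ≤ M}
  zero_mem' := ⟨0, fun σ => by simp⟩
  add_mem' := by
    rintro f g ⟨M, hM⟩ ⟨M', hM'⟩
    exact ⟨M + M', fun σ => (abs_add_le _ _).trans (add_le_add (hM σ) (hM' σ))⟩
  smul_mem' := by
    rintro a f ⟨M, hM⟩
    refine ⟨|a| * M, fun σ => ?_⟩
    rw [Pi.smul_apply, smul_eq_mul, abs_mul]
    exact mul_le_mul_of_nonneg_left (hM σ) (abs_nonneg a)

/-- The coboundary `(d f) σ = ∑ i, (-1) ^ i * f (∂ i σ)` of bounded cochains. -/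
def coboundary (n : ℕ) : boundedCochains X n →ₗ[ℝ] boundedCochains X (n + 1) where
  toFun f := ⟨fun σ => ∑ i : Fin (n + 2), (-1) ^ (i : ℕ) * f.1 (face i σ), by
    obtain ⟨M, hM⟩ := f.2
    refine ⟨∑ _i : Fin (n + 2), M, fun σ => (Finset.abs_sum_le_sum_abs _ _).trans ?_⟩
    refine Finset.sum_le_sum fun i _ => ?_
    rw [abs_mul, abs_pow, abs_neg, abs_one, one_pow, one_mul]
    exact hM _⟩
  map_add' f g := by
    ext σ
    simp [mul_add, Finset.sum_add_distrib]
  map_smul' a f := by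
    ext σ
    simp [Finset.mul_sum, mul_left_comm]

/-- The bounded cohomology of `X` in degree `n`, with real coefficients. -/
abbrev BoundedCohomology (n : ℕ) : Type _ :=
  Cohomology (fun n => boundedCochains X n) (coboundary X) n

/-- A space is `l₁`-acyclic (the same as boundedly acyclic) if its bounded cohomology is
isomorphic to the bounded cohomology of a point. -/
def IsL1Acyclic : Prop :=
  ∀ n, Nonempty (BoundedCohomology X n ≃ₗ[ℝ] BoundedCohomology Unit n)

variable {X}

/-- A covering `U` is almost `l₁`-acyclic if all non-empty intersections of finitely many members
of `U` are `l₁`-acyclic, except, perhaps, for a single set, which belongs to `U`. -/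
def IsAlmostL1Acyclic {I : Type*} (U : I → Set X) : Prop :=
  (∀ Z ∈ finiteIntersections U, IsL1Acyclic Z) ∨
    ∃ e : I, ∀ Z ∈ finiteIntersections U, Z ≠ U e → IsL1Acyclic Z

end Singular

/-! ### Compactly finite singular homology and its `l₁`-norm -/

section Chains

variable {X : Type*} [TopologicalSpace X]

/-- The coefficient of `τ` in the boundary of a singular simplex `σ`. -/
def incidence {n : ℕ} (σ : Sing X (n + 1)) (τ : Sing X n) : ℝ :=
  open Classical in ∑ i : Fin (n + 2), if face i σ = τ then (-1) ^ (i : ℕ) else 0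

theorem range_face_subset {n : ℕ} (i : Fin (n + 2)) (σ : Sing X (n + 1)) :
    Set.range (face i σ) ⊆ Set.range σ := by
  rintro _ ⟨t, rfl⟩
  exact ⟨_, rfl⟩

theorem exists_face_of_incidence_ne_zero {n : ℕ} {σ : Sing X (n + 1)} {τ : Sing X n}
    (h : incidence σ τ ≠ 0) : ∃ i, face i σ = τ := by
  classical
  by_contra! h'
  exact h (Finset.sum_eq_zero fun i _ => if_neg (h' i))

theorem range_subset_of_incidence_ne_zero {n : ℕ} {σ : Sing X (n + 1)} {τ : Sing X n}
    (h : incidence σ τ ≠ 0) : Set.range τ ⊆ Set.range σ := by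
  obtain ⟨i, rfl⟩ := exists_face_of_incidence_ne_zero h
  exact range_face_subset i σ

/-- Infinite singular chains are formal sums, i.e. arbitrary functions on singular simplices.
This is the boundary of an infinite chain; the sums are finite for compactly finite chains. -/
def bdry {n : ℕ} (c : Sing X (n + 1) → ℝ) (τ : Sing X n) : ℝ :=
  ∑ᶠ σ, incidence σ τ * c σ

variable (X)

/-- The compactly finite singular `n`-chains: the infinite chains such that the family of images
of simplices with non-zero coefficients is compactly finite. -/
def cfChains (n : ℕ) : Submodule ℝ (Sing X n → ℝ) where
  carrier := {c | IsCompactlyFinite fun σ : Function.support c => Set.range σ.1}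
  zero_mem' := fun K _ => by
    have : IsEmpty (Function.support (0 : Sing X n → ℝ)) := by simp
    exact Set.toFinite _
  add_mem' := by
    intro f g hf hg K hK
    have h := ((hf K hK).image Subtype.val).union ((hg K hK).image Subtype.val)
    refine Set.Finite.of_finite_image (f := Subtype.val) (h.subset ?_)
      Subtype.val_injective.injOn
    rintro _ ⟨⟨σ, hσ⟩, hK', rfl⟩
    rcases Function.support_add f g hσ with h | h
    · exact Or.inl ⟨⟨σ, h⟩, hK', rfl⟩
    · exact Or.inr ⟨⟨σ, h⟩, hK', rfl⟩
  smul_mem' := by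
    intro a f hf K hK
    refine Set.Finite.of_finite_image (f := Subtype.val)
      (((hf K hK).image Subtype.val).subset ?_) Subtype.val_injective.injOn
    rintro _ ⟨⟨σ, hσ⟩, hK', rfl⟩
    exact ⟨⟨σ, fun h => hσ (by simp [h])⟩, hK', rfl⟩

variable {X}

theorem mem_cfChains {n : ℕ} {c : Sing X n → ℝ} :
    c ∈ cfChains X n ↔
      ∀ K : Set X, IsCompact K → {σ | c σ ≠ 0 ∧ (K ∩ Set.range σ).Nonempty}.Finite := by
  refine forall₂_congr fun K _ => ⟨fun h => ?_, fun h => ?_⟩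
  · refine (h.image Subtype.val).subset ?_
    rintro σ ⟨h1, h2⟩
    exact ⟨⟨σ, h1⟩, h2, rfl⟩
  · refine Set.Finite.of_finite_image (f := Subtype.val) (h.subset ?_)
      Subtype.val_injective.injOn
    rintro _ ⟨⟨σ, hσ⟩, hK', rfl⟩
    exact ⟨hσ, hK'⟩

theorem isCompact_range_sing {n : ℕ} (σ : Sing X n) : IsCompact (Set.range σ) :=
  isCompact_range σ.continuous

theorem range_sing_nonempty {n : ℕ} (σ : Sing X n) : (Set.range σ).Nonempty :=
  Set.range_nonempty σ

theorem finite_incidence {n : ℕ} {c : Sing X (n + 1) → ℝ} (hc : c ∈ cfChains X (n + 1))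
    (τ : Sing X n) : {σ | incidence σ τ ≠ 0 ∧ c σ ≠ 0}.Finite := by
  refine (mem_cfChains.1 hc _ (isCompact_range_sing τ)).subset ?_
  rintro σ ⟨h1, h2⟩
  refine ⟨h2, ?_⟩
  rw [Set.inter_eq_left.2 (range_subset_of_incidence_ne_zero h1)]
  exact range_sing_nonempty τ

theorem finite_support_incidence {n : ℕ} {c : Sing X (n + 1) → ℝ} (hc : c ∈ cfChains X (n + 1))
    (τ : Sing X n) : (Function.support fun σ => incidence σ τ * c σ).Finite :=
  (finite_incidence hc τ).subset fun _ h => ⟨left_ne_zero_of_mul h, right_ne_zero_of_mul h⟩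

theorem exists_of_bdry_ne_zero {n : ℕ} {c : Sing X (n + 1) → ℝ} {τ : Sing X n}
    (h : bdry c τ ≠ 0) : ∃ i σ, c σ ≠ 0 ∧ face i σ = τ := by
  obtain ⟨σ, hσ⟩ := exists_ne_zero_of_finsum h
  obtain ⟨i, hi⟩ := exists_face_of_incidence_ne_zero (left_ne_zero_of_mul hσ)
  exact ⟨i, σ, right_ne_zero_of_mul hσ, hi⟩

theorem bdry_mem_cfChains {n : ℕ} {c : Sing X (n + 1) → ℝ} (hc : c ∈ cfChains X (n + 1)) :
    bdry c ∈ cfChains X n := by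
  refine mem_cfChains.2 fun K hK => ?_
  have h := mem_cfChains.1 hc K hK
  refine (Set.finite_iUnion fun i : Fin (n + 2) => h.image (face i)).subset ?_
  rintro τ ⟨h1, h2⟩
  obtain ⟨i, σ, hσ, rfl⟩ := exists_of_bdry_ne_zero h1
  exact Set.mem_iUnion.2 ⟨i, σ,
    ⟨hσ, h2.mono (Set.inter_subset_inter_right _ (range_face_subset i σ))⟩, rfl⟩

theorem bdry_add {n : ℕ} {c c' : Sing X (n + 1) → ℝ} (hc : c ∈ cfChains X (n + 1))
    (hc' : c' ∈ cfChains X (n + 1)) : bdry (c + c') = bdry c + bdry c' := by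
  ext τ
  simp only [bdry, Pi.add_apply, mul_add]
  exact finsum_add_distrib (finite_support_incidence hc τ) (finite_support_incidence hc' τ)

theorem bdry_smul {n : ℕ} (a : ℝ) (c : Sing X (n + 1) → ℝ) : bdry (a • c) = a • bdry c := by
  ext τ
  simp only [bdry, Pi.smul_apply, smul_eq_mul, mul_left_comm _ a]
  exact (mul_finsum _ _).symm

variable (X)

/-- The boundary operator of compactly finite chains. -/
def cfBoundary (n : ℕ) : cfChains X (n + 1) →ₗ[ℝ] cfChains X n where
  toFun c := ⟨bdry c.1, bdry_mem_cfChains c.2⟩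
  map_add' c c' := Subtype.ext (bdry_add c.2 c'.2)
  map_smul' a c := Subtype.ext (bdry_smul a c.1)

/-- The compactly finite homology of `X` in degree `n`, with real coefficients. -/
abbrev CFHomology (n : ℕ) : Type _ := Homology (fun n => cfChains X n) (cfBoundary X) n

variable {X}

/-- The `l₁`-norm of an infinite singular chain, possibly `∞`. -/
def chainNorm {n : ℕ} (c : Sing X n → ℝ) : ℝ≥0∞ := ∑' σ, ENNReal.ofReal |c σ|

/-- The `l₁`-norm of a compactly finite homology class: the infimum of the `l₁`-norms of the
compactly finite cycles representing it. -/
def homologyNorm {n : ℕ} (h : CFHomology X n) : ℝ≥0∞ :=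
  ⨅ (c : cycles (fun n => cfChains X n) (cfBoundary X) n)
    (_ : homologyClass (fun n => cfChains X n) (cfBoundary X) n c = h), chainNorm c.1.1

/-- The finite singular `n`-chains of a subset `Z` of `X`, regarded as chains of `X`. -/
def finChains (Z : Set X) (n : ℕ) : Submodule ℝ (Sing X n → ℝ) where
  carrier := {c | (Function.support c).Finite ∧ ∀ σ, c σ ≠ 0 → Set.range σ ⊆ Z}
  zero_mem' := ⟨by simp, by simp⟩
  add_mem' := by
    rintro f g ⟨hf, hf'⟩ ⟨hg, hg'⟩
    refine ⟨(hf.union hg).subset (Function.support_add f g), fun σ hσ => ?_⟩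
    rcases Function.support_add f g hσ with h | h
    · exact hf' σ h
    · exact hg' σ h
  smul_mem' := by
    rintro a f ⟨hf, hf'⟩
    have : ∀ σ, (a • f) σ ≠ 0 → f σ ≠ 0 := fun σ h h' => h (by simp [h'])
    exact ⟨hf.subset this, fun σ h => hf' σ (this σ h)⟩

theorem finChains_le_cfChains (Z : Set X) (n : ℕ) : finChains Z n ≤ cfChains X n :=
  fun _ hc => mem_cfChains.2 fun _ _ => hc.1.subset fun _ h => h.1

theorem bdry_mem_finChains {Z : Set X} {n : ℕ} {c : Sing X (n + 1) → ℝ}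
    (hc : c ∈ finChains Z (n + 1)) : bdry c ∈ finChains Z n := by
  constructor
  · refine (Set.finite_iUnion fun i : Fin (n + 2) => hc.1.image (face i)).subset fun τ hτ => ?_
    obtain ⟨i, σ, hσ, rfl⟩ := exists_of_bdry_ne_zero hτ
    exact Set.mem_iUnion.2 ⟨i, σ, hσ, rfl⟩
  · intro τ hτ
    obtain ⟨i, σ, hσ, rfl⟩ := exists_of_bdry_ne_zero hτ
    exact (range_face_subset i σ).trans (hc.2 σ hσ)

/-- The boundary operator of finite chains of a subset `Z`. -/
def finBoundary (Z : Set X) (n : ℕ) : finChains Z (n + 1) →ₗ[ℝ] finChains Z n where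
  toFun c := ⟨bdry c.1, bdry_mem_finChains c.2⟩
  map_add' c c' := Subtype.ext
    (bdry_add (finChains_le_cfChains Z _ c.2) (finChains_le_cfChains Z _ c'.2))
  map_smul' a c := Subtype.ext (bdry_smul a c.1)

/-- The augmentation: the sum of the coefficients. -/
def augmentation (Z : Set X) : finChains Z 0 →ₗ[ℝ] ℝ where
  toFun c := ∑ᶠ σ, c.1 σ
  map_add' c c' := finsum_add_distrib c.2.1 c'.2.1
  map_smul' _ _ := (mul_finsum _ _).symm

theorem finsum_incidence_mul {n : ℕ} (σ : Sing X (n + 1)) (f : Sing X n → ℝ) :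
    ∑ᶠ τ, incidence σ τ * f τ = ∑ i : Fin (n + 2), (-1) ^ (i : ℕ) * f (face i σ) := by
  classical
  simp only [incidence, Finset.sum_mul]
  rw [finsum_sum_comm]
  · refine Finset.sum_congr rfl fun i _ => ?_
    rw [finsum_eq_single _ (face i σ)]
    · simp
    · intro τ hτ
      rw [if_neg hτ.symm, zero_mul]
  · intro i _
    refine (Set.finite_singleton (face i σ)).subset fun τ hτ => ?_
    by_contra h
    exact hτ (by simp [if_neg (Ne.symm h)])

theorem augmentation_finBoundary (Z : Set X) (c : finChains Z 1) :
    augmentation Z (finBoundary Z 0 c) = 0 := by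
  change ∑ᶠ τ, ∑ᶠ σ, incidence σ τ * c.1 σ = 0
  rw [finsum_swap]
  · refine finsum_eq_zero_of_forall_eq_zero fun σ => ?_
    have h := finsum_incidence_mul σ fun _ => c.1 σ
    rw [h, Fin.sum_univ_two]
    simp
  · refine ((Set.finite_iUnion fun i : Fin 2 => c.2.1.image (face i)).prod c.2.1).subset ?_
    rintro ⟨τ, σ⟩ h
    obtain ⟨i, hi⟩ := exists_face_of_incidence_ne_zero (left_ne_zero_of_mul h)
    have hσ : σ ∈ Function.support c.1 := right_ne_zero_of_mul h
    exact ⟨Set.mem_iUnion.2 ⟨i, σ, hσ, hi⟩, hσ⟩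

end Chains

/-! ### The nerve and its infinite chains -/

section Nerve

variable {X : Type*} {I : Type*}

/-- The `p`-dimensional simplices of the nerve of `U`: sets of `p + 1` indices such that the
corresponding members of `U` have non-empty intersection. -/
abbrev NerveSimplex (U : I → Set X) (p : ℕ) : Type _ :=
  {s : Finset I // s.card = p + 1 ∧ (⋂ i ∈ s, U i).Nonempty}

/-- The intersection of the members of `U` corresponding to the vertices of a simplex. -/
def NerveSimplex.carrier {U : I → Set X} {p : ℕ} (s : NerveSimplex U p) : Set X :=
  ⋂ i ∈ s.1, U i

theorem NerveSimplex.carrier_subset_of_subset {U : I → Set X} {p q : ℕ} {s : NerveSimplex U p}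
    {t : NerveSimplex U q} (h : t.1 ⊆ s.1) : s.carrier ⊆ t.carrier :=
  Set.biInter_mono h fun _ _ => subset_rfl

theorem NerveSimplex.carrier_subset {U : I → Set X} {p : ℕ} (s : NerveSimplex U p) {i : I}
    (hi : i ∈ s.1) : s.carrier ⊆ U i :=
  Set.biInter_subset_of_mem hi

theorem NerveSimplex.exists_mem {U : I → Set X} {p : ℕ} (s : NerveSimplex U p) : ∃ i, i ∈ s.1 :=
  Finset.card_pos.1 (by rw [s.2.1]; omega)

theorem finite_simplices_meeting {U : I → Set X} (hU : IsStarFinite U) (p : ℕ)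
    (i : I) : {s : NerveSimplex U p | (U i ∩ s.carrier).Nonempty}.Finite := by
  have hfin := hU i
  refine Set.Finite.of_finite_image (f := Subtype.val)
    ((hfin.toFinset.powerset.finite_toSet).subset ?_) Subtype.val_injective.injOn
  rintro _ ⟨s, ⟨x, hx, hx'⟩, rfl⟩
  simp only [Finset.coe_powerset, Set.mem_preimage, Set.mem_powerset_iff]
  intro j hj
  simp only [Set.Finite.coe_toFinset, Set.mem_ofPred_eq]
  exact ⟨x, hx, s.carrier_subset hj hx'⟩

variable [LinearOrder I]

/-- The coefficient of `t` in the boundary of the simplex `s` of the nerve: it is `(-1) ^ k` if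
`t` is obtained by removing the vertex of `s` in position `k` (counting from `0`). -/
def nerveIncidence {U : I → Set X} {p : ℕ} (s : NerveSimplex U (p + 1)) (t : NerveSimplex U p) :
    ℝ :=
  ∑ v ∈ s.1, if s.1.erase v = t.1 then (-1) ^ (s.1.filter (· < v)).card else 0

theorem subset_of_nerveIncidence_ne_zero {U : I → Set X} {p : ℕ} {s : NerveSimplex U (p + 1)}
    {t : NerveSimplex U p} (h : nerveIncidence s t ≠ 0) : t.1 ⊆ s.1 := by
  obtain ⟨v, _, hv⟩ := Finset.exists_ne_zero_of_sum_ne_zero h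
  have : s.1.erase v = t.1 := by
    by_contra h'
    exact hv (if_neg h')
  rw [← this]
  exact Finset.erase_subset _ _

theorem finite_cofaces {U : I → Set X} (hU : IsStarFinite U) {p : ℕ} (t : NerveSimplex U p) :
    {s : NerveSimplex U (p + 1) | nerveIncidence s t ≠ 0}.Finite := by
  obtain ⟨i, hi⟩ := t.exists_mem
  refine (finite_simplices_meeting hU (p + 1) i).subset fun s hs => ?_
  obtain ⟨x, hx⟩ := s.2.2
  exact ⟨x, s.carrier_subset (subset_of_nerveIncidence_ne_zero hs hi) hx, hx⟩

theorem finite_support_nerveIncidence {U : I → Set X} (hU : IsStarFinite U) {p : ℕ}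
    (t : NerveSimplex U p) (f : NerveSimplex U (p + 1) → ℝ) :
    (Function.support fun s => nerveIncidence s t * f s).Finite :=
  (finite_cofaces hU t).subset fun _ h => left_ne_zero_of_mul h

theorem finsum_nerveIncidence_mul {U : I → Set X} {p : ℕ} (s : NerveSimplex U (p + 1))
    (f : Finset I → ℝ) :
    ∑ᶠ t : NerveSimplex U p, nerveIncidence s t * f t.1 =
      ∑ v ∈ s.1, (-1) ^ (s.1.filter (· < v)).card * f (s.1.erase v) := by
  simp only [nerveIncidence, Finset.sum_mul]
  have hface : ∀ v ∈ s.1, (s.1.erase v).card = p + 1 ∧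
      (⋂ i ∈ s.1.erase v, U i).Nonempty := fun v hv =>
    ⟨by rw [Finset.card_erase_of_mem hv, s.2.1]; rfl,
      s.2.2.mono (Set.biInter_mono (Finset.erase_subset v s.1) fun _ _ => subset_rfl)⟩
  rw [finsum_sum_comm]
  · refine Finset.sum_congr rfl fun v hv => ?_
    rw [finsum_eq_single _ ⟨s.1.erase v, hface v hv⟩]
    · rw [if_pos rfl]
    · intro t ht
      rw [if_neg fun h => ht (Subtype.ext h.symm), zero_mul]
  · intro v hv
    refine (Set.finite_singleton
      (⟨s.1.erase v, hface v hv⟩ : NerveSimplex U p)).subset fun t ht => ?_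
    by_contra h
    exact ht (by simp [show ¬ s.1.erase v = t.1 from fun h' => h (Subtype.ext h'.symm)])

theorem finsum_nerveIncidence_edge {U : I → Set X} (s : NerveSimplex U 1) (a : ℝ) :
    ∑ᶠ t : NerveSimplex U 0, nerveIncidence s t * a = 0 := by
  rw [finsum_nerveIncidence_mul s fun _ => a]
  obtain ⟨v, w, hvw, hs⟩ : ∃ v w, v < w ∧ s.1 = {v, w} := by
    obtain ⟨v, w, hvw, hs⟩ := Finset.card_eq_two.1 s.2.1
    rcases lt_or_gt_of_ne hvw with h | h
    · exact ⟨v, w, h, hs⟩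
    · exact ⟨w, v, h, by rw [hs, Finset.pair_comm]⟩
  rw [hs, Finset.sum_pair hvw.ne]
  simp [Finset.filter_insert, Finset.filter_singleton, hvw, hvw.not_gt]

/-- The boundary operator of infinite chains of the nerve of a star finite family. -/
def nerveBoundary {U : I → Set X} (hU : IsStarFinite U) (p : ℕ) :
    (NerveSimplex U (p + 1) → ℝ) →ₗ[ℝ] (NerveSimplex U p → ℝ) where
  toFun c t := ∑ᶠ s, nerveIncidence s t * c s
  map_add' c c' := by
    ext t
    simp only [Pi.add_apply, mul_add]
    exact finsum_add_distrib (finite_support_nerveIncidence hU t c)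
      (finite_support_nerveIncidence hU t c')
  map_smul' a c := by
    ext t
    simp only [Pi.smul_apply, smul_eq_mul, mul_left_comm _ a, RingHom.id_apply]
    exact (mul_finsum _ _).symm

/-- The homology of the nerve of a star finite family based on infinite chains. -/
abbrev NerveHomology {U : I → Set X} (hU : IsStarFinite U) (n : ℕ) : Type _ :=
  Homology (fun p => NerveSimplex U p → ℝ) (nerveBoundary hU) n

end Nerve

/-! ### The double complex of a covering -/

section Double

variable {X : Type*} [TopologicalSpace X] {I : Type*}

/-- The term `∏ s, C q (|s|)` of the double complex, where `s` runs over the `p`-simplices of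
the nerve. -/
abbrev DoubleChains (U : I → Set X) (p q : ℕ) : Type _ :=
  (s : NerveSimplex U p) → finChains s.carrier q

theorem finite_simplices_containing {U : I → Set X} (hU : IsStarFinite U) (p : ℕ) {q : ℕ}
    (σ : Sing X q) : {s : NerveSimplex U p | Set.range σ ⊆ s.carrier}.Finite := by
  rcases Set.eq_empty_or_nonempty {s : NerveSimplex U p | Set.range σ ⊆ s.carrier} with h | ⟨s, hs⟩
  · rw [h]; exact Set.finite_empty
  · obtain ⟨i, hi⟩ := s.exists_mem
    obtain ⟨x, hx⟩ := range_sing_nonempty σ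
    exact (finite_simplices_meeting hU p i).subset fun t ht =>
      ⟨x, s.carrier_subset hi (hs hx), ht hx⟩

theorem finite_support_apply {U : I → Set X} (hU : IsStarFinite U) {p q : ℕ}
    (c : DoubleChains U p q) (σ : Sing X q) : (Function.support fun s => (c s).1 σ).Finite :=
  (finite_simplices_containing hU p σ).subset fun s h => (c s).2.2 σ h

theorem finite_simplices_meeting_compact {U : I → Set X} (hU : IsStarFinite U)
    (hP : IsProperCovering U) (p : ℕ) {K : Set X} (hK : IsCompact K) :
    {s : NerveSimplex U p | (K ∩ s.carrier).Nonempty}.Finite := by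
  obtain ⟨J, hJ⟩ := hK.elim_finite_subcover (fun i => interior (U i)) (fun _ => isOpen_interior)
    (by rw [hP.iUnion_interior]; exact Set.subset_univ K)
  refine (J.finite_toSet.biUnion fun i _ =>
    finite_simplices_meeting hU p i).subset ?_
  rintro s ⟨x, hx, hx'⟩
  obtain ⟨i, hi, hxi⟩ := Set.mem_iUnion₂.1 (hJ hx)
  exact Set.mem_biUnion hi ⟨x, interior_subset hxi, hx'⟩

/-- The horizontal differential: the product of singular boundary operators. -/
def horizontal (U : I → Set X) (p q : ℕ) : DoubleChains U p (q + 1) →ₗ[ℝ] DoubleChains U p q :=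
  LinearMap.pi fun s => finBoundary s.carrier q ∘ₗ LinearMap.proj s

/-- The sum of a family of finite chains of members of the covering; it is compactly finite. -/
def sumChains {U : I → Set X} (hU : IsStarFinite U) (hP : IsProperCovering U) (q : ℕ) :
    DoubleChains U 0 q →ₗ[ℝ] cfChains X q where
  toFun c := ⟨fun σ => ∑ᶠ s, (c s).1 σ, by
    refine mem_cfChains.2 fun K hK => ?_
    refine ((finite_simplices_meeting_compact hU hP 0 hK).biUnion
      fun s _ => (c s).2.1).subset ?_
    rintro σ ⟨hσ, hK'⟩
    obtain ⟨s, hs⟩ := exists_ne_zero_of_finsum hσ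
    exact Set.mem_biUnion (x := s)
      (hK'.mono (Set.inter_subset_inter_right _ ((c s).2.2 σ hs))) hs⟩
  map_add' c c' := by
    ext σ
    exact finsum_add_distrib (finite_support_apply hU c σ) (finite_support_apply hU c' σ)
  map_smul' a c := by
    ext σ
    exact (mul_finsum _ _).symm

theorem sumChains_horizontal {U : I → Set X} (hU : IsStarFinite U) (hP : IsProperCovering U)
    (q : ℕ) (c : DoubleChains U 0 (q + 1)) :
    sumChains hU hP q (horizontal U 0 q c) = cfBoundary X q (sumChains hU hP (q + 1) c) := by
  ext τ
  change ∑ᶠ s, ∑ᶠ σ, incidence σ τ * (c s).1 σ = ∑ᶠ σ, incidence σ τ * ∑ᶠ s, (c s).1 σ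
  rw [finsum_swap]
  · simp only [mul_finsum]
  · refine ((finite_simplices_containing hU 0 τ).prod
      ((finite_simplices_containing hU 0 τ).biUnion fun s _ => (c s).2.1)).subset ?_
    rintro ⟨s, σ⟩ h
    have hs : s ∈ {s : NerveSimplex U 0 | Set.range τ ⊆ s.carrier} :=
      (range_subset_of_incidence_ne_zero (left_ne_zero_of_mul h)).trans
        ((c s).2.2 σ (right_ne_zero_of_mul h))
    exact ⟨hs, Set.mem_biUnion hs (right_ne_zero_of_mul h)⟩

variable [LinearOrder I]

/-- The vertical differential: the boundary operator of infinite chains of the nerve, combined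
with the inclusions of finite chains. -/
def vertical {U : I → Set X} (hU : IsStarFinite U) (p q : ℕ) :
    DoubleChains U (p + 1) q →ₗ[ℝ] DoubleChains U p q where
  toFun c t := ⟨fun σ => ∑ᶠ s, nerveIncidence s t * (c s).1 σ, by
    have key : ∀ σ, (∑ᶠ s, nerveIncidence s t * (c s).1 σ) ≠ 0 →
        ∃ s, nerveIncidence s t ≠ 0 ∧ (c s).1 σ ≠ 0 := by
      intro σ hσ
      obtain ⟨s, hs⟩ := exists_ne_zero_of_finsum hσ
      exact ⟨s, left_ne_zero_of_mul hs, right_ne_zero_of_mul hs⟩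
    constructor
    · refine ((finite_cofaces hU t).biUnion fun s _ => (c s).2.1).subset fun σ hσ => ?_
      obtain ⟨s, h1, h2⟩ := key σ hσ
      exact Set.mem_biUnion h1 h2
    · intro σ hσ
      obtain ⟨s, h1, h2⟩ := key σ hσ
      exact ((c s).2.2 σ h2).trans
        (NerveSimplex.carrier_subset_of_subset (subset_of_nerveIncidence_ne_zero h1))⟩
  map_add' c c' := by
    ext t σ
    simp only [Pi.add_apply, Submodule.coe_add, mul_add]
    exact finsum_add_distrib (finite_support_nerveIncidence hU t fun s => (c s).1 σ)
      (finite_support_nerveIncidence hU t fun s => (c' s).1 σ)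
  map_smul' a c := by
    ext t σ
    simp only [Pi.smul_apply, Submodule.coe_smul, smul_eq_mul, mul_left_comm _ a,
      RingHom.id_apply]
    exact (mul_finsum _ _).symm

/-- The degree `n` term of the total complex: the sum of the terms with `p + q = n`. -/
abbrev Total (U : I → Set X) (n : ℕ) : Type _ :=
  (x : {x : ℕ × ℕ // x.1 + x.2 = n}) → DoubleChains U x.1.1 x.1.2

/-- The component of an element of the total complex in bidegree `(p, q)`. -/
def component (U : I → Set X) {n : ℕ} (p q : ℕ) (h : p + q = n) :
    Total U n →ₗ[ℝ] DoubleChains U p q :=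
  LinearMap.proj (⟨(p, q), h⟩ : {x : ℕ × ℕ // x.1 + x.2 = n})

/-- The differential of the total complex: the component in bidegree `(p, q)` of the differential
of `z` is `(-1) ^ p d (z (p, q + 1)) + δ (z (p + 1, q))`. -/
def totalBoundary {U : I → Set X} (hU : IsStarFinite U) (n : ℕ) :
    Total U (n + 1) →ₗ[ℝ] Total U n :=
  LinearMap.pi fun x =>
    ((-1 : ℝ) ^ x.1.1) • (horizontal U x.1.1 x.1.2 ∘ₗ
      component U x.1.1 (x.1.2 + 1) (by have := x.2; omega)) +
    vertical hU x.1.1 x.1.2 ∘ₗ component U (x.1.1 + 1) x.1.2 (by have := x.2; omega)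

/-- The homology of the total complex. -/
abbrev TotalHomology {U : I → Set X} (hU : IsStarFinite U) (n : ℕ) : Type _ :=
  Homology (fun n => Total U n) (totalBoundary hU) n

/-- The map from the total complex to infinite chains of the nerve, given by the augmentations
on bidegree `(n, 0)` and by zero on other bidegrees. -/
def toNerve (U : I → Set X) (n : ℕ) : Total U n →ₗ[ℝ] (NerveSimplex U n → ℝ) :=
  LinearMap.pi fun s => augmentation s.carrier ∘ₗ LinearMap.proj s ∘ₗ component U n 0 rfl

/-- The map from the total complex to compactly finite chains, given by summation on bidegree
`(0, n)` and by zero on other bidegrees. -/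
def toCF {U : I → Set X} (hU : IsStarFinite U) (hP : IsProperCovering U) (n : ℕ) :
    Total U n →ₗ[ℝ] cfChains X n :=
  sumChains hU hP n ∘ₗ component U 0 n (zero_add n)

theorem toNerve_totalBoundary {U : I → Set X} (hU : IsStarFinite U) (n : ℕ)
    (z : Total U (n + 1)) :
    toNerve U n (totalBoundary hU n z) = nerveBoundary hU n (toNerve U (n + 1) z) := by
  funext t
  set c := component U (n + 1) 0 rfl z with hc
  have h1 : toNerve U n (totalBoundary hU n z) t =
      augmentation t.carrier
        ((-1 : ℝ) ^ n • finBoundary t.carrier 0 (component U n 1 rfl z t) +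
          vertical hU n 0 c t) := rfl
  rw [h1, map_add, map_smul, augmentation_finBoundary, smul_zero, zero_add]
  change ∑ᶠ σ, ∑ᶠ s, nerveIncidence s t * (c s).1 σ =
    ∑ᶠ s, nerveIncidence s t * ∑ᶠ σ, (c s).1 σ
  rw [finsum_swap]
  · simp only [mul_finsum]
  · refine (((finite_cofaces hU t).biUnion fun s _ => (c s).2.1).prod
      (finite_cofaces hU t)).subset ?_
    rintro ⟨σ, s⟩ h
    exact ⟨Set.mem_biUnion (x := s) (left_ne_zero_of_mul h) (right_ne_zero_of_mul h),
      left_ne_zero_of_mul h⟩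

theorem sumChains_vertical {U : I → Set X} (hU : IsStarFinite U) (hP : IsProperCovering U)
    (q : ℕ) (c : DoubleChains U 1 q) : sumChains hU hP q (vertical hU 0 q c) = 0 := by
  ext σ
  change ∑ᶠ t, ∑ᶠ s, nerveIncidence s t * (c s).1 σ = 0
  rw [finsum_swap]
  · exact finsum_eq_zero_of_forall_eq_zero fun s => finsum_nerveIncidence_edge s _
  · refine ((finite_simplices_containing hU 0 σ).prod
      (finite_simplices_containing hU 1 σ)).subset ?_
    rintro ⟨t, s⟩ h
    have hs := (c s).2.2 σ (right_ne_zero_of_mul h)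
    exact ⟨hs.trans (NerveSimplex.carrier_subset_of_subset
      (subset_of_nerveIncidence_ne_zero (left_ne_zero_of_mul h))), hs⟩

theorem toCF_totalBoundary {U : I → Set X} (hU : IsStarFinite U) (hP : IsProperCovering U)
    (n : ℕ) (z : Total U (n + 1)) :
    toCF hU hP n (totalBoundary hU n z) = cfBoundary X n (toCF hU hP (n + 1) z) := by
  have h1 : toCF hU hP n (totalBoundary hU n z) =
      sumChains hU hP n ((-1 : ℝ) ^ 0 •
        horizontal U 0 n (component U 0 (n + 1) (zero_add _) z) +
          vertical hU 0 n (component U 1 n (add_comm _ _) z)) := rfl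
  rw [h1, map_add, sumChains_vertical, add_zero, pow_zero, one_smul, sumChains_horizontal]
  rfl

/-! ### The Leray homomorphism -/

/-- The map from the homology of the total complex to the homology of the nerve. -/
def totalToNerve {U : I → Set X} (hU : IsStarFinite U) (n : ℕ) :
    TotalHomology hU n →ₗ[ℝ] NerveHomology hU n :=
  homologyMap (toNerve U) (toNerve_totalBoundary hU) n

/-- The map from the homology of the total complex to compactly finite homology. It is an
isomorphism for star finite proper coverings. -/
def totalToCF {U : I → Set X} (hU : IsStarFinite U) (hP : IsProperCovering U) (n : ℕ) :
    TotalHomology hU n →ₗ[ℝ] CFHomology X n :=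
  homologyMap (toCF hU hP) (toCF_totalBoundary hU hP) n

open Classical in
/-- The Leray homomorphism of a star finite proper covering: the composition of the inverse of the
isomorphism `totalToCF` with `totalToNerve`. The value `0` in the absence of an inverse is
only there to make this a definition; this case never occurs. -/
def leray {U : I → Set X} (hU : IsStarFinite U) (hP : IsProperCovering U) (n : ℕ) :
    CFHomology X n →ₗ[ℝ] NerveHomology hU n :=
  if h : Function.Bijective (totalToCF hU hP n) then
    totalToNerve hU n ∘ₗ (LinearEquiv.ofBijective (totalToCF hU hP n) h).symm.toLinearMap
  else 0

end Double

end LerayCF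

end

/-! The proof takes place in the double complex. A class killed by the Leray homomorphism is
represented by a total cycle, and this cycle is made small, one bidegree after another, until its `p
= 0` terms have finite total norm.

Summation of the `p = 0` terms is a homology isomorphism (`totalToCF_bijective`) for two reasons.
Compactly finite chains can be subdivided, to a depth depending on the simplex, until every simplex
lies in a member of `U` (`exists_smallHomotopy`). For fixed `q` the `p`-direction, augmented by
summation, splits over singular simplices `σ` into augmented chain complexes of full simplices,
spanned by the finitely many `i` with `σ` in `U i`; these are contracted by cones. Hence a class in
the kernel of the Leray homomorphism comes from a total cycle `z` whose components in bidegree `(n,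
0)` all have augmentation zero (`exists_cycle_of_leray_eq_zero`).

The analytic input is a filling property of an `l₁`-acyclic set. By Hahn–Banach duality and the open
mapping theorem for bounded cochains there is a constant `C`, for each positive degree, such that a
finite chain `c` can be changed by a boundary so that its norm becomes at most `C ‖∂c‖ + ε`
(`exists_filling`). A 0-chain of augmentation zero can be made arbitrarily small
(`exists_filling_zero`).

Let `F` be the finite set of indices of the members meeting the exceptional set. A simplex of the
nerve not contained in `F` has an `l₁`-acyclic carrier, and so do its cofaces. Because `z` is a
cycle, the boundary of its component at `(p, q + 1)` over `t` is, up to sign, a finite combination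
of the components at `(p + 1, q)` over the cofaces of `t`. If these are small enough, then so is the
boundary, and the filling property makes the component over `t` small as well. Going from `(n, 0)`
to `(0, n)`, one may prescribe the tolerance for each simplex separately (`exists_small_column`), so
no uniformity of the constants `C` is needed. For `p = 0` the tolerances are taken summable, which
is possible by countability. The finitely many vertices in `F` carry finite chains, which have
finite norm. -/

noncomputable section

namespace LerayCF

/-! ### Chains of tuples and their subdivision -/

section Tuples

/-- Finite real chains of `(n + 1)`-tuples of elements of `V`. -/
abbrev TupleChain (V : Type*) (n : ℕ) : Type _ := (Fin (n + 1) → V) →₀ ℝ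

variable {V W : Type*}

/-- The boundary operator of chains of tuples. -/
def tupleBdry (V : Type*) (n : ℕ) : TupleChain V (n + 1) →ₗ[ℝ] TupleChain V n :=
  Finsupp.linearCombination ℝ fun w =>
    ∑ i : Fin (n + 2), Finsupp.single (w ∘ i.succAbove) ((-1) ^ (i : ℕ))

theorem tupleBdry_single (n : ℕ) (w : Fin (n + 2) → V) :
    tupleBdry V n (Finsupp.single w 1) =
      ∑ i : Fin (n + 2), Finsupp.single (w ∘ i.succAbove) ((-1) ^ (i : ℕ)) := by
  simp [tupleBdry]

/-- The cone operator with apex `b`. -/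
def cone (b : V) (n : ℕ) : TupleChain V n →ₗ[ℝ] TupleChain V (n + 1) :=
  Finsupp.lmapDomain ℝ ℝ fun w => (Fin.cons b w : Fin (n + 2) → V)

theorem cone_single (b : V) (n : ℕ) (w : Fin (n + 1) → V) (a : ℝ) :
    cone b n (Finsupp.single w a) = Finsupp.single (Fin.cons b w : Fin (n + 2) → V) a := by
  simp [cone]

theorem cons_comp_zero_succAbove {n : ℕ} (b : V) (w : Fin (n + 1) → V) :
    (Fin.cons b w : Fin (n + 2) → V) ∘ Fin.succAbove 0 = w := by
  ext i; simp

theorem cons_comp_succ_succAbove {n : ℕ} (b : V) (w : Fin (n + 2) → V) (i : Fin (n + 2)) :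
    (Fin.cons b w : Fin (n + 3) → V) ∘ Fin.succAbove i.succ =
      (Fin.cons b (w ∘ i.succAbove) : Fin (n + 2) → V) := by
  ext j
  refine Fin.cases ?_ (fun j => ?_) j <;> simp

theorem tupleBdry_cone (b : V) (n : ℕ) (x : TupleChain V (n + 1)) :
    tupleBdry V (n + 1) (cone b (n + 1) x) = x - cone b n (tupleBdry V n x) := by
  suffices h : tupleBdry V (n + 1) ∘ₗ cone b (n + 1) =
      LinearMap.id - cone b n ∘ₗ tupleBdry V n from LinearMap.congr_fun h x
  refine Finsupp.lhom_ext' fun w => LinearMap.ext_ring ?_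
  simp only [LinearMap.comp_apply, Finsupp.lsingle_apply, cone_single, tupleBdry_single,
    LinearMap.sub_apply, LinearMap.id_apply, map_sum]
  rw [Fin.sum_univ_succ]
  simp only [cons_comp_zero_succAbove, cons_comp_succ_succAbove, Fin.val_zero, pow_zero,
    Fin.val_succ, pow_succ, mul_neg, mul_one, Finsupp.single_neg, Finset.sum_neg_distrib,
    sub_eq_add_neg]

/-- The sum of the coefficients. -/
def tupleSum (V : Type*) (n : ℕ) : TupleChain V n →ₗ[ℝ] ℝ :=
  Finsupp.linearCombination ℝ fun _ => 1

/-- A point has no boundary; its augmentation takes that place, which produces the correction term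
at the apex. -/
theorem tupleBdry_cone_zero (b : V) (x : TupleChain V 0) :
    tupleBdry V 0 (cone b 0 x) = x - Finsupp.single (fun _ => b) (tupleSum V 0 x) := by
  suffices h : tupleBdry V 0 ∘ₗ cone b 0 =
      LinearMap.id - Finsupp.lsingle (fun _ => b) ∘ₗ tupleSum V 0 from LinearMap.congr_fun h x
  refine Finsupp.lhom_ext' fun w => LinearMap.ext_ring ?_
  simp only [LinearMap.comp_apply, Finsupp.lsingle_apply, cone_single, tupleBdry_single,
    LinearMap.sub_apply, LinearMap.id_apply]
  rw [Fin.sum_univ_two, cons_comp_zero_succAbove]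
  have : (Fin.cons b w : Fin 2 → V) ∘ Fin.succAbove 1 = fun _ => b := by
    ext j
    obtain rfl : j = 0 := Subsingleton.elim _ _
    simp
  rw [this]
  simp [tupleSum, sub_eq_add_neg]

theorem tupleSum_tupleBdry (x : TupleChain V 1) : tupleSum V 0 (tupleBdry V 0 x) = 0 := by
  suffices h : tupleSum V 0 ∘ₗ tupleBdry V 0 = 0 from LinearMap.congr_fun h x
  refine Finsupp.lhom_ext' fun w => LinearMap.ext_ring ?_
  simp [tupleBdry_single, tupleSum, Fin.sum_univ_two]

/-- A tuple is the cone over its tail with apex its first entry, so the cone formula lowers the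
degree. -/
theorem tupleBdry_tupleBdry (n : ℕ) (x : TupleChain V (n + 2)) :
    tupleBdry V n (tupleBdry V (n + 1) x) = 0 := by
  induction n with
  | zero =>
    suffices h : tupleBdry V 0 ∘ₗ tupleBdry V 1 = 0 from LinearMap.congr_fun h x
    refine Finsupp.lhom_ext' fun w => LinearMap.ext_ring ?_
    have hw : (Finsupp.single w 1 : TupleChain V 2) =
        cone (w 0) 1 (Finsupp.single (Fin.tail w) 1) := by
      rw [cone_single, Fin.cons_self_tail]
    simp only [LinearMap.comp_apply, Finsupp.lsingle_apply, LinearMap.zero_apply]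
    rw [hw, tupleBdry_cone, map_sub, tupleBdry_cone_zero, tupleSum_tupleBdry]
    simp
  | succ n ih =>
    suffices h : tupleBdry V (n + 1) ∘ₗ tupleBdry V (n + 2) = 0 from LinearMap.congr_fun h x
    refine Finsupp.lhom_ext' fun w => LinearMap.ext_ring ?_
    have hw : (Finsupp.single w 1 : TupleChain V (n + 3)) =
        cone (w 0) (n + 2) (Finsupp.single (Fin.tail w) 1) := by
      rw [cone_single, Fin.cons_self_tail]
    simp only [LinearMap.comp_apply, Finsupp.lsingle_apply, LinearMap.zero_apply]
    rw [hw, tupleBdry_cone, map_sub, tupleBdry_cone, ih]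
    simp

/-- The map of chains of tuples induced by a map. -/
def tupleMap (f : V → W) (n : ℕ) : TupleChain V n →ₗ[ℝ] TupleChain W n :=
  Finsupp.lmapDomain ℝ ℝ fun w => f ∘ w

theorem tupleMap_single (f : V → W) (n : ℕ) (w : Fin (n + 1) → V) (a : ℝ) :
    tupleMap f n (Finsupp.single w a) = Finsupp.single (f ∘ w) a := by
  simp [tupleMap]

theorem tupleMap_tupleBdry (f : V → W) (n : ℕ) (x : TupleChain V (n + 1)) :
    tupleMap f n (tupleBdry V n x) = tupleBdry W n (tupleMap f (n + 1) x) := by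
  suffices h : tupleMap f n ∘ₗ tupleBdry V n = tupleBdry W n ∘ₗ tupleMap f (n + 1) from
    LinearMap.congr_fun h x
  refine Finsupp.lhom_ext' fun w => LinearMap.ext_ring ?_
  simp [tupleBdry_single, tupleMap_single, Function.comp_assoc]

theorem tupleMap_cone (f : V → W) (b : V) (n : ℕ) (x : TupleChain V n) :
    tupleMap f (n + 1) (cone b n x) = cone (f b) n (tupleMap f n x) := by
  suffices h : tupleMap f (n + 1) ∘ₗ cone b n = cone (f b) n ∘ₗ tupleMap f n from
    LinearMap.congr_fun h x
  refine Finsupp.lhom_ext' fun w => LinearMap.ext_ring ?_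
  simp only [LinearMap.comp_apply, Finsupp.lsingle_apply, cone_single, tupleMap_single]
  congr 1
  ext i
  refine Fin.cases ?_ (fun i => ?_) i <;> simp

/-! ### Subdivision of tuples and its chain homotopies, for an arbitrary choice of apexes -/

variable (β : ∀ n, (Fin (n + 1) → V) → V) (γ : ∀ n, (Fin (n + 1) → W) → W)

/-- The subdivision operator: a tuple is replaced by the cone over its subdivided boundary, with
the apex given by `β`. -/
def subdiv : ∀ n, TupleChain V n →ₗ[ℝ] TupleChain V n
  | 0 => LinearMap.id
  | n + 1 => Finsupp.linearCombination ℝ fun w =>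
      cone (β (n + 1) w) n (subdiv n (tupleBdry V n (Finsupp.single w 1)))

/-- The chain homotopy between the identity and the subdivision operator. -/
def subdivHomotopy : ∀ n, TupleChain V n →ₗ[ℝ] TupleChain V (n + 1)
  | 0 => Finsupp.linearCombination ℝ fun w => cone (β 0 w) 0 (Finsupp.single w 1)
  | n + 1 => Finsupp.linearCombination ℝ fun w => cone (β (n + 1) w) (n + 1)
      (Finsupp.single w 1 - subdivHomotopy n (tupleBdry V n (Finsupp.single w 1)))

theorem subdiv_single (n : ℕ) (w : Fin (n + 2) → V) :
    subdiv β (n + 1) (Finsupp.single w 1) =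
      cone (β (n + 1) w) n (subdiv β n (tupleBdry V n (Finsupp.single w 1))) := by
  simp [subdiv]

theorem subdivHomotopy_single_zero (w : Fin 1 → V) :
    subdivHomotopy β 0 (Finsupp.single w 1) = cone (β 0 w) 0 (Finsupp.single w 1) := by
  simp [subdivHomotopy]

theorem subdivHomotopy_single (n : ℕ) (w : Fin (n + 2) → V) :
    subdivHomotopy β (n + 1) (Finsupp.single w 1) = cone (β (n + 1) w) (n + 1)
      (Finsupp.single w 1 - subdivHomotopy β n (tupleBdry V n (Finsupp.single w 1))) := by
  simp [subdivHomotopy]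

theorem tupleBdry_subdiv (n : ℕ) (x : TupleChain V (n + 1)) :
    tupleBdry V n (subdiv β (n + 1) x) = subdiv β n (tupleBdry V n x) := by
  suffices h : tupleBdry V n ∘ₗ subdiv β (n + 1) = subdiv β n ∘ₗ tupleBdry V n from
    LinearMap.congr_fun h x
  refine Finsupp.lhom_ext' fun w => LinearMap.ext_ring ?_
  simp only [LinearMap.comp_apply, Finsupp.lsingle_apply, subdiv_single]
  induction n with
  | zero =>
    rw [tupleBdry_cone_zero]
    simp [subdiv, tupleSum_tupleBdry]
  | succ n ih =>
    have h : tupleBdry V n ∘ₗ subdiv β (n + 1) = subdiv β n ∘ₗ tupleBdry V n := by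
      refine Finsupp.lhom_ext' fun w => LinearMap.ext_ring ?_
      simp only [LinearMap.comp_apply, Finsupp.lsingle_apply, subdiv_single]
      exact ih 0 w
    have h' := LinearMap.congr_fun h (tupleBdry V (n + 1) (Finsupp.single w 1))
    simp only [LinearMap.comp_apply] at h'
    rw [tupleBdry_cone, h', tupleBdry_tupleBdry]
    simp

/-- When `β 0 w = w 0`, the homotopy sends a point to the degenerate edge at this point, and its two
faces cancel. This starts the homotopy formula, since subdivision is the identity in degree 0. -/
theorem tupleBdry_subdivHomotopy_zero (hβ : ∀ w, β 0 w = w 0) (x : TupleChain V 0) :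
    tupleBdry V 0 (subdivHomotopy β 0 x) = 0 := by
  suffices h : tupleBdry V 0 ∘ₗ subdivHomotopy β 0 = 0 from LinearMap.congr_fun h x
  refine Finsupp.lhom_ext' fun w => LinearMap.ext_ring ?_
  simp only [LinearMap.comp_apply, Finsupp.lsingle_apply, subdivHomotopy_single_zero,
    tupleBdry_cone_zero, LinearMap.zero_apply, hβ]
  have : (fun _ => w 0) = w := by
    ext i
    exact congrArg w (Fin.fin_one_eq_zero i).symm
  simp [tupleSum, this]

/-- Write `T` for the homotopy, `S` for subdivision and `b` for the cone with the apex of `w`, so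
that `T w = b (w - T ∂w)`. By the formula one degree lower, `w - T ∂w` has boundary `S ∂w`, and `b
(S ∂w) = S w`; the cone formula gives the rest. -/
theorem tupleBdry_subdivHomotopy (hβ : ∀ w, β 0 w = w 0) (n : ℕ) (x : TupleChain V (n + 1)) :
    tupleBdry V (n + 1) (subdivHomotopy β (n + 1) x) =
      x - subdiv β (n + 1) x - subdivHomotopy β n (tupleBdry V n x) := by
  induction n with
  | zero =>
    suffices h : tupleBdry V 1 ∘ₗ subdivHomotopy β 1 =
        LinearMap.id - subdiv β 1 - subdivHomotopy β 0 ∘ₗ tupleBdry V 0 from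
      LinearMap.congr_fun h x
    refine Finsupp.lhom_ext' fun w => LinearMap.ext_ring ?_
    simp only [LinearMap.comp_apply, Finsupp.lsingle_apply, LinearMap.sub_apply,
      LinearMap.id_apply, subdivHomotopy_single, subdiv_single]
    rw [tupleBdry_cone, map_sub, tupleBdry_subdivHomotopy_zero β hβ]
    simp only [subdiv, LinearMap.id_apply, sub_zero]
    abel
  | succ n ih =>
    suffices h : tupleBdry V (n + 2) ∘ₗ subdivHomotopy β (n + 2) =
        LinearMap.id - subdiv β (n + 2) - subdivHomotopy β (n + 1) ∘ₗ tupleBdry V (n + 1) from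
      LinearMap.congr_fun h x
    refine Finsupp.lhom_ext' fun w => LinearMap.ext_ring ?_
    simp only [LinearMap.comp_apply, Finsupp.lsingle_apply, LinearMap.sub_apply,
      LinearMap.id_apply]
    rw [subdivHomotopy_single β (n + 1), subdiv_single β (n + 1), tupleBdry_cone, map_sub, ih,
      tupleBdry_tupleBdry]
    simp only [map_zero, sub_zero, sub_sub_cancel]
    abel

variable {β γ}

/-- A map taking apexes to apexes commutes with every stage of the recursion. For affine maps and
barycenters this is the naturality that reduces computations to the standard simplex. -/
theorem tupleMap_subdiv {f : V → W} (hf : ∀ n w, f (β n w) = γ n (f ∘ w)) (n : ℕ)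
    (x : TupleChain V n) : tupleMap f n (subdiv β n x) = subdiv γ n (tupleMap f n x) := by
  induction n with
  | zero => rfl
  | succ n ih =>
    suffices h : tupleMap f (n + 1) ∘ₗ subdiv β (n + 1) = subdiv γ (n + 1) ∘ₗ tupleMap f (n + 1)
      from LinearMap.congr_fun h x
    refine Finsupp.lhom_ext' fun w => LinearMap.ext_ring ?_
    simp only [LinearMap.comp_apply, Finsupp.lsingle_apply, tupleMap_single]
    rw [subdiv_single, subdiv_single, tupleMap_cone, ih, tupleMap_tupleBdry, tupleMap_single, hf]

theorem tupleMap_subdivHomotopy {f : V → W} (hf : ∀ n w, f (β n w) = γ n (f ∘ w)) (n : ℕ)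
    (x : TupleChain V n) :
    tupleMap f (n + 1) (subdivHomotopy β n x) = subdivHomotopy γ n (tupleMap f n x) := by
  induction n with
  | zero =>
    suffices h : tupleMap f 1 ∘ₗ subdivHomotopy β 0 = subdivHomotopy γ 0 ∘ₗ tupleMap f 0
      from LinearMap.congr_fun h x
    refine Finsupp.lhom_ext' fun w => LinearMap.ext_ring ?_
    simp only [LinearMap.comp_apply, Finsupp.lsingle_apply, tupleMap_single]
    rw [subdivHomotopy_single_zero, subdivHomotopy_single_zero, tupleMap_cone, tupleMap_single, hf]
  | succ n ih =>
    suffices h : tupleMap f (n + 2) ∘ₗ subdivHomotopy β (n + 1) =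
        subdivHomotopy γ (n + 1) ∘ₗ tupleMap f (n + 1)
      from LinearMap.congr_fun h x
    refine Finsupp.lhom_ext' fun w => LinearMap.ext_ring ?_
    simp only [LinearMap.comp_apply, Finsupp.lsingle_apply, tupleMap_single]
    rw [subdivHomotopy_single, subdivHomotopy_single, tupleMap_cone, map_sub, ih,
      tupleMap_tupleBdry, tupleMap_single, hf]

variable (β)

/-- The chain homotopy between the identity and the `m`-th power of the subdivision operator. -/
def iterHomotopy (m n : ℕ) : TupleChain V n →ₗ[ℝ] TupleChain V (n + 1) :=
  ∑ j ∈ Finset.range m, subdivHomotopy β n ∘ₗ subdiv β n ^ j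

theorem iterHomotopy_apply (m n : ℕ) (x : TupleChain V n) :
    iterHomotopy β m n x = ∑ j ∈ Finset.range m, subdivHomotopy β n ((subdiv β n ^ j) x) := by
  simp [iterHomotopy]

theorem tupleBdry_subdiv_pow (j n : ℕ) (x : TupleChain V (n + 1)) :
    tupleBdry V n ((subdiv β (n + 1) ^ j) x) = (subdiv β n ^ j) (tupleBdry V n x) := by
  induction j with
  | zero => rfl
  | succ j ih => rw [pow_succ', pow_succ', Module.End.mul_apply, tupleBdry_subdiv, ih,
      Module.End.mul_apply]

/-- The sum telescopes: the `j`-th summand contributes `S ^ j - S ^ (j + 1)` besides the term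
containing `∂`. -/
theorem tupleBdry_iterHomotopy (hβ : ∀ w, β 0 w = w 0) (m n : ℕ) (x : TupleChain V (n + 1)) :
    tupleBdry V (n + 1) (iterHomotopy β m (n + 1) x) =
      x - (subdiv β (n + 1) ^ m) x - iterHomotopy β m n (tupleBdry V n x) := by
  simp only [iterHomotopy_apply, map_sum, tupleBdry_subdivHomotopy β hβ, tupleBdry_subdiv_pow,
    Finset.sum_sub_distrib]
  have h := Finset.sum_range_sub' (fun j => (subdiv β (n + 1) ^ j) x) m
  simp only [pow_zero, Module.End.one_apply] at h
  rw [← h, Finset.sum_sub_distrib]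
  simp only [pow_succ', Module.End.mul_apply]

theorem tupleMap_subdiv_pow {β} {f : V → W} (hf : ∀ n w, f (β n w) = γ n (f ∘ w)) (j n : ℕ)
    (x : TupleChain V n) :
    tupleMap f n ((subdiv β n ^ j) x) = (subdiv γ n ^ j) (tupleMap f n x) := by
  induction j with
  | zero => rfl
  | succ j ih => rw [pow_succ', pow_succ', Module.End.mul_apply, tupleMap_subdiv hf, ih,
      Module.End.mul_apply]

theorem tupleMap_iterHomotopy {β} {f : V → W} (hf : ∀ n w, f (β n w) = γ n (f ∘ w)) (m n : ℕ)
    (x : TupleChain V n) :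
    tupleMap f (n + 1) (iterHomotopy β m n x) = iterHomotopy γ m n (tupleMap f n x) := by
  simp only [iterHomotopy_apply, map_sum, tupleMap_subdivHomotopy hf, tupleMap_subdiv_pow hf]

end Tuples

/-! ### Affine simplices in standard simplices -/

section Affine

/-- By linearity. Repeated use traces the simplices of an iterated subdivision back to the original
one. -/
theorem exists_of_map_ne_zero {α β : Type*} (L : (α →₀ ℝ) →ₗ[ℝ] (β →₀ ℝ)) {x : α →₀ ℝ} {b : β}
    (h : L x b ≠ 0) : ∃ a, x a ≠ 0 ∧ L (Finsupp.single a 1) b ≠ 0 := by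
  by_contra! h'
  refine h ?_
  conv_lhs => rw [← Finsupp.sum_single x, Finsupp.sum, map_sum, Finsupp.finsetSum_apply]
  refine Finset.sum_eq_zero fun a ha => ?_
  rw [← mul_one (x a), ← smul_eq_mul, ← Finsupp.smul_single, map_smul, Finsupp.smul_apply,
    h' a (Finsupp.mem_support_iff.1 ha), smul_zero]

theorem exists_of_mapDomain_ne_zero {α β : Type*} {f : α → β} {x : α →₀ ℝ} {b : β}
    (h : Finsupp.mapDomain f x b ≠ 0) : ∃ a, x a ≠ 0 ∧ f a = b := by
  obtain ⟨a, ha, hb⟩ := exists_of_map_ne_zero (Finsupp.lmapDomain ℝ ℝ f) (x := x) h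
  refine ⟨a, ha, ?_⟩
  by_contra hne
  simp [hne] at hb

variable {k l n : ℕ}

/-- The affine map of standard simplices with given values at the vertices. -/
def affineComb (w : Fin (n + 1) → stdSimplex ℝ (Fin (k + 1))) :
    C(stdSimplex ℝ (Fin (n + 1)), stdSimplex ℝ (Fin (k + 1))) where
  toFun t := ⟨∑ i, t i • (w i).1, (convex_stdSimplex ℝ _).sum_mem
    (fun i _ => stdSimplex.zero_le t i) (stdSimplex.sum_eq_one t) fun i _ => (w i).2⟩
  continuous_toFun := by
    refine Continuous.subtype_mk (continuous_finsetSum _ fun i _ => ?_) _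
    exact ((continuous_apply i).comp continuous_subtype_val).smul continuous_const

theorem affineComb_coe (w : Fin (n + 1) → stdSimplex ℝ (Fin (k + 1)))
    (t : stdSimplex ℝ (Fin (n + 1))) : (affineComb w t).1 = ∑ i, t i • (w i).1 := rfl

theorem affineComb_affineComb (w : Fin (n + 1) → stdSimplex ℝ (Fin (k + 1)))
    (u : Fin (l + 1) → stdSimplex ℝ (Fin (n + 1))) (t : stdSimplex ℝ (Fin (l + 1))) :
    affineComb w (affineComb u t) = affineComb (affineComb w ∘ u) t := by
  refine Subtype.ext ?_
  have h : ∀ i, (affineComb u t) i = ∑ j, t j * (u j) i := fun i => by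
    change (affineComb u t).1 i = _
    rw [affineComb_coe, Finset.sum_apply]
    rfl
  simp only [affineComb_coe, h, Function.comp_apply, Finset.sum_smul, Finset.smul_sum, mul_smul]
  exact Finset.sum_comm

theorem affineComb_vertex (w : Fin (n + 1) → stdSimplex ℝ (Fin (k + 1))) (i : Fin (n + 1)) :
    affineComb w (stdSimplex.vertex i) = w i := by
  refine Subtype.ext ?_
  rw [affineComb_coe, Finset.sum_eq_single i]
  · simp
  · intro j _ hj
    simp [hj]
  · simp

theorem affineComb_comp_vertex (w : Fin (n + 1) → stdSimplex ℝ (Fin (k + 1))) :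
    affineComb w ∘ (fun i => stdSimplex.vertex i) = w :=
  funext fun i => affineComb_vertex w i

theorem affineComb_map (w : Fin (n + 1) → stdSimplex ℝ (Fin (k + 1)))
    (f : Fin (l + 1) → Fin (n + 1)) (t : stdSimplex ℝ (Fin (l + 1))) :
    affineComb w (stdSimplex.map f t) = affineComb (w ∘ f) t := by
  refine Subtype.ext ?_
  simp only [affineComb_coe, stdSimplex.map_coe, FunOnFinite.linearMap_apply_apply,
    Function.comp_apply]
  rw [← Finset.sum_fiberwise Finset.univ f]
  refine Finset.sum_congr rfl fun i _ => ?_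
  rw [Finset.sum_smul]
  refine Finset.sum_congr (by ext; simp) fun j hj => ?_
  rw [(Finset.mem_filter.1 hj).2]

theorem affineComb_vertices (t : stdSimplex ℝ (Fin (n + 1))) :
    affineComb (fun i => stdSimplex.vertex i) t = t := by
  refine Subtype.ext (funext fun j => ?_)
  rw [affineComb_coe, Finset.sum_apply, Finset.sum_eq_single j]
  · simp; rfl
  · intro i _ hi
    simp [hi.symm]
  · simp

/-- The barycenter of an affine simplex. -/
def bary (k n : ℕ) (w : Fin (n + 1) → stdSimplex ℝ (Fin (k + 1))) : stdSimplex ℝ (Fin (k + 1)) :=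
  affineComb w stdSimplex.barycenter

theorem affineComb_bary (w : Fin (l + 1) → stdSimplex ℝ (Fin (k + 1))) (n : ℕ)
    (u : Fin (n + 1) → stdSimplex ℝ (Fin (l + 1))) :
    affineComb w (bary l n u) = bary k n (affineComb w ∘ u) :=
  affineComb_affineComb w u _

theorem map_eq_affineComb (f : Fin (n + 1) → Fin (k + 1)) :
    stdSimplex.map (S := ℝ) f = affineComb (fun i => stdSimplex.vertex (f i)) := by
  funext t
  have h := affineComb_map (fun i => stdSimplex.vertex i) f t
  rw [affineComb_vertices] at h
  exact h

theorem bary_zero (w : Fin 1 → stdSimplex ℝ (Fin (k + 1))) : bary k 0 w = w 0 := by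
  refine Subtype.ext ?_
  rw [bary, affineComb_coe]
  simp

/-! ### Decay of diameters under barycentric subdivision -/

theorem dist_affineComb_le (w : Fin (n + 1) → stdSimplex ℝ (Fin (k + 1)))
    {p : stdSimplex ℝ (Fin (k + 1))} {r : ℝ} (h : ∀ i, dist (w i) p ≤ r)
    (t : stdSimplex ℝ (Fin (n + 1))) : dist (affineComb w t) p ≤ r := by
  have h' : ∑ i, t i • (w i).1 ∈ Metric.closedBall p.1 r :=
    (convex_closedBall p.1 r).sum_mem (fun i _ => stdSimplex.zero_le t i)
      (stdSimplex.sum_eq_one t) fun i _ => Metric.mem_closedBall.2 (h i)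
  exact Metric.mem_closedBall.1 h'

/-- The difference between the barycenter and `w i` is the average over all `n + 1` indices `j` of
`w j - w i`. The term `j = i` vanishes, which leaves `n` terms of norm at most `d`. -/
theorem dist_bary_le (w : Fin (n + 1) → stdSimplex ℝ (Fin (k + 1))) {d : ℝ}
    (h : ∀ i j, dist (w i) (w j) ≤ d) (i : Fin (n + 1)) :
    dist (bary k n w) (w i) ≤ n / (n + 1) * d := by
  have hn : (0 : ℝ) < n + 1 := by positivity
  have key : (bary k n w).1 - (w i).1 = ((n : ℝ) + 1)⁻¹ • ∑ j, ((w j).1 - (w i).1) := by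
    have hb : (bary k n w).1 = ((n : ℝ) + 1)⁻¹ • ∑ j, (w j).1 := by
      rw [bary, affineComb_coe, Finset.smul_sum]
      refine Finset.sum_congr rfl fun j _ => ?_
      congr 1
      change (stdSimplex.barycenter : stdSimplex ℝ (Fin (n + 1))).1 j = _
      simp
    rw [hb, Finset.sum_sub_distrib, smul_sub]
    congr 1
    simp only [Finset.sum_const, Finset.card_univ, Fintype.card_fin]
    rw [← Nat.cast_smul_eq_nsmul ℝ, smul_smul]
    push_cast
    rw [inv_mul_cancel₀ hn.ne', one_smul]
  rw [Subtype.dist_eq, dist_eq_norm, key, norm_smul, Real.norm_of_nonneg (by positivity),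
    div_eq_inv_mul, mul_assoc]
  refine mul_le_mul_of_nonneg_left ?_ (by positivity)
  rw [← Finset.sum_erase (a := i) _ (by simp)]
  refine (norm_sum_le_of_le (f := fun j => (w j).1 - (w i).1) (n := fun _ => d) _
    fun j _ => ?_).trans ?_
  · rw [← dist_eq_norm, ← Subtype.dist_eq]
    exact h j i
  · simp [Finset.card_erase_of_mem]

/-- By naturality the subdivision of `w` is the affine image of a subdivision of the standard
simplex. The point is that the new vertices are convex combinations of the entries of `w`. -/
theorem exists_of_subdiv_ne_zero {w : Fin (n + 1) → stdSimplex ℝ (Fin (k + 1))}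
    {u : Fin (n + 1) → stdSimplex ℝ (Fin (k + 1))}
    (hu : subdiv (bary k) n (Finsupp.single w 1) u ≠ 0) :
    ∃ v, u = affineComb w ∘ v := by
  rw [← affineComb_comp_vertex w, ← tupleMap_single, ← tupleMap_subdiv (affineComb_bary w)] at hu
  obtain ⟨v, _, hv⟩ := exists_of_mapDomain_ne_zero hu
  exact ⟨v, hv.symm⟩

theorem exists_of_subdivHomotopy_ne_zero {w : Fin (n + 1) → stdSimplex ℝ (Fin (k + 1))}
    {u : Fin (n + 2) → stdSimplex ℝ (Fin (k + 1))}
    (hu : subdivHomotopy (bary k) n (Finsupp.single w 1) u ≠ 0) :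
    ∃ v, u = affineComb w ∘ v := by
  rw [← affineComb_comp_vertex w, ← tupleMap_single,
    ← tupleMap_subdivHomotopy (affineComb_bary w)] at hu
  obtain ⟨v, _, hv⟩ := exists_of_mapDomain_ne_zero hu
  exact ⟨v, hv.symm⟩

theorem exists_of_tupleBdry_ne_zero {V : Type*} {w : Fin (n + 2) → V} {v : Fin (n + 1) → V}
    (h : tupleBdry V n (Finsupp.single w 1) v ≠ 0) : ∃ i : Fin (n + 2), v = w ∘ i.succAbove := by
  rw [tupleBdry_single, Finsupp.finsetSum_apply] at h
  obtain ⟨i, _, hi⟩ := Finset.exists_ne_zero_of_sum_ne_zero h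
  refine ⟨i, ?_⟩
  by_contra hne
  exact hi (Finsupp.single_eq_of_ne hne)

/-- Two vertices of a subdivided simplex either both come from the subdivision of a facet, where
induction gives a smaller factor, or one of them is the barycenter of `w`. In the latter case the
other is a convex combination of vertices of `w`, and `dist_bary_le` applies. -/
theorem dist_le_of_subdiv_ne_zero (n : ℕ) {w u : Fin (n + 1) → stdSimplex ℝ (Fin (k + 1))} {d : ℝ}
    (h : ∀ i j, dist (w i) (w j) ≤ d) (hu : subdiv (bary k) n (Finsupp.single w 1) u ≠ 0)
    (i j : Fin (n + 1)) : dist (u i) (u j) ≤ n / (n + 1) * d := by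
  have hd : 0 ≤ d := dist_nonneg.trans (h 0 0)
  induction n with
  | zero =>
    rw [Subsingleton.elim (α := Fin 1) i j, dist_self]
    positivity
  | succ n ih =>
    rw [subdiv_single] at hu
    obtain ⟨u', hu', rfl⟩ := exists_of_mapDomain_ne_zero hu
    obtain ⟨v, hv, hvu⟩ := exists_of_map_ne_zero _ hu'
    obtain ⟨a, rfl⟩ := exists_of_tupleBdry_ne_zero hv
    obtain ⟨x, hx⟩ := exists_of_subdiv_ne_zero hvu
    have hb : ∀ j, dist (u' j) (bary k (n + 1) w) ≤ (n + 1 : ℕ) / ((n + 1 : ℕ) + 1) * d := by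
      intro j
      rw [hx]
      refine dist_affineComb_le _ (fun i => ?_) _
      rw [dist_comm]
      exact dist_bary_le w h _
    have hmono : (n : ℝ) / (n + 1) * d ≤ (n + 1 : ℕ) / ((n + 1 : ℕ) + 1) * d := by
      refine mul_le_mul_of_nonneg_right ?_ hd
      push_cast
      rw [div_le_div_iff₀ (by positivity) (by positivity)]
      nlinarith
    refine Fin.cases ?_ (fun i => ?_) i <;> refine Fin.cases ?_ (fun j => ?_) j
    · simp only [dist_self]
      positivity
    · rw [dist_comm]
      simpa using hb j
    · simpa using hb i
    · simpa using (ih (fun i j => h _ _) hvu i j).trans hmono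

theorem dist_le_of_subdiv_pow_ne_zero (m : ℕ) {w u : Fin (n + 1) → stdSimplex ℝ (Fin (k + 1))}
    {d : ℝ} (h : ∀ i j, dist (w i) (w j) ≤ d)
    (hu : (subdiv (bary k) n ^ m) (Finsupp.single w 1) u ≠ 0) (i j : Fin (n + 1)) :
    dist (u i) (u j) ≤ ((n : ℝ) / (n + 1)) ^ m * d := by
  induction m generalizing u i j with
  | zero =>
    obtain rfl : u = w := by
      by_contra hne
      exact hu (by simp [Ne.symm hne])
    simpa using h i j
  | succ m ih =>
    rw [pow_succ', Module.End.mul_apply] at hu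
    obtain ⟨v, hv, hvu⟩ := exists_of_map_ne_zero _ hu
    rw [pow_succ', mul_assoc]
    exact dist_le_of_subdiv_ne_zero n (ih hv) hvu i j

end Affine

/-! ### Finite singular chains -/

section FinChain

variable {X : Type*} [TopologicalSpace X]

variable (X) in
/-- Finite real singular chains. -/
abbrev FinChain (n : ℕ) : Type _ := Sing X n →₀ ℝ

variable (X) in
/-- The boundary operator of finite singular chains. -/
def finBdry (n : ℕ) : FinChain X (n + 1) →ₗ[ℝ] FinChain X n :=
  Finsupp.linearCombination ℝ fun σ =>
    ∑ i : Fin (n + 2), Finsupp.single (face i σ) ((-1) ^ (i : ℕ))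

theorem finBdry_single (n : ℕ) (σ : Sing X (n + 1)) :
    finBdry X n (Finsupp.single σ 1) =
      ∑ i : Fin (n + 2), Finsupp.single (face i σ) ((-1) ^ (i : ℕ)) := by
  simp [finBdry]

/-- The singular chain corresponding to a chain of affine simplices in the domain of a singular
simplex. -/
def realize {k : ℕ} (σ : Sing X k) (n : ℕ) :
    TupleChain (stdSimplex ℝ (Fin (k + 1))) n →ₗ[ℝ] FinChain X n :=
  Finsupp.lmapDomain ℝ ℝ fun w => σ.comp (affineComb w)

theorem realize_single {k : ℕ} (σ : Sing X k) (n : ℕ)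
    (w : Fin (n + 1) → stdSimplex ℝ (Fin (k + 1))) (a : ℝ) :
    realize σ n (Finsupp.single w a) = Finsupp.single (σ.comp (affineComb w)) a := by
  simp [realize]

theorem face_comp_affineComb {k n : ℕ} (σ : Sing X k)
    (w : Fin (n + 2) → stdSimplex ℝ (Fin (k + 1))) (i : Fin (n + 2)) :
    face i (σ.comp (affineComb w)) = σ.comp (affineComb (w ∘ i.succAbove)) :=
  ContinuousMap.ext fun t => congrArg σ (affineComb_map w i.succAbove t)

theorem realize_tupleBdry {k : ℕ} (σ : Sing X k) (n : ℕ)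
    (x : TupleChain (stdSimplex ℝ (Fin (k + 1))) (n + 1)) :
    realize σ n (tupleBdry _ n x) = finBdry X n (realize σ (n + 1) x) := by
  suffices h : realize σ n ∘ₗ tupleBdry _ n = finBdry X n ∘ₗ realize σ (n + 1) from
    LinearMap.congr_fun h x
  refine Finsupp.lhom_ext' fun w => LinearMap.ext_ring ?_
  simp [tupleBdry_single, realize_single, finBdry_single, face_comp_affineComb]

/-- The tautological affine simplex. -/
def taut (n : ℕ) : TupleChain (stdSimplex ℝ (Fin (n + 1))) n :=
  Finsupp.single (fun i => stdSimplex.vertex i) 1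

theorem realize_taut {n : ℕ} (σ : Sing X n) : realize σ n (taut n) = Finsupp.single σ 1 := by
  rw [taut, realize_single]
  congr 1
  exact ContinuousMap.ext fun t => congrArg σ (affineComb_vertices t)

theorem finBdry_finBdry (n : ℕ) (c : FinChain X (n + 2)) :
    finBdry X n (finBdry X (n + 1) c) = 0 := by
  suffices h : finBdry X n ∘ₗ finBdry X (n + 1) = 0 from LinearMap.congr_fun h c
  refine Finsupp.lhom_ext' fun σ => LinearMap.ext_ring ?_
  simp only [LinearMap.comp_apply, Finsupp.lsingle_apply, LinearMap.zero_apply]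
  rw [← realize_taut, ← realize_tupleBdry, ← realize_tupleBdry, tupleBdry_tupleBdry, map_zero]

theorem realize_face {k n : ℕ} (σ : Sing X (k + 1)) (i : Fin (k + 2))
    (x : TupleChain (stdSimplex ℝ (Fin (k + 1))) n) :
    realize (face i σ) n x =
      realize σ n (tupleMap (affineComb fun j => stdSimplex.vertex (i.succAbove j)) n x) := by
  suffices h : realize (face i σ) n = realize σ n ∘ₗ
      tupleMap (affineComb fun j => stdSimplex.vertex (i.succAbove j)) n from
    LinearMap.congr_fun h x
  refine Finsupp.lhom_ext' fun w => LinearMap.ext_ring ?_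
  simp only [LinearMap.comp_apply, Finsupp.lsingle_apply, realize_single, tupleMap_single]
  congr 1
  refine ContinuousMap.ext fun t => congrArg σ ?_
  rw [← affineComb_affineComb]
  exact congrFun (map_eq_affineComb i.succAbove) _

theorem tupleMap_taut {k n : ℕ} (w : Fin (n + 1) → stdSimplex ℝ (Fin (k + 1))) :
    tupleMap (affineComb w) n (taut n) = Finsupp.single w 1 := by
  rw [taut, tupleMap_single, affineComb_comp_vertex]

theorem tupleBdry_taut (n : ℕ) :
    tupleBdry _ n (taut (n + 1)) = ∑ i : Fin (n + 2), (-1 : ℝ) ^ (i : ℕ) •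
      tupleMap (affineComb fun j => stdSimplex.vertex (i.succAbove j)) n (taut n) := by
  rw [taut, tupleBdry_single]
  refine Finset.sum_congr rfl fun i _ => ?_
  rw [tupleMap_taut, Finsupp.smul_single, smul_eq_mul, mul_one]
  rfl

/-! ### Subdividing singular simplices subordinate to a covering -/

/-- A singular simplex is small of order `U` if its image is contained in a member of `U`. -/
def IsSmall {I : Type*} (U : I → Set X) {n : ℕ} (σ : Sing X n) : Prop :=
  ∃ i, Set.range σ ⊆ U i

/-- A Lebesgue number of the pulled back covering is compared with the geometric decay of diameters.
All depths from `m` on are needed, because a simplex is later subdivided more deeply than its own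
faces. -/
theorem exists_subdiv_small {I : Type*} {U : I → Set X} (hU : ⋃ i, interior (U i) = Set.univ)
    {n : ℕ} (σ : Sing X n) :
    ∃ m, ∀ j ≥ m, ∀ u, (subdiv (bary n) n ^ j) (taut n) u ≠ 0 →
      IsSmall U (σ.comp (affineComb u)) := by
  obtain ⟨δ, hδ, hball⟩ := lebesgue_number_lemma_of_metric
    (isCompact_univ (X := stdSimplex ℝ (Fin (n + 1))))
    (c := fun i => σ ⁻¹' interior (U i)) (fun i => isOpen_interior.preimage σ.continuous)
    (by rw [← Set.preimage_iUnion, hU]; exact Set.subset_univ _)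
  set d := Metric.diam (Set.univ : Set (stdSimplex ℝ (Fin (n + 1))))
  have hd : ∀ x y : stdSimplex ℝ (Fin (n + 1)), dist x y ≤ d := fun x y =>
    Metric.dist_le_diam_of_mem isCompact_univ.isBounded (Set.mem_univ x) (Set.mem_univ y)
  have hlim : Filter.Tendsto (fun m => ((n : ℝ) / (n + 1)) ^ m * d) Filter.atTop (nhds (0 * d)) :=
    (tendsto_pow_atTop_nhds_zero_of_lt_one (by positivity)
      ((div_lt_one (by positivity)).2 (lt_add_one _))).mul_const d
  rw [zero_mul] at hlim
  obtain ⟨m, hm⟩ := Filter.eventually_atTop.1 (hlim.eventually_lt_const hδ)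
  refine ⟨m, fun j hj u hu => ?_⟩
  obtain ⟨i, hi⟩ := hball (u 0) (Set.mem_univ _)
  refine ⟨i, ?_⟩
  rintro _ ⟨t, rfl⟩
  refine interior_subset (hi (Metric.mem_ball.2 (lt_of_le_of_lt ?_ (hm j hj))))
  exact dist_affineComb_le u (fun a =>
    dist_le_of_subdiv_pow_ne_zero j (fun i j => hd _ _) hu a 0) t

/-- The maximum of a function on singular simplices over the iterated faces of a simplex. -/
def faceSup (m : ∀ n, Sing X n → ℕ) : ∀ n, Sing X n → ℕ
  | 0, σ => m 0 σ
  | n + 1, σ => max (m (n + 1) σ) (Finset.univ.sup fun i => faceSup m n (face i σ))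

theorem le_faceSup (m : ∀ n, Sing X n → ℕ) (n : ℕ) (σ : Sing X n) : m n σ ≤ faceSup m n σ := by
  cases n with
  | zero => exact le_rfl
  | succ n => exact le_max_left _ _

theorem faceSup_face_le (m : ∀ n, Sing X n → ℕ) (n : ℕ) (σ : Sing X (n + 1)) (i : Fin (n + 2)) :
    faceSup m n (face i σ) ≤ faceSup m (n + 1) σ :=
  (Finset.le_sup (f := fun i => faceSup m n (face i σ)) (Finset.mem_univ i)).trans
    (le_max_right _ _)

/-- The chain homotopy between the identity and a subdivision of depth depending on simplices. -/
def depthHomotopy (m : ∀ n, Sing X n → ℕ) (n : ℕ) : FinChain X n →ₗ[ℝ] FinChain X (n + 1) :=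
  Finsupp.linearCombination ℝ fun σ =>
    realize σ (n + 1) (iterHomotopy (bary n) (m n σ) n (taut n))

theorem depthHomotopy_single (m : ∀ n, Sing X n → ℕ) (n : ℕ) (σ : Sing X n) :
    depthHomotopy m n (Finsupp.single σ 1) =
      realize σ (n + 1) (iterHomotopy (bary n) (m n σ) n (taut n)) := by
  simp [depthHomotopy]

theorem range_subset_of_depthHomotopy_ne_zero (m : ∀ n, Sing X n → ℕ) {n : ℕ} {σ : Sing X n}
    {τ : Sing X (n + 1)} (h : depthHomotopy m n (Finsupp.single σ 1) τ ≠ 0) :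
    Set.range τ ⊆ Set.range σ := by
  rw [depthHomotopy_single] at h
  obtain ⟨u, _, rfl⟩ := exists_of_mapDomain_ne_zero h
  rintro _ ⟨t, rfl⟩
  exact ⟨_, rfl⟩

/-- If all simplices had the same depth `m`, only the subdivision `S ^ m σ` would remain. The
difference of depths between `σ` and its faces adds the terms `T S ^ j` of the face `face i σ` with
`j` between `m n (face i σ)` and `m (n + 1) σ`. These are small too, since `j` is at least the depth
required for that face. -/
theorem isSmall_of_depthHomotopy {I : Type*} {U : I → Set X} {m : ∀ n, Sing X n → ℕ}
    (hm : ∀ n σ, ∀ j ≥ m n σ, ∀ u, (subdiv (bary n) n ^ j) (taut n) u ≠ 0 →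
      IsSmall U (σ.comp (affineComb u)))
    (hface : ∀ n (σ : Sing X (n + 1)) i, m n (face i σ) ≤ m (n + 1) σ) {n : ℕ}
    {σ τ : Sing X (n + 1)}
    (h : (Finsupp.single σ 1 - finBdry X (n + 1) (depthHomotopy m (n + 1) (Finsupp.single σ 1)) -
      depthHomotopy m n (finBdry X n (Finsupp.single σ 1)) : FinChain X (n + 1)) τ ≠ 0) :
    IsSmall U τ := by
  have h1 : finBdry X (n + 1) (depthHomotopy m (n + 1) (Finsupp.single σ 1)) =
      Finsupp.single σ 1 - realize σ (n + 1) ((subdiv (bary (n + 1)) (n + 1) ^ m (n + 1) σ)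
        (taut (n + 1))) - ∑ i : Fin (n + 2), (-1 : ℝ) ^ (i : ℕ) • realize (face i σ) (n + 1)
          (iterHomotopy (bary n) (m (n + 1) σ) n (taut n)) := by
    rw [depthHomotopy_single, ← realize_tupleBdry, tupleBdry_iterHomotopy _ bary_zero, map_sub,
      map_sub, realize_taut, tupleBdry_taut, map_sum, map_sum]
    congr 1
    refine Finset.sum_congr rfl fun i _ => ?_
    rw [map_smul, map_smul, realize_face, tupleMap_iterHomotopy (affineComb_bary _)]
  have h2 : depthHomotopy m n (finBdry X n (Finsupp.single σ 1)) =
      ∑ i : Fin (n + 2), (-1 : ℝ) ^ (i : ℕ) • realize (face i σ) (n + 1)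
          (iterHomotopy (bary n) (m n (face i σ)) n (taut n)) := by
    rw [finBdry_single, map_sum]
    refine Finset.sum_congr rfl fun i _ => ?_
    rw [← mul_one ((-1 : ℝ) ^ (i : ℕ)), ← smul_eq_mul, ← Finsupp.smul_single, map_smul,
      depthHomotopy_single, smul_eq_mul, mul_one]
  have h3 : Finsupp.single σ 1 -
        finBdry X (n + 1) (depthHomotopy m (n + 1) (Finsupp.single σ 1)) -
        depthHomotopy m n (finBdry X n (Finsupp.single σ 1)) =
      realize σ (n + 1) ((subdiv (bary (n + 1)) (n + 1) ^ m (n + 1) σ) (taut (n + 1))) +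
        ∑ i : Fin (n + 2), (-1 : ℝ) ^ (i : ℕ) • realize (face i σ) (n + 1)
          (∑ j ∈ Finset.Ico (m n (face i σ)) (m (n + 1) σ),
            subdivHomotopy (bary n) n ((subdiv (bary n) n ^ j) (taut n))) := by
    rw [h1, h2]
    simp only [iterHomotopy_apply, Finset.sum_Ico_eq_sub _ (hface n σ _), map_sub, smul_sub,
      Finset.sum_sub_distrib]
    abel
  rw [h3, Finsupp.add_apply] at h
  rcases ne_or_eq (realize σ (n + 1) ((subdiv (bary (n + 1)) (n + 1) ^ m (n + 1) σ)
    (taut (n + 1))) τ) 0 with h4 | h4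
  · obtain ⟨u, hu, rfl⟩ := exists_of_mapDomain_ne_zero h4
    exact hm _ σ _ le_rfl u hu
  · rw [h4, zero_add, Finsupp.finsetSum_apply] at h
    obtain ⟨i, _, hi⟩ := Finset.exists_ne_zero_of_sum_ne_zero h
    obtain ⟨u, hu, rfl⟩ := exists_of_mapDomain_ne_zero (right_ne_zero_of_mul hi)
    rw [Finsupp.finsetSum_apply] at hu
    obtain ⟨j, hj, hu⟩ := Finset.exists_ne_zero_of_sum_ne_zero hu
    obtain ⟨v, hv, hvu⟩ := exists_of_map_ne_zero _ hu
    obtain ⟨a, ha⟩ := hm n (face i σ) j (Finset.mem_Ico.1 hj).1 v hv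
    obtain ⟨x, rfl⟩ := exists_of_subdivHomotopy_ne_zero hvu
    refine ⟨a, subset_trans ?_ ha⟩
    rintro _ ⟨t, rfl⟩
    exact ⟨affineComb x t, congrArg (face i σ) (affineComb_affineComb v x t)⟩

end FinChain

/-! ### Extending operators to compactly finite chains -/

section LocalExtend

variable {X : Type*} [TopologicalSpace X]

/-- An operator on finite singular chains is local if it does not enlarge the images of
singular simplices. -/
def IsLocal {n m : ℕ} (L : FinChain X n →ₗ[ℝ] FinChain X m) : Prop :=
  ∀ σ τ, L (Finsupp.single σ 1) τ ≠ 0 → Set.range τ ⊆ Set.range σ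

/-- The extension of a local operator to compactly finite chains. -/
def localExtend {n m : ℕ} (L : FinChain X n →ₗ[ℝ] FinChain X m) (c : Sing X n → ℝ) :
    Sing X m → ℝ :=
  fun τ => ∑ᶠ σ, c σ * L (Finsupp.single σ 1) τ

variable {n m l : ℕ}

theorem exists_of_localExtend_ne_zero {L : FinChain X n →ₗ[ℝ] FinChain X m} {c : Sing X n → ℝ}
    {τ : Sing X m} (h : localExtend L c τ ≠ 0) :
    ∃ σ, c σ ≠ 0 ∧ L (Finsupp.single σ 1) τ ≠ 0 := by
  obtain ⟨σ, hσ⟩ := exists_ne_zero_of_finsum h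
  exact ⟨σ, left_ne_zero_of_mul hσ, right_ne_zero_of_mul hσ⟩

/-- The image of `τ` is a compact set meeting all these simplices. This is what makes the infinite
sums defining extensions of local operators finite at each `τ`. -/
theorem finite_range_subset {c : Sing X n → ℝ} (hc : c ∈ cfChains X n) (τ : Sing X m) :
    {σ | c σ ≠ 0 ∧ Set.range τ ⊆ Set.range σ}.Finite := by
  refine (mem_cfChains.1 hc _ (isCompact_range_sing τ)).subset fun σ h => ⟨h.1, ?_⟩
  rw [Set.inter_eq_left.2 h.2]
  exact range_sing_nonempty τ

theorem finite_support_localExtend {L : FinChain X n →ₗ[ℝ] FinChain X m} (hL : IsLocal L)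
    {c : Sing X n → ℝ} (hc : c ∈ cfChains X n) (τ : Sing X m) :
    (Function.support fun σ => c σ * L (Finsupp.single σ 1) τ).Finite :=
  (finite_range_subset hc τ).subset fun σ h =>
    ⟨left_ne_zero_of_mul h, hL σ τ (right_ne_zero_of_mul h)⟩

theorem localExtend_mem_cfChains {L : FinChain X n →ₗ[ℝ] FinChain X m} (hL : IsLocal L)
    {c : Sing X n → ℝ} (hc : c ∈ cfChains X n) : localExtend L c ∈ cfChains X m := by
  refine mem_cfChains.2 fun K hK => ?_
  refine ((mem_cfChains.1 hc K hK).biUnion fun σ _ =>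
    (L (Finsupp.single σ 1)).hasFiniteSupport).subset ?_
  rintro τ ⟨h1, h2⟩
  obtain ⟨σ, hσ, hτ⟩ := exists_of_localExtend_ne_zero h1
  exact Set.mem_biUnion (x := σ) ⟨hσ, h2.mono (Set.inter_subset_inter_right _ (hL σ τ hτ))⟩ hτ

theorem localExtend_finsupp (L : FinChain X n →ₗ[ℝ] FinChain X m) (c : FinChain X n) :
    localExtend L c = L c := by
  funext τ
  conv_rhs => rw [← Finsupp.sum_single c, Finsupp.sum, map_sum, Finsupp.finsetSum_apply]
  rw [localExtend, finsum_eq_sum_of_support_subset (s := c.support)]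
  · refine Finset.sum_congr rfl fun σ _ => ?_
    conv_rhs => rw [← mul_one (c σ), ← smul_eq_mul, ← Finsupp.smul_single, map_smul]
    rfl
  · intro σ h
    exact Finsupp.mem_support_iff.2 (left_ne_zero_of_mul h)

/-- The sums may be interchanged because, by locality, only the finitely many `σ` in the support of
`c` whose images contain the image of `ρ` contribute at `ρ`. -/
theorem localExtend_localExtend {L : FinChain X n →ₗ[ℝ] FinChain X m} (hL : IsLocal L)
    {M : FinChain X m →ₗ[ℝ] FinChain X l} (hM : IsLocal M) {c : Sing X n → ℝ}
    (hc : c ∈ cfChains X n) : localExtend M (localExtend L c) = localExtend (M ∘ₗ L) c := by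
  funext ρ
  have h1 : ∀ σ, (M ∘ₗ L) (Finsupp.single σ 1) ρ =
      ∑ᶠ τ, L (Finsupp.single σ 1) τ * M (Finsupp.single τ 1) ρ := fun σ =>
    (congrFun (localExtend_finsupp M (L (Finsupp.single σ 1))) ρ).symm
  have h2 : ∀ τ, localExtend L c τ * M (Finsupp.single τ 1) ρ =
      ∑ᶠ σ, c σ * L (Finsupp.single σ 1) τ * M (Finsupp.single τ 1) ρ := fun τ =>
    finsum_mul _ _
  have hfin := finite_range_subset hc ρ
  change ∑ᶠ τ, localExtend L c τ * M (Finsupp.single τ 1) ρ = ∑ᶠ σ, c σ * _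
  simp only [h1, h2]
  rw [finsum_swap]
  · simp only [mul_finsum, mul_assoc]
  · refine ((hfin.biUnion fun σ _ => (L (Finsupp.single σ 1)).hasFiniteSupport).prod hfin).subset ?_
    rintro ⟨τ, σ⟩ h
    have h3 := left_ne_zero_of_mul (left_ne_zero_of_mul h)
    have h4 := right_ne_zero_of_mul (left_ne_zero_of_mul h)
    have h5 : σ ∈ {σ | c σ ≠ 0 ∧ Set.range ρ ⊆ Set.range σ} :=
      ⟨h3, (hM _ _ (right_ne_zero_of_mul h)).trans (hL _ _ h4)⟩
    exact ⟨Set.mem_biUnion h5 h4, h5⟩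

theorem localExtend_sub {L M : FinChain X n →ₗ[ℝ] FinChain X m} (hL : IsLocal L) (hM : IsLocal M)
    {c : Sing X n → ℝ} (hc : c ∈ cfChains X n) :
    localExtend (L - M) c = localExtend L c - localExtend M c := by
  funext τ
  simp only [localExtend, LinearMap.sub_apply, Finsupp.sub_apply, mul_sub, Pi.sub_apply]
  exact finsum_sub_distrib (finite_support_localExtend hL hc τ)
    (finite_support_localExtend hM hc τ)

theorem localExtend_id (c : Sing X n → ℝ) : localExtend LinearMap.id c = c := by
  funext τ
  rw [localExtend, finsum_eq_single _ τ]
  · simp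
  · intro σ hσ
    simp [hσ.symm]

theorem isLocal_id : IsLocal (LinearMap.id : FinChain X n →ₗ[ℝ] FinChain X n) := by
  intro σ τ h
  by_cases hστ : τ = σ
  · rw [hστ]
  · exact absurd (Finsupp.single_eq_of_ne hστ) h

theorem IsLocal.sub {L M : FinChain X n →ₗ[ℝ] FinChain X m} (hL : IsLocal L) (hM : IsLocal M) :
    IsLocal (L - M) := by
  intro σ τ h
  by_cases h' : L (Finsupp.single σ 1) τ = 0
  · refine hM σ τ fun h'' => h ?_
    rw [LinearMap.sub_apply, Finsupp.sub_apply, h', h'', sub_zero]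
  · exact hL σ τ h'

theorem IsLocal.comp {L : FinChain X n →ₗ[ℝ] FinChain X m} (hL : IsLocal L)
    {M : FinChain X m →ₗ[ℝ] FinChain X l} (hM : IsLocal M) : IsLocal (M ∘ₗ L) := by
  intro σ ρ h
  obtain ⟨τ, h1, h2⟩ := exists_of_map_ne_zero M h
  exact (hM _ _ h2).trans (hL _ _ h1)

theorem finBdry_single_apply (σ : Sing X (n + 1)) (τ : Sing X n) :
    finBdry X n (Finsupp.single σ 1) τ = incidence σ τ := by
  classical
  rw [finBdry_single, Finsupp.finsetSum_apply, incidence]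
  exact Finset.sum_congr rfl fun i _ => by rw [Finsupp.single_apply]

theorem isLocal_finBdry : IsLocal (finBdry X n) := fun σ τ h =>
  range_subset_of_incidence_ne_zero (by rwa [finBdry_single_apply] at h)

theorem isLocal_depthHomotopy (m : ∀ n, Sing X n → ℕ) : IsLocal (depthHomotopy m n) :=
  fun _ _ h => range_subset_of_depthHomotopy_ne_zero m h

theorem bdry_eq_localExtend (c : Sing X (n + 1) → ℝ) : bdry c = localExtend (finBdry X n) c := by
  funext τ
  simp only [bdry, localExtend, finBdry_single_apply, mul_comm]

theorem bdry_finsupp (c : FinChain X (n + 1)) : bdry c = finBdry X n c := by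
  rw [bdry_eq_localExtend, localExtend_finsupp]

theorem bdry_bdry {c : Sing X (n + 2) → ℝ} (hc : c ∈ cfChains X (n + 2)) : bdry (bdry c) = 0 := by
  have h : finBdry X n ∘ₗ finBdry X (n + 1) = 0 := LinearMap.ext fun c => finBdry_finBdry n c
  rw [bdry_eq_localExtend, bdry_eq_localExtend, localExtend_localExtend isLocal_finBdry
    isLocal_finBdry hc, h]
  funext τ
  simp [localExtend]

/-- Compactly finite chains can be made small by a homotopy preserving small chains. -/
theorem exists_smallHomotopy {I : Type*} {U : I → Set X} (hU : ⋃ i, interior (U i) = Set.univ) :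
    ∃ D : ∀ n, (Sing X n → ℝ) → Sing X (n + 1) → ℝ, (∀ n, D n 0 = 0) ∧
      (∀ n, ∀ c ∈ cfChains X n, D n c ∈ cfChains X (n + 1)) ∧
      (∀ n c, (∀ σ, c σ ≠ 0 → IsSmall U σ) → ∀ τ, D n c τ ≠ 0 → IsSmall U τ) ∧
      ∀ n, ∀ c ∈ cfChains X (n + 1), ∀ τ,
        (c - bdry (D (n + 1) c) - D n (bdry c)) τ ≠ 0 → IsSmall U τ := by
  choose m0 hm0 using fun n (σ : Sing X n) => exists_subdiv_small hU σ
  -- Passing to the maximum over iterated faces makes the depth monotone with respect to faces, as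
  -- the comparison of depths requires.
  set m := faceSup m0
  refine ⟨fun n => localExtend (depthHomotopy m n), fun n => ?_, fun n c hc =>
    localExtend_mem_cfChains (isLocal_depthHomotopy m) hc, fun n c hc τ hτ => ?_,
    fun n c hc τ hτ => ?_⟩
  · funext τ
    simp [localExtend]
  · obtain ⟨σ, h1, h2⟩ := exists_of_localExtend_ne_zero hτ
    obtain ⟨i, hi⟩ := hc σ h1
    exact ⟨i, (isLocal_depthHomotopy m σ τ h2).trans hi⟩
  · have hd := isLocal_depthHomotopy (n := n) m
    have hd' := isLocal_depthHomotopy (n := n + 1) m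
    have hb := isLocal_finBdry (X := X) (n := n)
    have hb' := isLocal_finBdry (X := X) (n := n + 1)
    have h : c - bdry (localExtend (depthHomotopy m (n + 1)) c) -
        localExtend (depthHomotopy m n) (bdry c) =
        localExtend (LinearMap.id - finBdry X (n + 1) ∘ₗ depthHomotopy m (n + 1) -
          depthHomotopy m n ∘ₗ finBdry X n) c := by
      rw [bdry_eq_localExtend, bdry_eq_localExtend, localExtend_localExtend hd' hb' hc,
        localExtend_localExtend hb hd hc, localExtend_sub (isLocal_id.sub (hd'.comp hb'))
        (hb.comp hd) hc, localExtend_sub isLocal_id (hd'.comp hb') hc, localExtend_id]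
    rw [h] at hτ
    obtain ⟨σ, h1, h2⟩ := exists_of_localExtend_ne_zero hτ
    exact isSmall_of_depthHomotopy (fun n σ j hj => hm0 n σ j ((le_faceSup m0 n σ).trans hj))
      (faceSup_face_le m0) h2

end LocalExtend

/-! ### The simplicial chain complex of a full simplex -/

section FullSimplex

variable {I : Type*} [LinearOrder I]

/-- The sign attached to a vertex `v` and a simplex `t`. -/
def vertexSign (t : Finset I) (v : I) : ℝ := (-1) ^ (t.filter (· < v)).card

theorem vertexSign_mul_self (t : Finset I) (v : I) : vertexSign t v * vertexSign t v = 1 := by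
  rw [vertexSign, ← pow_add, ← two_mul, pow_mul]
  simp

theorem vertexSign_insert {t : Finset I} {v : I} (hv : v ∉ t) (w : I) :
    vertexSign (insert v t) w = vertexSign t w * if v < w then -1 else 1 := by
  rw [vertexSign, Finset.filter_insert]
  split_ifs with h
  · rw [Finset.card_insert_of_notMem fun h' => hv (Finset.mem_filter.1 h').1, pow_succ, vertexSign]
  · rw [mul_one, vertexSign]

theorem vertexSign_insert_self {t : Finset I} {v : I} (hv : v ∉ t) :
    vertexSign (insert v t) v = vertexSign t v := by
  rw [vertexSign_insert hv, if_neg (lt_irrefl v), mul_one]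

/-- The boundary operator of the full simplex with the set of vertices `N`. -/
def fullBdry (N : Finset I) (f : Finset I → ℝ) (t : Finset I) : ℝ :=
  ∑ v ∈ N \ t, vertexSign t v * f (insert v t)

/-- The cone operator of a full simplex. -/
def fullCone (i : I) (f : Finset I → ℝ) (t : Finset I) : ℝ :=
  if i ∈ t then vertexSign t i * f (t.erase i) else 0

/-- The empty simplex is allowed, so this contracts the augmented complex, provided that `i` is one
of the vertices. If `i ∈ t`, the terms with `v ≠ i` cancel in pairs, since adding `v` and removing
`i` in the two orders gives opposite signs; if `i ∉ t`, only the insertion of `i` contributes. -/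
theorem fullBdry_fullCone_add {N : Finset I} {i : I} (hi : i ∈ N) (f : Finset I → ℝ)
    (t : Finset I) : fullBdry N (fullCone i f) t + fullCone i (fullBdry N f) t = f t := by
  by_cases hit : i ∈ t
  · obtain ⟨t, hit', rfl⟩ : ∃ t', i ∉ t' ∧ t = insert i t' :=
      ⟨t.erase i, Finset.notMem_erase i t, (Finset.insert_erase hit).symm⟩
    have hN : N \ t = insert i (N \ insert i t) := by
      ext v
      simp only [Finset.mem_sdiff, Finset.mem_insert, not_or]
      by_cases hv : v = i
      · simp [hv, hi, hit']
      · simp [hv]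
    have hnot : i ∉ N \ insert i t := by simp
    rw [fullCone, if_pos hit, Finset.erase_insert hit', fullBdry, fullBdry, hN,
      Finset.sum_insert hnot, vertexSign_insert_self hit', mul_add, ← mul_assoc,
      vertexSign_mul_self, one_mul, add_comm, add_assoc, Finset.mul_sum,
      ← Finset.sum_add_distrib, Finset.sum_eq_zero, add_zero]
    intro v hv
    simp only [Finset.mem_sdiff, Finset.mem_insert, not_or] at hv
    obtain ⟨_, hvi, hvt⟩ := hv
    have h1 : (insert v (insert i t)).erase i = insert v t := by
      rw [Finset.insert_comm, Finset.erase_insert]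
      simp [Ne.symm hvi, hit']
    have h2 : v ∉ insert i t := by simp [hvi, hvt]
    rw [fullCone, if_pos (by simp), h1, vertexSign_insert h2, vertexSign_insert_self hit',
      vertexSign_insert hit']
    rcases lt_or_gt_of_ne hvi with h | h
    · rw [if_pos h, if_neg h.not_gt]
      ring
    · rw [if_pos h, if_neg h.not_gt]
      ring
  · rw [fullCone, if_neg hit, add_zero, fullBdry, Finset.sum_eq_single i]
    · rw [fullCone, if_pos (Finset.mem_insert_self i t), Finset.erase_insert hit,
        vertexSign_insert_self hit, ← mul_assoc, vertexSign_mul_self, one_mul]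
    · intro v _ hv
      rw [fullCone, if_neg (by simp [Ne.symm hv, hit]), mul_zero]
    · intro h
      exact absurd (Finset.mem_sdiff.2 ⟨hi, hit⟩) h

/-- Adding two vertices in the two possible orders gives opposite signs, so the double sum equals
its own negative. -/
theorem fullBdry_fullBdry (N : Finset I) (f : Finset I → ℝ) (t : Finset I) :
    fullBdry N (fullBdry N f) t = 0 := by
  set g : I → I → ℝ := fun v w => if v = w then 0 else
    vertexSign t v * vertexSign t w * (if v < w then -1 else 1) * f (insert w (insert v t))
    with hg
  have hsum : fullBdry N (fullBdry N f) t = ∑ v ∈ N \ t, ∑ w ∈ N \ t, g v w := by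
    refine Finset.sum_congr rfl fun v hv => ?_
    obtain ⟨hvN, hvt⟩ := Finset.mem_sdiff.1 hv
    rw [fullBdry, Finset.mul_sum, ← Finset.add_sum_erase _ _ hv]
    have h0 : g v v = 0 := by simp [hg]
    rw [h0, zero_add]
    refine Finset.sum_congr ?_ fun w hw => ?_
    · ext w
      simp only [Finset.mem_sdiff, Finset.mem_insert, Finset.mem_erase]
      tauto
    · have hvw : v ≠ w := (Finset.ne_of_mem_erase hw).symm
      simp only [hg, if_neg hvw, vertexSign_insert hvt]
      ring
  have hanti : ∀ v w, g v w = -g w v := by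
    intro v w
    by_cases hvw : v = w
    · simp [hg, hvw]
    · simp only [hg, if_neg hvw, if_neg (Ne.symm hvw), Finset.insert_comm w v]
      rcases lt_or_gt_of_ne hvw with h | h
      · rw [if_pos h, if_neg h.not_gt]
        ring
      · rw [if_pos h, if_neg h.not_gt]
        ring
  have h : ∑ v ∈ N \ t, ∑ w ∈ N \ t, g v w = -∑ v ∈ N \ t, ∑ w ∈ N \ t, g v w := by
    conv_lhs => rw [Finset.sum_comm]
    simp only [← Finset.sum_neg_distrib]
    exact Finset.sum_congr rfl fun v _ => Finset.sum_congr rfl fun w _ => hanti w v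
  rw [hsum]
  linarith

end FullSimplex

/-! ### Exactness of the columns of the double complex -/

section Columns

/-- For each `v` at most one simplex of the nerve is equal to `P v`, and if none is, then `g (P v) =
0`. This turns sums over the nerve into sums over vertices. -/
theorem finsum_simplices_mul {X I : Type*} [DecidableEq I] {U : I → Set X} {p : ℕ}
    {N : Finset I} {g : Finset I → ℝ}
    (hg : ∀ s, g s ≠ 0 → s.card = p + 1 ∧ (⋂ i ∈ s, U i).Nonempty) (P : I → Finset I)
    (a : I → ℝ) :
    ∑ᶠ s : NerveSimplex U p, (∑ v ∈ N, if s.1 = P v then a v else 0) * g s.1 =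
      ∑ v ∈ N, a v * g (P v) := by
  simp only [Finset.sum_mul]
  have hne : ∀ v (s : NerveSimplex U p), s.1 ≠ P v →
      (if s.1 = P v then a v else 0) * g s.1 = 0 := fun v s h => by rw [if_neg h, zero_mul]
  rw [finsum_sum_comm]
  · refine Finset.sum_congr rfl fun v _ => ?_
    by_cases h : g (P v) = 0
    · rw [h, mul_zero]
      refine finsum_eq_zero_of_forall_eq_zero fun s => ?_
      split_ifs with h'
      · rw [h', h, mul_zero]
      · rw [zero_mul]
    · rw [finsum_eq_single _ ⟨P v, hg _ h⟩]
      · rw [if_pos rfl]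
      · exact fun s hs => hne v s fun h' => hs (Subtype.ext h')
  · intro v _
    refine Set.Finite.of_finite_image (f := Subtype.val)
      ((Set.finite_singleton (P v)).subset ?_) Subtype.val_injective.injOn
    rintro _ ⟨s, hs, rfl⟩
    by_contra h
    exact hs (hne v s h)

variable {X : Type*} [TopologicalSpace X] {I : Type*} {U : I → Set X} {p q : ℕ}

/-- The coefficients of a fixed singular simplex in an element of the double complex, as a function
on finite sets of indices. -/
def coeffFun (c : DoubleChains U p q) (σ : Sing X q) (s : Finset I) : ℝ :=
  open Classical in
  if h : s.card = p + 1 ∧ (⋂ i ∈ s, U i).Nonempty then (c ⟨s, h⟩).1 σ else 0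

theorem coeffFun_coe (c : DoubleChains U p q) (σ : Sing X q) (s : NerveSimplex U p) :
    coeffFun c σ s.1 = (c s).1 σ := dif_pos s.2

theorem isSimplex_of_coeffFun_ne_zero {c : DoubleChains U p q} {σ : Sing X q} {s : Finset I}
    (h : coeffFun c σ s ≠ 0) : s.card = p + 1 ∧ (⋂ i ∈ s, U i).Nonempty := by
  by_contra h'
  exact h (dif_neg h')

theorem range_subset_of_coeffFun_ne_zero {c : DoubleChains U p q} {σ : Sing X q} {s : Finset I}
    (h : coeffFun c σ s ≠ 0) {i : I} (hi : i ∈ s) : Set.range σ ⊆ U i := by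
  have hs := isSimplex_of_coeffFun_ne_zero h
  rw [coeffFun_coe c σ ⟨s, hs⟩] at h
  exact ((c ⟨s, hs⟩).2.2 σ h).trans (NerveSimplex.carrier_subset ⟨s, hs⟩ hi)

theorem doubleChains_ext {c c' : DoubleChains U p q}
    (h : ∀ σ s, coeffFun c σ s = coeffFun c' σ s) : c = c' := by
  funext s
  ext σ
  rw [← coeffFun_coe, ← coeffFun_coe, h]

theorem finite_support_coeffFun (c : DoubleChains U p q) (s : Finset I) :
    {σ | coeffFun c σ s ≠ 0}.Finite := by
  by_cases hs : s.card = p + 1 ∧ (⋂ i ∈ s, U i).Nonempty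
  · refine (c ⟨s, hs⟩).2.1.subset fun σ hσ => ?_
    rwa [Function.mem_support, ← coeffFun_coe]
  · exact Set.finite_empty.subset fun σ hσ => hs (isSimplex_of_coeffFun_ne_zero hσ)

theorem finite_members_containing (hU : IsStarFinite U) (σ : Sing X q) :
    {i | Set.range σ ⊆ U i}.Finite := by
  rcases Set.eq_empty_or_nonempty {i | Set.range σ ⊆ U i} with h | ⟨i, hi⟩
  · rw [h]
    exact Set.finite_empty
  · obtain ⟨x, hx⟩ := range_sing_nonempty σ
    exact (hU i).subset fun j hj => ⟨x, hi hx, hj hx⟩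

/-- The set of indices of the members of the covering containing a singular simplex. -/
def containing (hU : IsStarFinite U) (σ : Sing X q) : Finset I :=
  (finite_members_containing hU σ).toFinset

theorem mem_containing {hU : IsStarFinite U} {σ : Sing X q} {i : I} :
    i ∈ containing hU σ ↔ Set.range σ ⊆ U i := by
  simp [containing]

theorem horizontal_horizontal (c : DoubleChains U p (q + 2)) :
    horizontal U p q (horizontal U p (q + 1) c) = 0 := by
  funext s
  refine Subtype.ext ?_
  exact bdry_bdry (finChains_le_cfChains _ _ (c s).2)

/-- A choice of a member of the covering containing each small simplex. -/
def IsSelection (U : I → Set X) (pick : Sing X q → I) : Prop :=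
  ∀ (σ : Sing X q) (i : I), Set.range σ ⊆ U i → Set.range σ ⊆ U (pick σ)

/-- The condition is vacuous for simplices that are not small, and these get an arbitrary index; one
exists because a singular simplex has a point and this point is covered. -/
theorem exists_isSelection (hP : IsProperCovering U) (q : ℕ) :
    ∃ pick : Sing X q → I, IsSelection U pick := by
  have h : ∀ σ : Sing X q, ∃ j, ∀ i, Set.range σ ⊆ U i → Set.range σ ⊆ U j := by
    intro σ
    by_cases hσ : IsSmall U σ
    · obtain ⟨j, hj⟩ := hσ
      exact ⟨j, fun _ _ => hj⟩
    · obtain ⟨x, _⟩ := range_sing_nonempty σ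
      obtain ⟨j, _⟩ := Set.mem_iUnion.1 (hP.iUnion_interior.symm ▸ Set.mem_univ x)
      exact ⟨j, fun i hi => absurd ⟨i, hi⟩ hσ⟩
  choose pick hpick using h
  exact ⟨pick, hpick⟩

/-- Each small simplex is assigned to one member containing it. The part of `c` assigned to `U i` is
finite because its simplices meet the compact set `closure (U i)`. -/
theorem exists_sumChains_eq (hU : IsStarFinite U) (hP : IsProperCovering U) (c : cfChains X q)
    (hc : ∀ σ, c.1 σ ≠ 0 → IsSmall U σ) :
    ∃ z : DoubleChains U 0 q, sumChains hU hP q z = c := by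
  classical
  -- The value `none` is for simplices that are not small; their coefficients in `c` are zero.
  have h : ∀ σ : Sing X q, ∃ s : Option (NerveSimplex U 0), IsSmall U σ →
      ∃ t, s = some t ∧ Set.range σ ⊆ t.carrier := by
    intro σ
    by_cases hσ : IsSmall U σ
    · obtain ⟨i, hi⟩ := hσ
      refine ⟨some ⟨{i}, by simp, ?_⟩, fun _ => ⟨_, rfl, ?_⟩⟩
      · simpa using (range_sing_nonempty σ).mono hi
      · simpa [NerveSimplex.carrier] using hi
    · exact ⟨none, fun h => absurd h hσ⟩
  choose pick hpick using h
  have key : ∀ s σ, (if pick σ = some s then c.1 σ else 0) ≠ 0 →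
      c.1 σ ≠ 0 ∧ pick σ = some s ∧ Set.range σ ⊆ s.carrier := by
    intro s σ hσ
    have h1 : pick σ = some s := by
      by_contra h
      exact hσ (if_neg h)
    rw [if_pos h1] at hσ
    obtain ⟨t, ht, hr⟩ := hpick σ (hc σ hσ)
    obtain rfl : t = s := Option.some_injective _ (ht.symm.trans h1)
    exact ⟨hσ, h1, hr⟩
  refine ⟨fun s => ⟨fun σ => if pick σ = some s then c.1 σ else 0, ?_, fun σ hσ =>
    (key s σ hσ).2.2⟩, ?_⟩
  · obtain ⟨i, hi⟩ := s.exists_mem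
    refine (mem_cfChains.1 c.2 _ (hP.isCompact_closure i)).subset fun σ hσ => ?_
    obtain ⟨h1, _, h3⟩ := key s σ hσ
    refine ⟨h1, ?_⟩
    rw [Set.inter_eq_right.2 (h3.trans ((s.carrier_subset hi).trans subset_closure))]
    exact range_sing_nonempty σ
  · ext σ
    change ∑ᶠ s, (if pick σ = some s then c.1 σ else 0) = c.1 σ
    by_cases hσ : c.1 σ = 0
    · simp [hσ]
    · obtain ⟨t, ht, _⟩ := hpick σ (hc σ hσ)
      rw [finsum_eq_single _ t]
      · rw [if_pos ht]
      · intro s hs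
        rw [if_neg]
        rw [ht]
        exact fun h => hs (Option.some_injective _ h).symm

variable [LinearOrder I]

/-- With `σ` fixed, non-zero coefficients occur only at simplices spanned by members containing `σ`,
and every non-empty set of such members is a simplex of the nerve. So the vertical differential at
`σ` is that of a full simplex. -/
theorem coeffFun_vertical (hU : IsStarFinite U) (c : DoubleChains U (p + 1) q) (σ : Sing X q)
    (t : Finset I) :
    coeffFun (vertical hU p q c) σ t = fullBdry (containing hU σ) (coeffFun c σ) t := by
  by_cases ht : t.card = p + 1 ∧ (⋂ i ∈ t, U i).Nonempty
  · have h1 : coeffFun (vertical hU p q c) σ t =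
        ∑ᶠ s : NerveSimplex U (p + 1), nerveIncidence s ⟨t, ht⟩ * coeffFun c σ s.1 := by
      rw [coeffFun_coe _ σ ⟨t, ht⟩]
      simp only [coeffFun_coe]
      rfl
    rw [h1, fullBdry, ← finsum_simplices_mul (fun s => isSimplex_of_coeffFun_ne_zero)]
    refine finsum_congr fun s => ?_
    by_cases hs : coeffFun c σ s.1 = 0
    · rw [hs, mul_zero, mul_zero]
    congr 1
    rw [nerveIncidence, ← Finset.sum_filter, ← Finset.sum_filter]
    have hset : (s.1.filter fun v => s.1.erase v = t) =
        (containing hU σ \ t).filter fun v => s.1 = insert v t := by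
      ext v
      simp only [Finset.mem_filter, Finset.mem_sdiff, mem_containing]
      constructor
      · rintro ⟨hv, rfl⟩
        exact ⟨⟨range_subset_of_coeffFun_ne_zero hs hv, Finset.notMem_erase v _⟩,
          (Finset.insert_erase hv).symm⟩
      · rintro ⟨⟨_, hv⟩, h⟩
        rw [h]
        exact ⟨Finset.mem_insert_self v t, Finset.erase_insert hv⟩
    change ∑ v ∈ s.1.filter (fun v => s.1.erase v = t), vertexSign s.1 v = _
    rw [hset]
    refine Finset.sum_congr rfl fun v hv => ?_
    obtain ⟨hv1, hv2⟩ := Finset.mem_filter.1 hv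
    rw [hv2, vertexSign_insert_self (Finset.mem_sdiff.1 hv1).2]
  · rw [coeffFun, dif_neg ht, fullBdry, Finset.sum_eq_zero]
    intro v hv
    by_contra h
    obtain ⟨h1, h2⟩ := isSimplex_of_coeffFun_ne_zero (right_ne_zero_of_mul h)
    rw [Finset.card_insert_of_notMem (Finset.mem_sdiff.1 hv).2] at h1
    exact ht ⟨by omega, h2.mono (Set.biInter_mono (Finset.subset_insert v t) fun _ _ => subset_rfl)⟩

/-- In the splitting over singular simplices, summation plays the role of the augmentation, that is,
of the boundary at the empty simplex. -/
theorem fullBdry_coeffFun_empty (hU : IsStarFinite U) (hP : IsProperCovering U)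
    (c : DoubleChains U 0 q) (σ : Sing X q) :
    fullBdry (containing hU σ) (coeffFun c σ) ∅ = (sumChains hU hP q c).1 σ := by
  have h1 : (sumChains hU hP q c).1 σ = ∑ᶠ s : NerveSimplex U 0, coeffFun c σ s.1 := by
    simp only [coeffFun_coe]
    rfl
  rw [h1, fullBdry, Finset.sdiff_empty, ← finsum_simplices_mul
    (fun s => isSimplex_of_coeffFun_ne_zero)]
  refine finsum_congr fun s => ?_
  by_cases hs : coeffFun c σ s.1 = 0
  · rw [hs, mul_zero]
  obtain ⟨v, hv⟩ := Finset.card_eq_one.1 s.2.1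
  have hv' : v ∈ containing hU σ :=
    mem_containing.2 (range_subset_of_coeffFun_ne_zero hs (by simp [hv]))
  rw [Finset.sum_eq_single v]
  · rw [if_pos (by simp [hv])]
    simp [vertexSign]
  · intro w _ hw
    rw [if_neg]
    rw [hv]
    intro h
    exact hw (by simpa using h.symm)
  · exact fun h => absurd hv' h

theorem vertical_vertical (hU : IsStarFinite U) (c : DoubleChains U (p + 2) q) :
    vertical hU p q (vertical hU (p + 1) q c) = 0 := by
  refine doubleChains_ext fun σ t => ?_
  have h : coeffFun (vertical hU (p + 1) q c) σ = fullBdry (containing hU σ) (coeffFun c σ) :=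
    funext fun t => coeffFun_vertical hU c σ t
  rw [coeffFun_vertical, h, fullBdry_fullBdry]
  simp [coeffFun]

theorem vertical_horizontal (hU : IsStarFinite U) (c : DoubleChains U (p + 1) (q + 1)) :
    vertical hU p q (horizontal U (p + 1) q c) = horizontal U p q (vertical hU p (q + 1) c) := by
  funext t
  ext τ
  change ∑ᶠ s, nerveIncidence s t * ∑ᶠ σ, incidence σ τ * (c s).1 σ =
    ∑ᶠ σ, incidence σ τ * ∑ᶠ s, nerveIncidence s t * (c s).1 σ
  simp only [mul_finsum]
  rw [finsum_swap]
  · simp only [mul_left_comm]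
  · refine ((finite_cofaces hU t).prod
      ((finite_cofaces hU t).biUnion fun s _ => (c s).2.1)).subset ?_
    rintro ⟨s, σ⟩ h
    have hs : s ∈ {s | nerveIncidence s t ≠ 0} := left_ne_zero_of_mul h
    exact ⟨hs, Set.mem_biUnion hs (right_ne_zero_of_mul (right_ne_zero_of_mul h))⟩

/-- The contraction of the columns of the double complex. -/
def coneChains {pick : Sing X q → I} (hpick : IsSelection U pick) (c : DoubleChains U p q) :
    DoubleChains U (p + 1) q := fun t => ⟨fun σ => fullCone (pick σ) (coeffFun c σ) t.1, by
  have key : ∀ σ, fullCone (pick σ) (coeffFun c σ) t.1 ≠ 0 →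
      pick σ ∈ t.1 ∧ coeffFun c σ (t.1.erase (pick σ)) ≠ 0 := by
    intro σ hσ
    have h : pick σ ∈ t.1 := by
      by_contra h
      exact hσ (if_neg h)
    rw [fullCone, if_pos h] at hσ
    exact ⟨h, right_ne_zero_of_mul hσ⟩
  constructor
  · refine (t.1.finite_toSet.biUnion fun i _ =>
      finite_support_coeffFun c (t.1.erase i)).subset fun σ hσ => ?_
    exact Set.mem_biUnion (key σ hσ).1 (key σ hσ).2
  · intro σ hσ
    obtain ⟨h1, h2⟩ := key σ hσ
    obtain ⟨i, hi⟩ := Finset.card_pos.1 (by rw [(isSimplex_of_coeffFun_ne_zero h2).1]; omega)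
    refine Set.subset_iInter₂ fun j hj => ?_
    by_cases hji : j = pick σ
    · rw [hji]
      exact hpick σ i (range_subset_of_coeffFun_ne_zero h2 hi)
    · exact range_subset_of_coeffFun_ne_zero h2 (Finset.mem_erase.2 ⟨hji, hj⟩)⟩

/-- A non-zero value of the cone at `t` forces the image of `σ` into every member indexed by `t`, so
that `t` is a simplex of the nerve. Restricting the cone to the nerve therefore loses nothing. -/
theorem coeffFun_coneChains {pick : Sing X q → I} (hpick : IsSelection U pick)
    (c : DoubleChains U p q) (σ : Sing X q) :
    coeffFun (coneChains hpick c) σ = fullCone (pick σ) (coeffFun c σ) := by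
  funext t
  by_cases ht : t.card = p + 2 ∧ (⋂ i ∈ t, U i).Nonempty
  · exact coeffFun_coe _ σ ⟨t, ht⟩
  · rw [coeffFun, dif_neg ht, fullCone]
    split_ifs with hmem
    · symm
      by_contra h
      have h2 := right_ne_zero_of_mul h
      have hs := isSimplex_of_coeffFun_ne_zero h2
      rw [Finset.card_erase_of_mem hmem] at hs
      refine ht ⟨by omega, ?_⟩
      obtain ⟨i, hi⟩ : (t.erase (pick σ)).Nonempty := Finset.card_pos.1 (by
        rw [Finset.card_erase_of_mem hmem]
        omega)
      refine (range_sing_nonempty σ).mono (Set.subset_iInter₂ fun j hj => ?_)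
      by_cases hji : j = pick σ
      · rw [hji]
        exact hpick σ i (range_subset_of_coeffFun_ne_zero h2 hi)
      · exact range_subset_of_coeffFun_ne_zero h2 (Finset.mem_erase.2 ⟨hji, hj⟩)
    · rfl

/-- The hypothesis includes `t = ∅`, so it expresses that `c` is a cycle of the augmented complexes;
the cone contraction then returns `c`. At simplices that are not small all coefficients vanish
anyway. -/
theorem vertical_coneChains (hU : IsStarFinite U) {pick : Sing X q → I}
    (hpick : IsSelection U pick) {c : DoubleChains U p q}
    (hc : ∀ σ t, fullBdry (containing hU σ) (coeffFun c σ) t = 0) :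
    vertical hU p q (coneChains hpick c) = c := by
  refine doubleChains_ext fun σ t => ?_
  rw [coeffFun_vertical, coeffFun_coneChains]
  by_cases hσ : IsSmall U σ
  · obtain ⟨i, hi⟩ := hσ
    have h := fullBdry_fullCone_add (mem_containing (hU := hU).2 (hpick σ i hi)) (coeffFun c σ) t
    have h0 : fullBdry (containing hU σ) (coeffFun c σ) = 0 := funext (hc σ)
    rw [h0] at h
    rw [← h]
    simp [fullCone]
  · have h0 : coeffFun c σ = 0 := by
      funext s
      by_contra h
      obtain ⟨i, hi⟩ := Finset.card_pos.1 (by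
        rw [(isSimplex_of_coeffFun_ne_zero h).1]
        omega)
      exact hσ ⟨i, range_subset_of_coeffFun_ne_zero h hi⟩
    rw [h0]
    simp [fullBdry, fullCone]

theorem vertical_coneChains_of_vertical_eq_zero (hU : IsStarFinite U) {pick : Sing X q → I}
    (hpick : IsSelection U pick) {c : DoubleChains U (p + 1) q} (hc : vertical hU p q c = 0) :
    vertical hU (p + 1) q (coneChains hpick c) = c := by
  refine vertical_coneChains hU hpick fun σ t => ?_
  rw [← coeffFun_vertical, hc]
  simp [coeffFun]

theorem vertical_coneChains_of_sumChains_eq_zero (hU : IsStarFinite U) (hP : IsProperCovering U)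
    {pick : Sing X q → I} (hpick : IsSelection U pick) {c : DoubleChains U 0 q}
    (hc : sumChains hU hP q c = 0) :
    vertical hU 0 q (coneChains hpick c) = c := by
  refine vertical_coneChains hU hpick fun σ t => ?_
  rcases Finset.eq_empty_or_nonempty t with rfl | ht
  · rw [fullBdry_coeffFun_empty hU hP, hc]
    rfl
  · refine Finset.sum_eq_zero fun v hv => ?_
    by_contra h
    have h1 := (isSimplex_of_coeffFun_ne_zero (right_ne_zero_of_mul h)).1
    rw [Finset.card_insert_of_notMem (Finset.mem_sdiff.1 hv).2] at h1
    have := Finset.card_pos.2 ht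
    omega

end Columns

/-! ### The total complex as a grid -/

section Grid

theorem pow_smul_add_pow_succ_smul {M : Type*} [AddCommGroup M] [Module ℝ M] (p : ℕ) (x : M) :
    (-1 : ℝ) ^ p • x + (-1 : ℝ) ^ (p + 1) • x = 0 := by
  rw [pow_succ, mul_neg, mul_one, neg_smul, add_neg_cancel]

theorem sub_pow_succ_smul {M : Type*} [AddCommGroup M] [Module ℝ M] (p : ℕ) (x y : M) :
    y - (-1 : ℝ) ^ (p + 1) • x = (-1 : ℝ) ^ p • x + y := by
  rw [pow_succ, mul_neg, mul_one, neg_smul, sub_neg_eq_add, add_comm]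

variable {X : Type*} [TopologicalSpace X] {I : Type*} {U : I → Set X}

/-- Families of elements of all terms of the double complex. -/
abbrev Grid (U : I → Set X) : Type _ := ∀ p q, DoubleChains U p q

/-- The part of a grid in total degree `n`. -/
def ofGrid (n : ℕ) (z : Grid U) : Total U n := fun x => z x.1.1 x.1.2

/-- The extension of an element of the total complex by zero. -/
def toGrid {n : ℕ} (z : Total U n) : Grid U := fun p q =>
  if h : p + q = n then component U p q h z else 0

theorem toGrid_of_add_eq {n p q : ℕ} (z : Total U n) (h : p + q = n) :
    toGrid z p q = component U p q h z := dif_pos h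

theorem toGrid_of_add_ne {n p q : ℕ} (z : Total U n) (h : p + q ≠ n) :
    toGrid z p q = 0 := dif_neg h

theorem ofGrid_toGrid {n : ℕ} (z : Total U n) : ofGrid n (toGrid z) = z := by
  funext x
  exact toGrid_of_add_eq z x.2

/-- The grid with a single non-zero term. -/
def singleGrid (p q : ℕ) (c : DoubleChains U p q) : Grid U := Pi.single p (Pi.single q c)

theorem singleGrid_same (p q : ℕ) (c : DoubleChains U p q) : singleGrid p q c p q = c := by
  simp [singleGrid]

theorem singleGrid_of_ne_left {p q p' q' : ℕ} (c : DoubleChains U p q) (h : p' ≠ p) :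
    singleGrid p q c p' q' = 0 := by
  simp [singleGrid, h]

theorem singleGrid_of_ne_right {p q p' q' : ℕ} (c : DoubleChains U p q) (h : q' ≠ q) :
    singleGrid p q c p' q' = 0 := by
  by_cases hp : p' = p
  · subst hp
    simp [singleGrid, h]
  · exact singleGrid_of_ne_left c hp

theorem toCF_ofGrid (hU : IsStarFinite U) (hP : IsProperCovering U) (n : ℕ) (z : Grid U) :
    toCF hU hP n (ofGrid n z) = sumChains hU hP n (z 0 n) := rfl

theorem isSmall_of_sumChains (hU : IsStarFinite U) (hP : IsProperCovering U) {q : ℕ}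
    (c : DoubleChains U 0 q) (σ : Sing X q) (h : (sumChains hU hP q c).1 σ ≠ 0) :
    IsSmall U σ := by
  obtain ⟨s, hs⟩ := exists_ne_zero_of_finsum h
  obtain ⟨i, hi⟩ := s.exists_mem
  exact ⟨i, ((c s).2.2 σ hs).trans (s.carrier_subset hi)⟩

theorem isSmall_add {q : ℕ} {c c' : Sing X q → ℝ} (hc : ∀ σ, c σ ≠ 0 → IsSmall U σ)
    (hc' : ∀ σ, c' σ ≠ 0 → IsSmall U σ) (σ : Sing X q) (h : (c + c') σ ≠ 0) : IsSmall U σ := by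
  rcases Function.support_add c c' h with h | h
  · exact hc σ h
  · exact hc' σ h

theorem exists_small_cycle (hP : IsProperCovering U) (n : ℕ) {c : cfChains X n}
    (hc : c ∈ cycles (fun n => cfChains X n) (cfBoundary X) n) :
    ∃ b : cfChains X (n + 1), ∀ σ, (c - cfBoundary X n b).1 σ ≠ 0 → IsSmall U σ := by
  cases n with
  | zero =>
    refine ⟨0, fun σ _ => ?_⟩
    -- The image of a singular 0-simplex is a point, so it is small without any subdivision.
    have hss : ∀ t, σ t = σ default := fun t => congrArg σ (Subsingleton.elim _ _)
    obtain ⟨i, hi⟩ := Set.mem_iUnion.1 (hP.iUnion_interior.symm ▸ Set.mem_univ (σ default))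
    refine ⟨i, ?_⟩
    rintro _ ⟨t, rfl⟩
    rw [hss]
    exact interior_subset hi
  | succ n =>
    obtain ⟨D, hD0, hDcf, _, hD⟩ := exists_smallHomotopy hP.iUnion_interior
    refine ⟨⟨D (n + 1) c.1, hDcf _ _ c.2⟩, fun σ hσ => hD n c.1 c.2 σ ?_⟩
    have hc' : bdry c.1 = 0 := congrArg Subtype.val (show cfBoundary X n c = 0 from hc)
    rw [hc', hD0, sub_zero]
    exact hσ

/-- The chain `b - ∂Db` has the same boundary as `b`. It is small up to the term `D∂b = Dc`, and
this term is small since `c` is. -/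
theorem exists_small_filling (hP : IsProperCovering U) (n : ℕ) {c : cfChains X n}
    (hc : ∀ σ, c.1 σ ≠ 0 → IsSmall U σ) {b : cfChains X (n + 1)} (hb : cfBoundary X n b = c) :
    ∃ b' : cfChains X (n + 1), cfBoundary X n b' = c ∧ ∀ σ, b'.1 σ ≠ 0 → IsSmall U σ := by
  obtain ⟨D, hD0, hDcf, hDs, hD⟩ := exists_smallHomotopy hP.iUnion_interior
  have hbc : bdry b.1 = c.1 := congrArg Subtype.val hb
  refine ⟨b - cfBoundary X (n + 1) ⟨D (n + 1) b.1, hDcf _ _ b.2⟩, ?_, ?_⟩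
  · rw [map_sub, hb]
    have h0 : ∀ x : cfChains X (n + 2), cfBoundary X n (cfBoundary X (n + 1) x) = 0 := fun x =>
      Subtype.ext (bdry_bdry x.2)
    rw [h0, sub_zero]
  · have h1 : (b - cfBoundary X (n + 1) ⟨D (n + 1) b.1, hDcf _ _ b.2⟩).1 =
        (b.1 - bdry (D (n + 1) b.1) - D n (bdry b.1)) + D n (bdry b.1) := by
      rw [sub_add_cancel]
      rfl
    rw [h1]
    refine isSmall_add (hD n b.1 b.2) ?_
    rw [hbc]
    exact hDs n c.1 hc

/-! ### The total differential of grids and the solution of boundary equations -/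

variable [LinearOrder I]

/-- The total differential of a grid. -/
def gridBdry (hU : IsStarFinite U) : Grid U →ₗ[ℝ] Grid U where
  toFun z p q := (-1 : ℝ) ^ p • horizontal U p q (z p (q + 1)) + vertical hU p q (z (p + 1) q)
  map_add' z z' := by
    funext p q
    simp only [Pi.add_apply, map_add, smul_add]
    abel
  map_smul' a z := by
    funext p q
    simp only [Pi.smul_apply, map_smul, RingHom.id_apply, smul_add, smul_comm a]

theorem gridBdry_apply (hU : IsStarFinite U) (z : Grid U) (p q : ℕ) :
    gridBdry hU z p q =
      (-1 : ℝ) ^ p • horizontal U p q (z p (q + 1)) + vertical hU p q (z (p + 1) q) := rfl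

theorem gridBdry_gridBdry (hU : IsStarFinite U) (z : Grid U) : gridBdry hU (gridBdry hU z) = 0 := by
  funext p q
  simp only [gridBdry_apply, map_add, map_smul, horizontal_horizontal, vertical_vertical,
    vertical_horizontal, smul_zero, zero_add, add_zero]
  exact pow_smul_add_pow_succ_smul p _

theorem totalBoundary_ofGrid (hU : IsStarFinite U) (n : ℕ) (z : Grid U) :
    totalBoundary hU n (ofGrid (n + 1) z) = ofGrid n (gridBdry hU z) := rfl

theorem gridBdry_toGrid (hU : IsStarFinite U) {n : ℕ} {z : Total U n}
    (hz : z ∈ cycles (fun n => Total U n) (totalBoundary hU) n) : gridBdry hU (toGrid z) = 0 := by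
  funext p q
  by_cases h : p + q + 1 = n
  · subst h
    have h1 : totalBoundary hU (p + q) z = 0 := hz
    rw [← ofGrid_toGrid z, totalBoundary_ofGrid] at h1
    exact congrFun h1 ⟨(p, q), rfl⟩
  · rw [gridBdry_apply, toGrid_of_add_ne z (by omega), toGrid_of_add_ne z (by omega)]
    simp

theorem ofGrid_mem_cycles (hU : IsStarFinite U) (n : ℕ) {z : Grid U} (hz : gridBdry hU z = 0) :
    ofGrid n z ∈ cycles (fun n => Total U n) (totalBoundary hU) n := by
  cases n with
  | zero => exact Submodule.mem_top
  | succ n =>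
    change totalBoundary hU n (ofGrid (n + 1) z) = 0
    rw [totalBoundary_ofGrid, hz]
    rfl

/-- The solution, by recursion on columns, of the equation `gridBdry y = z`. -/
def fillGrid {pick : ∀ q, Sing X q → I} (hpick : ∀ q, IsSelection U (pick q)) (z : Grid U) :
    Grid U
  | 0 => 0
  | p + 1 => fun q => coneChains (hpick q)
      (z p q - (-1 : ℝ) ^ p • horizontal U p q (fillGrid hpick z p (q + 1)))

/-- The contraction solves the equation as soon as its right-hand side is a vertical cycle. For `p =
0` this is the condition on sums. For `p + 1`, the equation already solved for `p` turns the
vertical image of the right-hand side into the component of `gridBdry hU z` at `(p, q)`, which is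
zero. -/
theorem vertical_fillGrid (hU : IsStarFinite U) (hP : IsProperCovering U)
    {pick : ∀ q, Sing X q → I} (hpick : ∀ q, IsSelection U (pick q)) {z : Grid U}
    (hz : gridBdry hU z = 0) (hz0 : ∀ q, sumChains hU hP q (z 0 q) = 0) (p q : ℕ) :
    vertical hU p q (fillGrid hpick z (p + 1) q) =
      z p q - (-1 : ℝ) ^ p • horizontal U p q (fillGrid hpick z p (q + 1)) := by
  induction p generalizing q with
  | zero =>
    refine vertical_coneChains_of_sumChains_eq_zero hU hP (hpick q) ?_
    have h : fillGrid hpick z 0 (q + 1) = 0 := rfl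
    rw [h, map_zero, smul_zero, sub_zero, hz0]
  | succ p ih =>
    refine vertical_coneChains_of_vertical_eq_zero hU (hpick q) ?_
    have h1 : gridBdry hU z p q = 0 := by rw [hz]; rfl
    rw [map_sub, map_smul, vertical_horizontal, ih, map_sub, map_smul, horizontal_horizontal,
      smul_zero, sub_zero]
    exact (sub_pow_succ_smul p _ _).trans h1

theorem exists_gridBdry_eq (hU : IsStarFinite U) (hP : IsProperCovering U) {z : Grid U}
    (hz : gridBdry hU z = 0) (hz0 : ∀ q, sumChains hU hP q (z 0 q) = 0) :
    ∃ y, gridBdry hU y = z ∧ ∀ q, y 0 q = 0 := by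
  choose pick hpick using exists_isSelection hP
  refine ⟨fillGrid hpick z, ?_, fun q => rfl⟩
  funext p q
  rw [gridBdry_apply, vertical_fillGrid hU hP hpick hz hz0]
  abel

/-! ### Comparison with compactly finite homology -/

/-- A small representative lifts to bidegree `(0, n)`. The total boundary of the lift has `p = 0`
terms with zero sum, hence is also the total boundary of some `y` with no `p = 0` terms. Subtracting
`y` makes the lift a cycle without changing its sum. -/
theorem totalToCF_surjective (hU : IsStarFinite U) (hP : IsProperCovering U) (n : ℕ) :
    Function.Surjective (totalToCF hU hP n) := by
  intro h
  obtain ⟨⟨c, hc⟩, rfl⟩ := Submodule.mkQ_surjective _ h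
  obtain ⟨b, hb⟩ := exists_small_cycle hP n hc
  obtain ⟨z0, hz0⟩ := exists_sumChains_eq hU hP _ hb
  have hcyc : ∀ q, sumChains hU hP q (gridBdry hU (singleGrid 0 n z0) 0 q) = 0 := by
    intro q
    rw [gridBdry_apply, singleGrid_of_ne_left z0 (Nat.succ_ne_zero 0), map_zero, add_zero, pow_zero,
      one_smul, sumChains_horizontal]
    by_cases hq : q + 1 = n
    · subst hq
      rw [singleGrid_same, hz0, map_sub]
      have h0 : cfBoundary X q c = 0 := hc
      have h1 : cfBoundary X q (cfBoundary X (q + 1) b) = 0 := Subtype.ext (bdry_bdry b.2)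
      rw [h0, h1, sub_zero]
    · rw [singleGrid_of_ne_right z0 hq, map_zero, map_zero]
  obtain ⟨y, hy, hy0⟩ := exists_gridBdry_eq hU hP (gridBdry_gridBdry hU _) hcyc
  have hz : gridBdry hU (singleGrid 0 n z0 - y) = 0 := by rw [map_sub, hy, sub_self]
  refine ⟨homologyClass _ _ n ⟨_, ofGrid_mem_cycles hU n hz⟩, ?_⟩
  refine (Submodule.Quotient.eq _).2 ⟨-b, ?_⟩
  have h2 : toCF hU hP n (ofGrid n (singleGrid 0 n z0 - y)) = c - cfBoundary X n b := by
    rw [toCF_ofGrid, Pi.sub_apply, Pi.sub_apply, hy0, sub_zero, singleGrid_same, hz0]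
  change cfBoundary X n (-b) = toCF hU hP n (ofGrid n (singleGrid 0 n z0 - y)) - c
  rw [h2, map_neg]
  abel

/-- A small filling of the sum of `z` lifts to bidegree `(0, n + 1)`. After subtraction of the total
boundary of the lift the `p = 0` terms have zero sum, and `exists_gridBdry_eq` applies. -/
theorem totalToCF_injective (hU : IsStarFinite U) (hP : IsProperCovering U) (n : ℕ) :
    Function.Injective (totalToCF hU hP n) := by
  rw [← LinearMap.ker_eq_bot, LinearMap.ker_eq_bot']
  intro h hh
  obtain ⟨⟨z, hz⟩, rfl⟩ := Submodule.mkQ_surjective _ h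
  obtain ⟨b, hb⟩ : ∃ b, cfBoundary X n b = toCF hU hP n z :=
    (Submodule.Quotient.mk_eq_zero _).1 hh
  obtain ⟨b', hb', hs⟩ := exists_small_filling hP n
    (isSmall_of_sumChains hU hP (component U 0 n (zero_add n) z)) hb
  obtain ⟨y0, hy0⟩ := exists_sumChains_eq hU hP b' hs
  have h0 : ∀ q, sumChains hU hP q ((toGrid z - gridBdry hU (singleGrid 0 (n + 1) y0)) 0 q) =
      0 := by
    intro q
    rw [Pi.sub_apply, Pi.sub_apply, gridBdry_apply, singleGrid_of_ne_left y0 (Nat.succ_ne_zero 0),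
      map_zero, add_zero, pow_zero, one_smul, map_sub, sumChains_horizontal]
    by_cases hq : q = n
    · subst hq
      rw [singleGrid_same, hy0, hb', toGrid_of_add_eq z (zero_add q)]
      exact sub_self _
    · rw [singleGrid_of_ne_right y0 (by omega), toGrid_of_add_ne z (by omega)]
      simp
  obtain ⟨y, hy, _⟩ := exists_gridBdry_eq hU hP
    (by rw [map_sub, gridBdry_gridBdry, gridBdry_toGrid hU hz, sub_zero]) h0
  refine (Submodule.Quotient.mk_eq_zero _).2 ⟨ofGrid (n + 1) (y + singleGrid 0 (n + 1) y0), ?_⟩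
  rw [totalBoundary_ofGrid, map_add, hy, sub_add_cancel, ofGrid_toGrid]
  rfl

theorem totalToCF_bijective (hU : IsStarFinite U) (hP : IsProperCovering U) (n : ℕ) :
    Function.Bijective (totalToCF hU hP n) :=
  ⟨totalToCF_injective hU hP n, totalToCF_surjective hU hP n⟩

end Grid

/-! ### Finite chains with the `l₁`-norm -/

section L1Norm

variable {α β : Type*}

/-- The `l₁`-norm of a finitely supported function. -/
def l1Norm (x : α →₀ ℝ) : ℝ := ∑ a ∈ x.support, |x a|

theorem l1Norm_eq_sum {x : α →₀ ℝ} {s : Finset α} (h : x.support ⊆ s) :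
    l1Norm x = ∑ a ∈ s, |x a| :=
  Finset.sum_subset h fun a _ ha => by rw [Finsupp.notMem_support_iff.1 ha, abs_zero]

theorem l1Norm_nonneg (x : α →₀ ℝ) : 0 ≤ l1Norm x :=
  Finset.sum_nonneg fun _ _ => abs_nonneg _

theorem l1Norm_add_le (x y : α →₀ ℝ) : l1Norm (x + y) ≤ l1Norm x + l1Norm y := by
  classical
  rw [l1Norm_eq_sum Finsupp.support_add, l1Norm_eq_sum (Finset.subset_union_left (s₂ := y.support)),
    l1Norm_eq_sum (x := y) (Finset.subset_union_right (s₁ := x.support)), ← Finset.sum_add_distrib]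
  exact Finset.sum_le_sum fun a _ => abs_add_le _ _

theorem l1Norm_smul (r : ℝ) (x : α →₀ ℝ) : l1Norm (r • x) = |r| * l1Norm x := by
  rw [l1Norm_eq_sum Finsupp.support_smul, l1Norm, Finset.mul_sum]
  exact Finset.sum_congr rfl fun a _ => abs_mul _ _

theorem l1Norm_single (a : α) (r : ℝ) : l1Norm (Finsupp.single a r) = |r| := by
  rw [l1Norm_eq_sum Finsupp.support_single_subset, Finset.sum_singleton, Finsupp.single_eq_same]

theorem abs_linearCombination_le {f : α → ℝ} {C : ℝ} (hf : ∀ a, |f a| ≤ C) (x : α →₀ ℝ) :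
    |Finsupp.linearCombination ℝ f x| ≤ C * l1Norm x := by
  rw [Finsupp.linearCombination_apply, Finsupp.sum, l1Norm, Finset.mul_sum]
  refine (Finset.abs_sum_le_sum_abs _ _).trans (Finset.sum_le_sum fun a _ => ?_)
  rw [smul_eq_mul, abs_mul, mul_comm]
  exact mul_le_mul_of_nonneg_right (hf a) (abs_nonneg _)

theorem l1Norm_mapDomain {f : α → β} (hf : Function.Injective f) (x : α →₀ ℝ) :
    l1Norm (Finsupp.mapDomain f x) = l1Norm x := by
  classical
  rw [l1Norm, Finsupp.mapDomain_support_of_injective hf, Finset.sum_image hf.injOn, l1Norm]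
  exact Finset.sum_congr rfl fun a _ => by rw [Finsupp.mapDomain_apply hf]

/-- Hahn–Banach in the quotient by `S`, where the seminorm is the distance to `S`. This distance
need not be attained, whence `ε`; `S` need not be closed, whence seminorms. -/
theorem exists_dual_vanishing_on {E : Type*} [SeminormedAddCommGroup E] [NormedSpace ℝ E]
    (S : Submodule ℝ E) (x : E) {ε : ℝ} (hε : 0 < ε) :
    ∃ f : E →ₗ[ℝ] ℝ, (∀ y, |f y| ≤ ‖y‖) ∧ (∀ s ∈ S, f s = 0) ∧
      ∃ s ∈ S, ‖x - s‖ < f x + ε := by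
  obtain ⟨g, hg, hgx⟩ := exists_dual_vector'' ℝ (S.mkQ x)
  refine ⟨g.toLinearMap ∘ₗ S.mkQ, fun y => ?_, fun s hs => ?_, ?_⟩
  · calc |g (S.mkQ y)| ≤ ‖g‖ * ‖S.mkQ y‖ := g.le_opNorm _
      _ ≤ 1 * ‖y‖ := mul_le_mul hg (Submodule.Quotient.norm_mk_le S y) (norm_nonneg _) zero_le_one
      _ = ‖y‖ := one_mul _
  · change g (S.mkQ s) = 0
    rw [Submodule.mkQ_apply, (Submodule.Quotient.mk_eq_zero S).2 hs, map_zero]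
  · obtain ⟨m, hm, hlt⟩ := Submodule.Quotient.norm_mk_lt (S.mkQ x) hε
    refine ⟨x - m, (Submodule.Quotient.eq S).1 hm.symm, ?_⟩
    rw [sub_sub_cancel]
    change ‖m‖ < g (S.mkQ x) + ε
    rw [hgx]
    exact hlt

/-- A functional of `l₁`-norm at most 1 on finite chains is given by its values on the basis, a
function bounded by 1. Applied to boundaries, it expresses the distance to them through bounded
cocycles. -/
theorem exists_function_vanishing_on (S : Submodule ℝ (α →₀ ℝ)) (x : α →₀ ℝ) {ε : ℝ}
    (hε : 0 < ε) :
    ∃ f : α → ℝ, (∀ a, |f a| ≤ 1) ∧ (∀ s ∈ S, Finsupp.linearCombination ℝ f s = 0) ∧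
      ∃ s ∈ S, l1Norm (x - s) < Finsupp.linearCombination ℝ f x + ε := by
  let : Norm (α →₀ ℝ) := ⟨l1Norm⟩
  let : SeminormedAddCommGroup (α →₀ ℝ) := SeminormedAddCommGroup.ofCore (𝕜 := ℝ)
    { norm_nonneg := l1Norm_nonneg
      norm_smul := l1Norm_smul
      norm_triangle := l1Norm_add_le }
  let : NormedSpace ℝ (α →₀ ℝ) := ⟨fun r x => (l1Norm_smul r x).le⟩
  obtain ⟨g, hg1, hg2, hg3⟩ := exists_dual_vanishing_on S x hε
  have hlin : Finsupp.linearCombination ℝ (fun a => g (Finsupp.single a 1)) = g := by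
    refine Finsupp.lhom_ext' fun a => LinearMap.ext_ring ?_
    simp
  refine ⟨fun a => g (Finsupp.single a 1), fun a => ?_, ?_, ?_⟩
  · refine (hg1 _).trans ?_
    change l1Norm _ ≤ 1
    rw [l1Norm_single, abs_one]
  · rwa [hlin]
  · rw [hlin]
    exact hg3

end L1Norm

/-! ### Bounded cochains of `l₁`-acyclic spaces -/

section Acyclic

variable {Y : Type*} [TopologicalSpace Y]

/-- The coboundary of an arbitrary singular cochain. -/
def cobdry {n : ℕ} (f : Sing Y n → ℝ) (σ : Sing Y (n + 1)) : ℝ :=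
  ∑ i : Fin (n + 2), (-1) ^ (i : ℕ) * f (face i σ)

theorem linearCombination_cobdry {n : ℕ} (f : Sing Y n → ℝ) (c : FinChain Y (n + 1)) :
    Finsupp.linearCombination ℝ (cobdry f) c =
      Finsupp.linearCombination ℝ f (finBdry Y n c) := by
  suffices h : Finsupp.linearCombination ℝ (cobdry f) =
      Finsupp.linearCombination ℝ f ∘ₗ finBdry Y n from LinearMap.congr_fun h c
  refine Finsupp.lhom_ext' fun σ => LinearMap.ext_ring ?_
  simp only [LinearMap.comp_apply, Finsupp.lsingle_apply, finBdry_single, map_sum,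
    Finsupp.linearCombination_single, smul_eq_mul, one_mul]
  rfl

theorem cobdry_cobdry {n : ℕ} (f : Sing Y n → ℝ) : cobdry (cobdry f) = 0 := by
  funext σ
  have h := (linearCombination_cobdry (cobdry f) (Finsupp.single σ 1)).trans
    (linearCombination_cobdry f _)
  rw [finBdry_finBdry, map_zero] at h
  simpa using h

theorem abs_cobdry_le {n : ℕ} {f : Sing Y n → ℝ} {M : ℝ} (hf : ∀ σ, |f σ| ≤ M)
    (σ : Sing Y (n + 1)) : |cobdry f σ| ≤ (n + 2) * M := by
  refine (Finset.abs_sum_le_sum_abs _ _).trans ?_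
  refine (Finset.sum_le_sum (g := fun _ => M) fun i _ => ?_).trans ?_
  · rw [abs_mul, abs_pow, abs_neg, abs_one, one_pow, one_mul]
    exact hf _
  · simp

/-! ### Bounded cohomology of a point and consequences for acyclic spaces -/

theorem sing_unit_eq {n : ℕ} (σ τ : Sing Unit n) : σ = τ := ContinuousMap.ext fun _ => rfl

theorem cobdry_unit {n : ℕ} (f : Sing Unit n → ℝ) (σ : Sing Unit n) (τ : Sing Unit (n + 1)) :
    cobdry f τ = (if Even n then 0 else 1) * f σ := by
  have h : cobdry f τ = ∑ i : Fin (n + 2), (-1 : ℝ) ^ (i : ℕ) * f σ :=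
    Finset.sum_congr rfl fun i _ => by rw [sing_unit_eq (face i τ) σ]
  rw [h, ← Finset.sum_mul, Fin.sum_neg_one_pow]
  simp [Nat.even_add]

theorem exists_cobdry_eq_unit {n : ℕ} {f : Sing Unit (n + 1) → ℝ} (hf : cobdry f = 0) :
    ∃ a : ℝ, cobdry (fun _ : Sing Unit n => a) = f := by
  let σ : Sing Unit (n + 1) := ContinuousMap.const _ ()
  refine ⟨f σ, funext fun τ => ?_⟩
  rw [cobdry_unit _ (ContinuousMap.const _ ()), sing_unit_eq τ σ]
  -- For `n` even the coboundary of `f` is `f` itself up to identification of simplices, so `f = 0`;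
  -- for `n` odd the coboundary of a constant is the same constant.
  by_cases hn : Even n
  · have h := cobdry_unit f σ (ContinuousMap.const _ ())
    rw [hf, if_neg (by rwa [Nat.not_even_iff_odd, Nat.odd_add_one, Nat.not_odd_iff_even]),
      one_mul] at h
    rw [← h]
    simp
  · rw [if_neg hn, one_mul]

theorem subsingleton_boundedCohomology_unit (n : ℕ) :
    Subsingleton (BoundedCohomology Unit (n + 1)) := by
  refine subsingleton_of_forall_eq 0 fun x => ?_
  obtain ⟨⟨f, hf⟩, rfl⟩ := Submodule.mkQ_surjective _ x
  refine (Submodule.Quotient.mk_eq_zero _).2 ?_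
  have hf' : cobdry f.1 = 0 := congrArg Subtype.val (show coboundary Unit (n + 1) f = 0 from hf)
  obtain ⟨a, ha⟩ := exists_cobdry_eq_unit hf'
  exact ⟨⟨fun _ => a, |a|, fun _ => le_rfl⟩, Subtype.ext ha⟩

theorem exists_smul_eq_boundedCohomology_unit (x y : BoundedCohomology Unit 0) (hx : x ≠ 0) :
    ∃ a : ℝ, y = a • x := by
  obtain ⟨⟨f, hf⟩, rfl⟩ := Submodule.mkQ_surjective _ x
  obtain ⟨⟨g, hg⟩, rfl⟩ := Submodule.mkQ_surjective _ y
  let σ : Sing Unit 0 := ContinuousMap.const _ ()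
  have hfσ : f.1 σ ≠ 0 := by
    intro h
    refine hx ?_
    have : f = 0 := Subtype.ext (funext fun τ => (congrArg f.1 (sing_unit_eq τ σ)).trans h)
    subst this
    exact map_zero _
  refine ⟨g.1 σ / f.1 σ, ?_⟩
  rw [← map_smul]
  congr 1
  refine Subtype.ext (Subtype.ext (funext fun τ => ?_))
  rw [sing_unit_eq τ σ]
  exact (div_mul_cancel₀ _ hfσ).symm

theorem exists_bounded_primitive (hY : IsL1Acyclic Y) {n : ℕ} {f : Sing Y (n + 1) → ℝ} {M : ℝ}
    (hf : ∀ σ, |f σ| ≤ M) (hcob : cobdry f = 0) :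
    ∃ g : Sing Y n → ℝ, (∃ M', ∀ σ, |g σ| ≤ M') ∧ cobdry g = f := by
  obtain ⟨e⟩ := hY (n + 1)
  have hs := subsingleton_boundedCohomology_unit n
  have h0 : (Submodule.Quotient.mk ⟨⟨f, M, hf⟩, Subtype.ext hcob⟩ : BoundedCohomology Y (n + 1)) =
    0 := e.injective (Subsingleton.elim _ _)
  obtain ⟨g, hg⟩ := (Submodule.Quotient.mk_eq_zero _).1 h0
  exact ⟨g.1, g.2, congrArg Subtype.val hg⟩

/-- The given isomorphism is abstract, but it shows that any two classes in degree 0 are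
proportional once one is non-zero. The constant cochain 1 is non-zero in cohomology because there
are no coboundaries in degree 0. -/
theorem exists_eq_const (hY : IsL1Acyclic Y) {f : Sing Y 0 → ℝ} {M : ℝ}
    (hf : ∀ σ, |f σ| ≤ M) (hcob : cobdry f = 0) : ∃ a, ∀ σ, f σ = a := by
  by_cases hne : Nonempty (Sing Y 0)
  · obtain ⟨σ₀⟩ := hne
    obtain ⟨e⟩ := hY 0
    have h1 : cobdry (fun _ : Sing Y 0 => (1 : ℝ)) = 0 := by
      funext σ
      simp [cobdry, Fin.sum_univ_two]
    set x : BoundedCohomology Y 0 :=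
      Submodule.Quotient.mk ⟨⟨fun _ => 1, 1, by simp⟩, Subtype.ext h1⟩ with hx
    set y : BoundedCohomology Y 0 := Submodule.Quotient.mk ⟨⟨f, M, hf⟩, Subtype.ext hcob⟩ with hy
    have hinj : ∀ g : LinearMap.ker (coboundary Y 0),
        (Submodule.Quotient.mk g : BoundedCohomology Y 0) = 0 → g = 0 := by
      intro g hg
      have h := (Submodule.Quotient.mk_eq_zero _).1 hg
      exact Subtype.ext ((Submodule.mem_bot ℝ).1 h)
    have hx0 : x ≠ 0 := by
      intro h
      have h2 := congrArg (fun g => g.1.1 σ₀) (hinj _ h)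
      exact one_ne_zero (α := ℝ) h2
    obtain ⟨a, ha⟩ := exists_smul_eq_boundedCohomology_unit (e x) (e y)
      fun h => hx0 (e.injective (h.trans (map_zero e).symm))
    have h3 : y - a • x = 0 := by
      rw [sub_eq_zero]
      exact e.injective (by rw [ha, map_smul])
    have h4 := hinj _ h3
    refine ⟨a, fun σ => ?_⟩
    have h5 : f σ - a * 1 = 0 := congrArg (fun g => g.1.1 σ) h4
    linarith
  · exact ⟨0, fun σ => absurd ⟨σ⟩ hne⟩

/-- The coboundary operator on the Banach spaces of bounded cochains. -/
def cobdryL (Y : Type*) [TopologicalSpace Y] (n : ℕ) :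
    lp (fun _ : Sing Y n => ℝ) ∞ →L[ℝ] lp (fun _ : Sing Y (n + 1) => ℝ) ∞ :=
  LinearMap.mkContinuous
    { toFun := fun f => ⟨cobdry f, memℓp_infty ⟨(n + 2) * ‖f‖, by
        rintro _ ⟨σ, rfl⟩
        exact abs_cobdry_le (fun σ => lp.norm_apply_le_norm ENNReal.top_ne_zero f σ) σ⟩⟩
      map_add' := fun f g => by
        ext σ
        simp [cobdry, mul_add, Finset.sum_add_distrib]
        rfl
      map_smul' := fun a f => by
        ext σ
        simp [cobdry, Finset.mul_sum, mul_left_comm] }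
    (n + 2) fun f => lp.norm_le_of_forall_le (by positivity) fun σ =>
      abs_cobdry_le (fun σ => lp.norm_apply_le_norm ENNReal.top_ne_zero f σ) σ

/-- The open mapping theorem, applied to the coboundary as a surjection from the Banach space of
bounded cochains onto the closed subspace of bounded cocycles. -/
theorem exists_controlled_primitive (hY : IsL1Acyclic Y) (n : ℕ) :
    ∃ C > 0, ∀ f : Sing Y (n + 1) → ℝ, (∀ σ, |f σ| ≤ 1) → cobdry f = 0 →
      ∃ g : Sing Y n → ℝ, (∀ σ, |g σ| ≤ C) ∧ cobdry g = f := by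
  have hmem : ∀ g, cobdryL Y n g ∈ (cobdryL Y (n + 1)).ker := fun g =>
    LinearMap.mem_ker.2 (Subtype.ext (cobdry_cobdry (g : Sing Y n → ℝ)))
  have : CompleteSpace (cobdryL Y (n + 1)).ker := (cobdryL Y (n + 1)).isClosed_ker.completeSpace_coe
  have hsurj : Function.Surjective ((cobdryL Y n).codRestrict _ hmem) := by
    rintro ⟨f, hf⟩
    obtain ⟨g, ⟨M, hM⟩, hg⟩ := exists_bounded_primitive hY (f := f)
      (fun σ => lp.norm_apply_le_norm ENNReal.top_ne_zero f σ)
      (congrArg (fun x : lp (fun _ : Sing Y (n + 2) => ℝ) ∞ => (x : Sing Y (n + 2) → ℝ))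
        (LinearMap.mem_ker.1 hf))
    refine ⟨⟨g, memℓp_infty ⟨M, ?_⟩⟩, Subtype.ext (Subtype.ext hg)⟩
    rintro _ ⟨σ, rfl⟩
    exact hM σ
  obtain ⟨C, hC, h⟩ := ContinuousLinearMap.exists_preimage_norm_le _ hsurj
  refine ⟨C, hC, fun f hf hcob => ?_⟩
  have hmemf : Memℓp f ∞ := memℓp_infty ⟨1, by
    rintro _ ⟨σ, rfl⟩
    exact hf σ⟩
  set F : lp (fun _ : Sing Y (n + 1) => ℝ) ∞ := ⟨f, hmemf⟩
  have hF : ‖F‖ ≤ 1 := lp.norm_le_of_forall_le zero_le_one hf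
  obtain ⟨g, hg, hgn⟩ := h ⟨F, LinearMap.mem_ker.2 (Subtype.ext hcob)⟩
  refine ⟨g, fun σ => ?_, congrArg (fun x => (x.1 : Sing Y (n + 1) → ℝ)) hg⟩
  calc |g σ| ≤ ‖g‖ := lp.norm_apply_le_norm ENNReal.top_ne_zero g σ
    _ ≤ C * ‖F‖ := hgn
    _ ≤ C * 1 := mul_le_mul_of_nonneg_left hF hC.le
    _ = C := mul_one C

theorem cobdry_eq_zero_of_vanishing {n : ℕ} {f : Sing Y n → ℝ}
    (h : ∀ s ∈ LinearMap.range (finBdry Y n), Finsupp.linearCombination ℝ f s = 0) :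
    cobdry f = 0 := by
  funext σ
  have h1 := linearCombination_cobdry f (Finsupp.single σ 1)
  rw [h _ ⟨_, rfl⟩] at h1
  simpa using h1

/-- By duality the distance from `c` to boundaries is bounded, up to `ε`, by the value at `c` of a
cocycle `f` with `|f| ≤ 1`. Writing `f` as the coboundary of `g` with `|g| ≤ C` turns this value
into that of `g` on the boundary of `c`. -/
theorem exists_filling (hY : IsL1Acyclic Y) (n : ℕ) :
    ∃ C > 0, ∀ (c : FinChain Y (n + 1)), ∀ ε > 0, ∃ b : FinChain Y (n + 2),
      l1Norm (c - finBdry Y (n + 1) b) ≤ C * l1Norm (finBdry Y n c) + ε := by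
  obtain ⟨C, hC, h⟩ := exists_controlled_primitive hY n
  refine ⟨C, hC, fun c ε hε => ?_⟩
  obtain ⟨f, hf1, hf2, _, ⟨b, rfl⟩, hb⟩ :=
    exists_function_vanishing_on (LinearMap.range (finBdry Y (n + 1))) c hε
  obtain ⟨g, hg, rfl⟩ := h f hf1 (cobdry_eq_zero_of_vanishing hf2)
  refine ⟨b, hb.le.trans (add_le_add_left ?_ ε)⟩
  rw [linearCombination_cobdry]
  exact (le_abs_self _).trans (abs_linearCombination_le hg _)

/-- A bounded cocycle of degree 0 is constant, hence vanishes on `c`; by duality `c` is at distance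
zero from boundaries. -/
theorem exists_filling_zero (hY : IsL1Acyclic Y) (c : FinChain Y 0)
    (hc : Finsupp.linearCombination ℝ (fun _ => (1 : ℝ)) c = 0) {ε : ℝ} (hε : 0 < ε) :
    ∃ b : FinChain Y 1, l1Norm (c - finBdry Y 0 b) ≤ ε := by
  obtain ⟨f, hf1, hf2, _, ⟨b, rfl⟩, hb⟩ :=
    exists_function_vanishing_on (LinearMap.range (finBdry Y 0)) c hε
  obtain ⟨a, ha⟩ := exists_eq_const hY hf1 (cobdry_eq_zero_of_vanishing hf2)
  have h : Finsupp.linearCombination ℝ f c = 0 := by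
    have hfa : Finsupp.linearCombination ℝ f c =
        a * Finsupp.linearCombination ℝ (fun _ => (1 : ℝ)) c := by
      simp only [Finsupp.linearCombination_apply, Finsupp.sum, ha, Finset.mul_sum, smul_eq_mul]
      exact Finset.sum_congr rfl fun σ _ => by ring
    rw [hfa, hc, mul_zero]
  exact ⟨b, by linarith⟩

end Acyclic

/-! ### The `l₁`-norm of singular chains -/

section ChainNorm

variable {X : Type*} [TopologicalSpace X] {n : ℕ}

theorem chainNorm_add_le (c c' : Sing X n → ℝ) :
    chainNorm (c + c') ≤ chainNorm c + chainNorm c' := by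
  rw [chainNorm, chainNorm, chainNorm, ← ENNReal.tsum_add]
  refine ENNReal.tsum_le_tsum fun σ => ?_
  rw [← ENNReal.ofReal_add (abs_nonneg _) (abs_nonneg _)]
  exact ENNReal.ofReal_le_ofReal (abs_add_le _ _)

theorem chainNorm_smul (a : ℝ) (c : Sing X n → ℝ) :
    chainNorm (a • c) = ENNReal.ofReal |a| * chainNorm c := by
  rw [chainNorm, chainNorm, ← ENNReal.tsum_mul_left]
  refine tsum_congr fun σ => ?_
  rw [← ENNReal.ofReal_mul (abs_nonneg a), ← abs_mul]
  rfl

theorem chainNorm_zero : chainNorm (0 : Sing X n → ℝ) = 0 := by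
  simp [chainNorm]

theorem chainNorm_neg (c : Sing X n → ℝ) : chainNorm (-c) = chainNorm c := by
  simp [chainNorm]

theorem chainNorm_neg_one_pow_smul (p : ℕ) (c : Sing X n → ℝ) :
    chainNorm ((-1 : ℝ) ^ p • c) = chainNorm c := by
  rw [chainNorm_smul, abs_pow, abs_neg, abs_one, one_pow, ENNReal.ofReal_one, one_mul]

theorem chainNorm_sum_le {ι : Type*} (S : Finset ι) (c : ι → Sing X n → ℝ) :
    chainNorm (∑ s ∈ S, c s) ≤ ∑ s ∈ S, chainNorm (c s) :=
  Finset.le_sum_of_subadditive chainNorm chainNorm_zero.le chainNorm_add_le S c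

theorem chainNorm_finsupp (x : FinChain X n) : chainNorm x = ENNReal.ofReal (l1Norm x) := by
  rw [chainNorm, tsum_eq_sum (s := x.support), l1Norm,
    ENNReal.ofReal_sum_of_nonneg fun _ _ => abs_nonneg _]
  intro σ hσ
  rw [Finsupp.notMem_support_iff.1 hσ, abs_zero, ENNReal.ofReal_zero]

/-! ### Chains of a subset as chains of a subspace -/

/-- A singular simplex of a subspace as a singular simplex of the ambient space. -/
def inclSing (Z : Set X) (n : ℕ) (σ : Sing Z n) : Sing X n :=
  (⟨Subtype.val, continuous_subtype_val⟩ : C(Z, X)).comp σ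

theorem inclSing_injective (Z : Set X) (n : ℕ) : Function.Injective (inclSing Z n) := by
  intro σ τ h
  exact ContinuousMap.ext fun t => Subtype.ext (DFunLike.congr_fun h t)

theorem range_inclSing_subset (Z : Set X) (n : ℕ) (σ : Sing Z n) :
    Set.range (inclSing Z n σ) ⊆ Z := by
  rintro _ ⟨t, rfl⟩
  exact (σ t).2

theorem exists_inclSing_eq {Z : Set X} {σ : Sing X n} (h : Set.range σ ⊆ Z) :
    ∃ τ, inclSing Z n τ = σ :=
  ⟨⟨fun t => ⟨σ t, h ⟨t, rfl⟩⟩, σ.continuous.subtype_mk _⟩, rfl⟩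

theorem finBdry_mapDomain_inclSing (Z : Set X) (c : FinChain Z (n + 1)) :
    finBdry X n (Finsupp.mapDomain (inclSing Z (n + 1)) c) =
      Finsupp.mapDomain (inclSing Z n) (finBdry Z n c) := by
  suffices h : finBdry X n ∘ₗ Finsupp.lmapDomain ℝ ℝ (inclSing Z (n + 1)) =
      Finsupp.lmapDomain ℝ ℝ (inclSing Z n) ∘ₗ finBdry Z n from LinearMap.congr_fun h c
  refine Finsupp.lhom_ext' fun σ => LinearMap.ext_ring ?_
  simp only [LinearMap.comp_apply, Finsupp.lsingle_apply, Finsupp.lmapDomain_apply,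
    Finsupp.mapDomain_single, finBdry_single, Finsupp.mapDomain_finsetSum]
  rfl

theorem mapDomain_inclSing_mem (Z : Set X) (c : FinChain Z n) :
    ⇑(Finsupp.mapDomain (inclSing Z n) c) ∈ finChains Z n := by
  refine ⟨(Finsupp.mapDomain (inclSing Z n) c).hasFiniteSupport, fun σ hσ => ?_⟩
  obtain ⟨τ, _, rfl⟩ := exists_of_mapDomain_ne_zero hσ
  exact range_inclSing_subset Z n τ

theorem exists_mapDomain_inclSing_eq {Z : Set X} {c : Sing X n → ℝ} (hc : c ∈ finChains Z n) :
    ∃ x : FinChain Z n, ⇑(Finsupp.mapDomain (inclSing Z n) x) = c := by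
  refine ⟨Finsupp.comapDomain (inclSing Z n) (Finsupp.ofSupportFinite c hc.1)
    (inclSing_injective Z n).injOn, ?_⟩
  rw [Finsupp.mapDomain_comapDomain _ (inclSing_injective Z n)]
  · rfl
  · intro σ hσ
    exact exists_inclSing_eq (hc.2 σ (Finsupp.mem_support_iff.1 hσ))

theorem exists_finChains_filling {Z : Set X} (hZ : IsL1Acyclic Z) (n : ℕ) :
    ∃ C > 0, ∀ c : finChains Z (n + 1), ∀ ε > 0, ∃ b : finChains Z (n + 2),
      chainNorm (c.1 - bdry b.1) ≤
        ENNReal.ofReal C * chainNorm (bdry c.1) + ENNReal.ofReal ε := by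
  obtain ⟨C, hC, h⟩ := exists_filling hZ n
  refine ⟨C, hC, fun c ε hε => ?_⟩
  obtain ⟨x, hx⟩ := exists_mapDomain_inclSing_eq c.2
  obtain ⟨b, hb⟩ := h x ε hε
  refine ⟨⟨_, mapDomain_inclSing_mem Z b⟩, ?_⟩
  rw [← hx, bdry_finsupp, bdry_finsupp, finBdry_mapDomain_inclSing, finBdry_mapDomain_inclSing,
    ← Finsupp.coe_sub, ← Finsupp.mapDomain_sub, chainNorm_finsupp, chainNorm_finsupp,
    l1Norm_mapDomain (inclSing_injective Z _), l1Norm_mapDomain (inclSing_injective Z _),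
    ← ENNReal.ofReal_mul hC.le, ← ENNReal.ofReal_add (mul_nonneg hC.le (l1Norm_nonneg _)) hε.le]
  exact ENNReal.ofReal_le_ofReal hb

theorem exists_finChains_filling_zero {Z : Set X} (hZ : IsL1Acyclic Z) (c : finChains Z 0)
    (hc : augmentation Z c = 0) {ε : ℝ} (hε : 0 < ε) :
    ∃ b : finChains Z 1, chainNorm (c.1 - bdry b.1) ≤ ENNReal.ofReal ε := by
  obtain ⟨x, hx⟩ := exists_mapDomain_inclSing_eq c.2
  have hsum : Finsupp.linearCombination ℝ (fun _ => (1 : ℝ)) x = 0 := by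
    have h1 : Finsupp.linearCombination ℝ (fun _ => (1 : ℝ))
        (Finsupp.mapDomain (inclSing Z 0) x) = 0 := by
      rw [Finsupp.linearCombination_apply, Finsupp.sum, ← hc]
      change _ = ∑ᶠ σ, c.1 σ
      rw [← hx, finsum_eq_sum_of_support_subset (s := (Finsupp.mapDomain (inclSing Z 0) x).support)]
      · simp
      · simp
    rw [Finsupp.linearCombination_mapDomain] at h1
    exact h1
  obtain ⟨b, hb⟩ := exists_filling_zero hZ x hsum hε
  refine ⟨⟨_, mapDomain_inclSing_mem Z b⟩, ?_⟩
  rw [← hx, bdry_finsupp, finBdry_mapDomain_inclSing, ← Finsupp.coe_sub, ← Finsupp.mapDomain_sub,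
    chainNorm_finsupp, l1Norm_mapDomain (inclSing_injective Z _)]
  exact ENNReal.ofReal_le_ofReal hb

theorem chainNorm_lt_top {Z : Set X} (c : finChains Z n) : chainNorm c.1 < ⊤ := by
  obtain ⟨x, hx⟩ := exists_mapDomain_inclSing_eq c.2
  rw [← hx, chainNorm_finsupp]
  exact ENNReal.ofReal_lt_top

end ChainNorm

/-! ### Small representatives in the double complex -/

section Small

theorem finite_facets {X I : Type*} [LinearOrder I] {U : I → Set X} {p : ℕ}
    (s : NerveSimplex U (p + 1)) :
    {t : NerveSimplex U p | nerveIncidence s t ≠ 0}.Finite := by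
  refine Set.Finite.of_finite_image (f := Subtype.val)
    (s.1.powerset.finite_toSet.subset ?_) Subtype.val_injective.injOn
  rintro _ ⟨t, ht, rfl⟩
  exact Finset.mem_powerset.2 (subset_of_nerveIncidence_ne_zero ht)

variable {X : Type*} [TopologicalSpace X] {I : Type*} {U : I → Set X}

/-- Only finitely many facets matter, and each imposes a condition true for all small `e`. This
converts tolerances for `p`-simplices into tolerances for `(p + 1)`-simplices. -/
theorem exists_pos_forall_facet_le {X I : Type*} [LinearOrder I] {U : I → Set X} {p : ℕ}
    {η : NerveSimplex U p → ℝ} (hη : ∀ t, 0 < η t)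
    (s : NerveSimplex U (p + 1)) : ∃ e > 0, ∀ t, |nerveIncidence s t| * e ≤ η t := by
  have h1 : ∀ t, ∀ᶠ e in nhdsWithin (0 : ℝ) (Set.Ioi 0), |nerveIncidence s t| * e ≤ η t := by
    intro t
    have h : Filter.Tendsto (fun e => |nerveIncidence s t| * e) (nhdsWithin (0 : ℝ) (Set.Ioi 0))
        (nhds (|nerveIncidence s t| * 0)) :=
      (Filter.tendsto_id.mono_left nhdsWithin_le_nhds).const_mul _
    rw [mul_zero] at h
    exact h.eventually_le_const (hη t)
  have h2 := ((Set.Finite.eventually_all (finite_facets s)).2 fun t _ => h1 t).and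
    self_mem_nhdsWithin
  obtain ⟨e, he, hpos⟩ := h2.exists
  refine ⟨e, hpos, fun t => ?_⟩
  by_cases ht : nerveIncidence s t = 0
  · rw [ht, abs_zero, zero_mul]
    exact (hη t).le
  · exact he t ht

theorem chainNorm_sumChains_le (hU : IsStarFinite U) (hP : IsProperCovering U) (q : ℕ)
    (c : DoubleChains U 0 q) :
    chainNorm (sumChains hU hP q c).1 ≤ ∑' s, chainNorm (c s).1 := by
  simp only [chainNorm]
  rw [ENNReal.tsum_comm]
  refine ENNReal.tsum_le_tsum fun σ => ?_
  have hfin := finite_support_apply hU c σ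
  change ENNReal.ofReal |∑ᶠ s, (c s).1 σ| ≤ _
  rw [finsum_eq_sum_of_support_subset (s := hfin.toFinset) _ (by simp)]
  refine (ENNReal.ofReal_le_ofReal (Finset.abs_sum_le_sum_abs _ _)).trans ?_
  rw [ENNReal.ofReal_sum_of_nonneg fun _ _ => abs_nonneg _]
  exact ENNReal.sum_le_tsum _

/-- `F` is the set of indices of members meeting `U e`: if the carrier of `s` is `U e`, then all
members indexed by `s` meet `U e`. The condition `¬ s.1 ⊆ F`, unlike inequality of carriers with `U
e`, passes to cofaces and leaves out only finitely many simplices. -/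
theorem exists_finset_isL1Acyclic (hU : IsStarFinite U) (hA : IsAlmostL1Acyclic U) :
    ∃ F : Finset I, ∀ p (s : NerveSimplex U p), ¬ s.1 ⊆ F → IsL1Acyclic s.carrier := by
  have hmem : ∀ p (s : NerveSimplex U p), s.carrier ∈ finiteIntersections U := fun p s =>
    ⟨s.2.2, s.1, s.exists_mem, rfl⟩
  rcases hA with h | ⟨e, h⟩
  · exact ⟨∅, fun p s _ => h _ (hmem p s)⟩
  · refine ⟨(hU e).toFinset, fun p s hs => h _ (hmem p s) fun he => hs fun i hi => ?_⟩
    obtain ⟨x, hx⟩ : s.carrier.Nonempty := s.2.2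
    rw [Set.Finite.mem_toFinset]
    exact ⟨x, he ▸ hx, s.carrier_subset hi hx⟩

theorem exists_doubleChains_augmentation_eq {p : ℕ} (w : NerveSimplex U p → ℝ) :
    ∃ c : DoubleChains U p 0, ∀ s, augmentation s.carrier (c s) = w s := by
  have h : ∀ s : NerveSimplex U p, ∃ c : finChains s.carrier 0, augmentation s.carrier c = w s := by
    intro s
    obtain ⟨x, hx⟩ : s.carrier.Nonempty := s.2.2
    let σ : Sing X 0 := ContinuousMap.const _ x
    refine ⟨⟨⇑(Finsupp.single σ (w s)), (Finsupp.single σ (w s)).hasFiniteSupport, ?_⟩, ?_⟩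
    · intro τ hτ
      obtain rfl : τ = σ := by
        by_contra hne
        exact hτ (Finsupp.single_eq_of_ne hne)
      rintro _ ⟨t, rfl⟩
      exact hx
    · change ∑ᶠ τ, Finsupp.single σ (w s) τ = w s
      rw [finsum_eq_single _ σ fun τ hτ => Finsupp.single_eq_of_ne hτ, Finsupp.single_eq_same]
  choose c hc using h
  exact ⟨c, hc⟩

/-! ### Propagation of smallness through the total complex -/

variable [LinearOrder I]

theorem chainNorm_vertical_le (hU : IsStarFinite U) {p q : ℕ} (c : DoubleChains U (p + 1) q)
    (t : NerveSimplex U p) :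
    chainNorm (vertical hU p q c t).1 ≤ ∑ s ∈ (finite_cofaces hU t).toFinset,
      ENNReal.ofReal |nerveIncidence s t| * chainNorm (c s).1 := by
  have h : (vertical hU p q c t).1 =
      ∑ s ∈ (finite_cofaces hU t).toFinset, nerveIncidence s t • (c s).1 := by
    funext σ
    change ∑ᶠ s, nerveIncidence s t * (c s).1 σ = _
    rw [finsum_eq_sum_of_support_subset (s := (finite_cofaces hU t).toFinset)]
    · simp [Finset.sum_apply]
    · intro s hs
      simpa using left_ne_zero_of_mul hs
  rw [h]
  refine (chainNorm_sum_le _ _).trans (Finset.sum_le_sum fun s _ => ?_)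
  rw [chainNorm_smul]

theorem gridBdry_singleGrid (hU : IsStarFinite U) (p q : ℕ) (b : DoubleChains U p (q + 1)) :
    gridBdry hU (singleGrid p (q + 1) ((-1 : ℝ) ^ p • b)) p q = horizontal U p q b := by
  rw [gridBdry_apply, singleGrid_same, singleGrid_of_ne_left _ (Nat.succ_ne_self p), map_zero,
    add_zero, map_smul, smul_smul, ← mul_pow]
  simp

/-- Tolerances are arbitrary positive functions, so the induction can demand at `(p + 1, q)`
whatever the filling constants at `(p, q + 1)` require, even if these are unbounded. The vanishing
augmentations start the induction at `(n, 0)`. -/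
theorem exists_small_column (hU : IsStarFinite U) {F : Finset I}
    (hF : ∀ p (s : NerveSimplex U p), ¬ s.1 ⊆ F → IsL1Acyclic s.carrier) {n : ℕ} {z : Grid U}
    (hz : gridBdry hU z = 0) (haug : ∀ s, augmentation s.carrier (z n 0 s) = 0) (q : ℕ) :
    ∀ p, p + q = n → ∀ ε : NerveSimplex U p → ℝ, (∀ s, 0 < ε s) →
      ∃ y : Grid U, ∀ s : NerveSimplex U p, ¬ s.1 ⊆ F →
        chainNorm ((z - gridBdry hU y) p q s).1 ≤ ENNReal.ofReal (ε s) := by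
  induction q with
  | zero =>
    rintro p rfl ε hε
    have h : ∀ s : NerveSimplex U p, ∃ b : finChains s.carrier 1, ¬ s.1 ⊆ F →
        chainNorm ((z p 0 s).1 - bdry b.1) ≤ ENNReal.ofReal (ε s) := by
      intro s
      by_cases hs : s.1 ⊆ F
      · exact ⟨0, fun h => absurd hs h⟩
      · obtain ⟨b, hb⟩ := exists_finChains_filling_zero (hF p s hs) (z p 0 s) (haug s) (hε s)
        exact ⟨b, fun _ => hb⟩
    choose b hb using h
    -- The sign of the correction cancels the sign `(-1) ^ p` in the total differential.
    refine ⟨singleGrid p 1 ((-1 : ℝ) ^ p • b), fun s hs => ?_⟩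
    rw [Pi.sub_apply, Pi.sub_apply, gridBdry_singleGrid]
    exact hb s hs
  | succ q ih =>
    intro p hpq ε hε
    have h : ∀ t : NerveSimplex U p, ∃ C : ℝ, 0 < C ∧ (¬ t.1 ⊆ F →
        ∀ c : finChains t.carrier (q + 1), ∀ ε > 0, ∃ b : finChains t.carrier (q + 2),
          chainNorm (c.1 - bdry b.1) ≤
            ENNReal.ofReal C * chainNorm (bdry c.1) + ENNReal.ofReal ε) := by
      intro t
      by_cases ht : t.1 ⊆ F
      · exact ⟨1, one_pos, fun h => absurd ht h⟩
      · obtain ⟨C, hC, h⟩ := exists_finChains_filling (hF p t ht) q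
        exact ⟨C, hC, fun _ => h⟩
    choose C hC hfill using h
    set S : NerveSimplex U p → Finset (NerveSimplex U (p + 1)) :=
      fun t => (finite_cofaces hU t).toFinset with hS
    -- At most `η t` from each coface of `t` adds up to at most `ε t / (2 * C t)`, which filling
    -- turns into `ε t / 2`; the other half is the error of filling. The `+ 1` keeps the denominator
    -- positive when there are no cofaces.
    set η : NerveSimplex U p → ℝ := fun t => ε t / (2 * C t * ((S t).card + 1)) with hη
    have hη0 : ∀ t, 0 < η t := fun t => by
      have := hC t
      have := hε t
      positivity
    choose ε' hε' hle using fun s => exists_pos_forall_facet_le hη0 s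
    obtain ⟨y, hy⟩ := ih (p + 1) (by omega) ε' hε'
    set z' := z - gridBdry hU y with hz'
    have hz'0 : gridBdry hU z' = 0 := by rw [hz', map_sub, hz, gridBdry_gridBdry, sub_zero]
    have hbdry : ∀ t : NerveSimplex U p, ¬ t.1 ⊆ F →
        chainNorm (bdry (z' p (q + 1) t).1) ≤ ENNReal.ofReal (ε t / (2 * C t)) := by
      intro t ht
      -- The cycle condition at `(p, q)` expresses this boundary through the components at `(p + 1,
      -- q)`, which are already small.
      have h1 : (-1 : ℝ) ^ p • bdry (z' p (q + 1) t).1 + (vertical hU p q (z' (p + 1) q) t).1 = 0 :=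
        congrArg (fun g : Grid U => (g p q t).1) hz'0
      rw [← chainNorm_neg_one_pow_smul p, eq_neg_of_add_eq_zero_left h1, chainNorm_neg]
      refine (chainNorm_vertical_le hU _ t).trans ?_
      have h2 : ∀ s ∈ S t, ENNReal.ofReal |nerveIncidence s t| * chainNorm (z' (p + 1) q s).1 ≤
          ENNReal.ofReal (η t) := by
        intro s hs
        -- Since `t` is not contained in `F`, neither is its coface `s`, so the bound over `s` is
        -- available.
        have hst : t.1 ⊆ s.1 := subset_of_nerveIncidence_ne_zero (by simpa [hS] using hs)
        calc _ ≤ ENNReal.ofReal |nerveIncidence s t| * ENNReal.ofReal (ε' s) := by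
              gcongr
              exact hy s fun h => ht (hst.trans h)
          _ = ENNReal.ofReal (|nerveIncidence s t| * ε' s) :=
              (ENNReal.ofReal_mul (abs_nonneg _)).symm
          _ ≤ ENNReal.ofReal (η t) := ENNReal.ofReal_le_ofReal (hle s t)
      refine (Finset.sum_le_sum h2).trans ?_
      rw [Finset.sum_const, ← ENNReal.ofReal_nsmul]
      refine ENNReal.ofReal_le_ofReal ?_
      rw [nsmul_eq_mul, hη]
      have h3 := hC t
      have h4 := hε t
      have h5 : ((S t).card : ℝ) * (ε t / (2 * C t * ((S t).card + 1))) =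
          ε t / (2 * C t) * ((S t).card / ((S t).card + 1)) := by
        field_simp
      rw [h5]
      refine mul_le_of_le_one_right (by positivity) ?_
      rw [div_le_one (by positivity)]
      linarith
    have hb : ∀ t : NerveSimplex U p, ∃ b : finChains t.carrier (q + 2), ¬ t.1 ⊆ F →
        chainNorm ((z' p (q + 1) t).1 - bdry b.1) ≤ ENNReal.ofReal (ε t) := by
      intro t
      by_cases ht : t.1 ⊆ F
      · exact ⟨0, fun h => absurd ht h⟩
      · obtain ⟨b, hb⟩ := hfill t ht (z' p (q + 1) t) (ε t / 2) (half_pos (hε t))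
        refine ⟨b, fun _ => hb.trans ?_⟩
        have h3 := hC t
        have h4 := hε t
        calc _ ≤ ENNReal.ofReal (C t) * ENNReal.ofReal (ε t / (2 * C t)) +
                ENNReal.ofReal (ε t / 2) := by
              gcongr
              exact hbdry t ht
          _ = ENNReal.ofReal (ε t) := by
              rw [← ENNReal.ofReal_mul h3.le, ← ENNReal.ofReal_add (by positivity) (by positivity)]
              congr 1
              field_simp
              norm_num
    choose b hb using hb
    refine ⟨y + singleGrid p (q + 2) ((-1 : ℝ) ^ p • b), fun s hs => ?_⟩
    rw [map_add, ← sub_sub, ← hz', Pi.sub_apply, Pi.sub_apply, gridBdry_singleGrid]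
    exact hb s hs

theorem homologyClass_ofGrid_sub (hU : IsStarFinite U) (n : ℕ) {z : Grid U}
    (hz : gridBdry hU z = 0) (y : Grid U) (hz' : gridBdry hU (z - gridBdry hU y) = 0) :
    homologyClass (fun n => Total U n) (totalBoundary hU) n ⟨_, ofGrid_mem_cycles hU n hz'⟩ =
      homologyClass _ _ n ⟨_, ofGrid_mem_cycles hU n hz⟩ := by
  refine (Submodule.Quotient.eq _).2 ⟨-ofGrid (n + 1) y, ?_⟩
  rw [map_neg, totalBoundary_ofGrid]
  exact (sub_sub_cancel_left (ofGrid n z) (ofGrid n (gridBdry hU y))).symm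

/-- A total cycle over `h` maps to a boundary in the nerve, say of `w`. Carriers are non-empty, so
`w` lifts to bidegree `(n + 1, 0)`; subtracting the total boundary of the lift makes the image in
the nerve zero already as a chain. -/
theorem exists_cycle_of_leray_eq_zero (hU : IsStarFinite U) (hP : IsProperCovering U) {n : ℕ}
    {h : CFHomology X n} (hh : leray hU hP n h = 0) :
    ∃ (z : Grid U) (hz : gridBdry hU z = 0), (∀ s, augmentation s.carrier (z n 0 s) = 0) ∧
      totalToCF hU hP n (homologyClass _ _ n ⟨_, ofGrid_mem_cycles hU n hz⟩) = h := by
  rw [leray, dif_pos (totalToCF_bijective hU hP n)] at hh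
  set x := (LinearEquiv.ofBijective _ (totalToCF_bijective hU hP n)).symm h with hx
  have hxh : totalToCF hU hP n x = h :=
    (LinearEquiv.ofBijective _ (totalToCF_bijective hU hP n)).apply_symm_apply h
  have hxN : totalToNerve hU n x = 0 := hh
  clear_value x
  obtain ⟨⟨z, hz⟩, rfl⟩ := Submodule.mkQ_surjective _ x
  obtain ⟨w, hw⟩ : ∃ w, nerveBoundary hU n w = toNerve U n z :=
    (Submodule.Quotient.mk_eq_zero _).1 hxN
  obtain ⟨c, hc⟩ := exists_doubleChains_augmentation_eq w
  set y : Grid U := singleGrid (n + 1) 0 c with hy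
  have hyw : toNerve U (n + 1) (ofGrid (n + 1) y) = w := by
    funext s
    rw [← hc s]
    change augmentation s.carrier (y (n + 1) 0 s) = _
    rw [hy, singleGrid_same]
  have hz0 := gridBdry_toGrid hU hz
  have hz1 : gridBdry hU (toGrid z - gridBdry hU y) = 0 := by
    rw [map_sub, gridBdry_gridBdry, sub_zero, hz0]
  refine ⟨toGrid z - gridBdry hU y, hz1, fun s => ?_, ?_⟩
  · have h1 : toNerve U n (ofGrid n (toGrid z - gridBdry hU y)) = 0 := by
      have h2 : ofGrid n (toGrid z - gridBdry hU y) =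
          z - totalBoundary hU n (ofGrid (n + 1) y) := by
        rw [totalBoundary_ofGrid]
        conv_rhs => rw [← ofGrid_toGrid z]
        rfl
      rw [h2, map_sub, toNerve_totalBoundary, hyw, hw, sub_self]
    exact congrFun h1 s
  · rw [homologyClass_ofGrid_sub hU n hz0 y hz1, ← hxh]
    simp only [ofGrid_toGrid]

theorem homologyNorm_le (hU : IsStarFinite U) (hP : IsProperCovering U) (n : ℕ) {z : Grid U}
    (hz : gridBdry hU z = 0) :
    homologyNorm (totalToCF hU hP n (homologyClass _ _ n ⟨_, ofGrid_mem_cycles hU n hz⟩)) ≤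
      ∑' s, chainNorm (z 0 n s).1 := by
  let c : cycles (fun n => cfChains X n) (cfBoundary X) n :=
    ⟨toCF hU hP n (ofGrid n z), map_mem_cycles _ (toCF_totalBoundary hU hP) n _
      (ofGrid_mem_cycles hU n hz)⟩
  have h : chainNorm c.1.1 ≤ ∑' s, chainNorm (z 0 n s).1 :=
    chainNorm_sumChains_le hU hP n (z 0 n)
  unfold homologyNorm
  exact (iInf_le_of_le c (iInf_le _ rfl)).trans h

theorem tsum_lt_top_of_le {ι : Type*} {f g : ι → ℝ≥0∞} {S : Set ι} (hS : S.Finite)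
    (hf : ∀ s, f s < ⊤) (hle : ∀ s, s ∉ S → f s ≤ g s) (hg : ∑' s, g s < ⊤) : ∑' s, f s < ⊤ := by
  classical
  calc ∑' s, f s ≤ ∑' s, (g s + if s ∈ hS.toFinset then f s else 0) := by
        refine ENNReal.tsum_le_tsum fun s => ?_
        by_cases hs : s ∈ S
        · rw [if_pos ((Set.Finite.mem_toFinset hS).2 hs)]
          exact le_add_self
        · exact (hle s hs).trans le_self_add
    _ = ∑' s, g s + ∑ s ∈ hS.toFinset, f s := by
        rw [ENNReal.tsum_add, tsum_eq_sum (s := hS.toFinset)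
          (f := fun s => if s ∈ hS.toFinset then f s else 0) fun s hs => if_neg hs]
        congr 1
        exact Finset.sum_congr rfl fun s hs => if_pos hs
    _ < ⊤ := ENNReal.add_lt_top.2 ⟨hg, ENNReal.sum_lt_top.2 fun s _ => hf s⟩

end Small

end LerayCF

end

/-! ### Proof of the theorem -/

theorem mainTheorem9 {X : Type*} [TopologicalSpace X] {I : Type*} [LinearOrder I] [Countable I]
    (U : I → Set X) (hstar : LerayCF.IsStarFinite U) (hproper : LerayCF.IsProperCovering U)
    (hacyclic : LerayCF.IsAlmostL1Acyclic U)
    (n : ℕ) (h : LerayCF.CFHomology X n)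
    (hker : h ∈ LinearMap.ker (LerayCF.leray hstar hproper n)) :
    LerayCF.homologyNorm h < ⊤ := by
  obtain ⟨z, hz, haug, rfl⟩ :=
    LerayCF.exists_cycle_of_leray_eq_zero hstar hproper (LinearMap.mem_ker.1 hker)
  obtain ⟨F, hF⟩ := LerayCF.exists_finset_isL1Acyclic hstar hacyclic
  -- There are countably many vertices of the nerve, so positive tolerances with sum less than 1
  -- exist.
  obtain ⟨ε, hε, hsum⟩ :=
    ENNReal.exists_pos_sum_of_countable one_ne_zero (LerayCF.NerveSimplex U 0)
  obtain ⟨y, hy⟩ := LerayCF.exists_small_column hstar hF hz haug n 0 (zero_add n)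
    (fun s => (ε s : ℝ)) fun s => hε s
  have hz' : LerayCF.gridBdry hstar (z - LerayCF.gridBdry hstar y) = 0 := by
    rw [map_sub, LerayCF.gridBdry_gridBdry, hz, sub_zero]
  rw [← LerayCF.homologyClass_ofGrid_sub hstar n hz y hz']
  refine (LerayCF.homologyNorm_le hstar hproper n hz').trans_lt ?_
  -- Over these vertices nothing is made small, but there are finitely many of them and each carries
  -- a finite chain.
  have hfin : {s : LerayCF.NerveSimplex U 0 | s.1 ⊆ F}.Finite :=
    Set.Finite.of_finite_image (f := Subtype.val) (F.powerset.finite_toSet.subset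
      (by rintro _ ⟨s, hs, rfl⟩; exact Finset.mem_powerset.2 hs)) Subtype.val_injective.injOn
  exact LerayCF.tsum_lt_top_of_le hfin (fun s => LerayCF.chainNorm_lt_top _)
    (fun s hs => (hy s hs).trans_eq ENNReal.ofReal_coe_nnreal) (hsum.trans_le le_top)
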